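/- **Setting.** $M=(\mathcal S,\mathcal A,P,r,H,d_1)$ is a finite-horizon time-inhomogeneous MDP with finite state and action spaces, $S=|\mathcal S|$, $A=|\mathcal A|$, horizon $H\ge 1$, initial distribution $d_1$, transition kernels $P_h(\cdot\mid s,a)$ and random rewards $r_h\in[0,1]$ whose law depends on $(h,s_h,a_h)$; given $(s_h,a_h)$ the reward is independent of $s_{h+1}$. A policy is $\pi=(\pi_1,\dots,\pi_H)$ with $\pi_h(\cdot\mid s)$ a distribution on $\mathcal A$; $v^\pi=\mathbb E_\pi[\sum_{h=1}^H r_h]$, $v^\star=\sup_\pi v^\pi$, and $d^\pi_h(s,a)=\mathbb P_\pi(s_h=s,a_h=a)$. The data $\mathcal D$ consist of $n$ i.i.d. episodes $(s_1^\tau,a_1^\tau,r_1^\tau,\dots,s_H^\tau,a_H^\tau,r_H^\tau,s_{H+1}^\tau)$ generated by a behaviour policy $\mu$. Put $\bar d_m=\min\{d^\mu_h(s,a): d^\mu_h(s,a)>0\}$ and $\iota=\log(HSA/\delta)$. **APVI** (Adaptive Pessimistic Value Iteration) with failure probability $\delta$. Let $n_{h}(s,a)$ be the number of episodes with $(s_h^\tau,a_h^\tau)=(s,a)$,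 and let $\widehat P_h(\cdot\mid s,a)$ and $\widehat r_h(s,a)$ be the empirical next-state distribution and the empirical mean reward over these episodes ($\widehat P_h=1/S$, $\widehat r_h=0$ if there are none). Set $\widehat V_{H+1}=0$ and, for $h=H,\dots,1$, $$\widehat Q_h=\widehat r_h+\widehat P_h\widehat V_{h+1},\qquad \overline Q_h=\max\{\min\{\widehat Q_h-\Gamma_h,\,H-h+1\},0\},$$ $$\Gamma_h(s,a)=2\sqrt{\frac{\widehat{\mathrm{Var}}_{h,s,a}(r_h+\widehat V_{h+1}(s_{h+1}))\,\iota}{n_h(s,a)}}+\frac{14H\iota}{n_h(s,a)}\ \text{ if } n_h(s,a)\ge1,\qquad \Gamma_h(s,a)=CH\iota\ \text{ otherwise},$$ where $\widehat{\mathrm{Var}}_{h,s,a}$ is the empirical variance over the episodes visiting $(s,a)$ at step $h$ (normalized by $n_h(s,a)$) and $C\ge 2$ is a constant. For every $s$ let $\widehat\pi_h(\cdot\mid s)$ be a distribution maximizing $\langle\overline Q_h(s,\cdot),\widehat\pi_h(\cdot\mid s)\rangle$, and let $\widehat V_h(s)$ be this maximum. The output is $\widehat\pi=(\widehat\pi_1,\dots,\widehat\pi_H)$.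 **Proposition.** There are absolute constants $c_0,C'>0$ and $k\in\mathbb N$ such that the following holds for all such $M$, $\mu$ and $C\ge 2$. Let $\pi^\star$ be a deterministic optimal policy (that is, $v^{\pi^\star}=v^\star$) with $$C^\star:=\max_{h,s,a}\frac{d^{\pi^\star}_h(s,a)}{d^\mu_h(s,a)}<\infty\qquad(0/0:=0,\ x/0:=\infty\text{ for }x>0).$$ Then for every $0<\delta<1$ and every $n>c_0\,\iota/\bar d_m$, with probability at least $1-\delta$ every output $\widehat\pi$ of APVI (whatever the rule for breaking ties in the $\mathrm{argmax}$) satisfies $$0\le v^\star-v^{\widehat\pi}\le C'\sqrt{\frac{H^3SC^\star\,\iota}{n}}+C'\,\frac{H^3\,\log^k(HSAn/\delta)}{n\,\bar d_m}.$$ In other words, the suboptimality gap is $\widetilde O\big(\sqrt{H^3SC^\star/n}\big)$, where $\widetilde O$ hides logarithmic factors and the higher-order term of order $1/n$. -/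

import Mathlib

open MeasureTheory

noncomputable section

namespace OfflineRL

/-- A finite-horizon, time-inhomogeneous Markov decision process with states `S`, actions `A` and
horizon `H`. Step `h : Fin H` (counted from `0`) is the step `h + 1` of the usual notation.
`R h s a` is the law of the random reward received at step `h` in state `s` under action `a`;
rewards lie in `[0, 1]`. -/
structure MDP (S A : Type*) [Fintype S] (H : ℕ) where
  init : S → ℝ
  init_nonneg : ∀ s, 0 ≤ init s
  init_sum : ∑ s, init s = 1
  P : Fin H → S → A → S → ℝ
  P_nonneg : ∀ h s a s', 0 ≤ P h s a s'
  P_sum : ∀ h s a, ∑ s', P h s a s' = 1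
  R : Fin H → S → A → Measure ℝ
  R_prob : ∀ h s a, IsProbabilityMeasure (R h s a)
  R_mem : ∀ h s a, ∀ᵐ x ∂(R h s a), x ∈ Set.Icc (0 : ℝ) 1

/-- A (Markov, possibly randomized) policy: `π.prob h s a` is `π_h(a | s)`. -/
structure Policy (S A : Type*) [Fintype A] (H : ℕ) where
  prob : Fin H → S → A → ℝ
  prob_nonneg : ∀ h s a, 0 ≤ prob h s a
  prob_sum : ∀ h s, ∑ a, prob h s a = 1

/-- The policy plays a single action in every state at every step. -/
def Policy.IsDeterministic {S A : Type*} [Fintype A] {H : ℕ} (π : Policy S A H) : Prop :=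
  ∀ h s, ∃ a, π.prob h s a = 1

/-- One episode: the states `s_1, …, s_{H+1}`, the actions `a_1, …, a_H` and the rewards
`r_1, …, r_H`. -/
abbrev Episode (S A : Type*) (H : ℕ) : Type _ :=
  (Fin (H + 1) → S) × (Fin H → A) × (Fin H → ℝ)

/-- The state at step `h`. -/
def Episode.state {S A : Type*} {H : ℕ} (e : Episode S A H) (h : Fin H) : S := e.1 h.castSucc

/-- The action at step `h`. -/
def Episode.action {S A : Type*} {H : ℕ} (e : Episode S A H) (h : Fin H) : A := e.2.1 h

/-- The reward at step `h`. -/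
def Episode.reward {S A : Type*} {H : ℕ} (e : Episode S A H) (h : Fin H) : ℝ := e.2.2 h

/-- The state that follows step `h`. -/
def Episode.next {S A : Type*} {H : ℕ} (e : Episode S A H) (h : Fin H) : S := e.1 h.succ

section Model

variable {S A : Type*} [Fintype S] [Fintype A] {H : ℕ}

/-- The probability that an episode of `M` under `π` runs through the states `s` and the
actions `a`. -/
def pathProb (M : MDP S A H) (π : Policy S A H) (s : Fin (H + 1) → S) (a : Fin H → A) : ℝ :=
  M.init (s 0) *
    ∏ h : Fin H, π.prob h (s h.castSucc) (a h) * M.P h (s h.castSucc) (a h) (s h.succ)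

/-- The law of one episode of `M` under `π`: `s_1 ∼ d_1`, `a_h ∼ π_h(· | s_h)`,
`r_h ∼ R_h(s_h, a_h)` and `s_{h+1} ∼ P_h(· | s_h, a_h)`, where the rewards are independent of each
other given the states and actions. -/
def episodeLaw [MeasurableSpace S] [MeasurableSpace A] (M : MDP S A H) (π : Policy S A H) :
    Measure (Episode S A H) :=
  ∑ s : Fin (H + 1) → S, ∑ a : Fin H → A,
    ENNReal.ofReal (pathProb M π s a) •
      (Measure.pi fun h : Fin H => M.R h (s h.castSucc) (a h)).map fun r => (s, a, r)

theorem sum_path_aux (H : ℕ) (f : S → ℝ) (p : Fin H → S → A → ℝ) (P : Fin H → S → A → S → ℝ)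
    (hp : ∀ h s, ∑ a, p h s a = 1) (hP : ∀ h s a, ∑ s', P h s a s' = 1) :
    ∑ s : Fin (H + 1) → S, ∑ a : Fin H → A,
      f (s 0) * ∏ h : Fin H, p h (s h.castSucc) (a h) * P h (s h.castSucc) (a h) (s h.succ)
      = ∑ x, f x := by
  induction H generalizing f with
  | zero =>
    simp only [Finset.univ_eq_empty, Finset.prod_empty, mul_one, Finset.sum_const,
      Finset.card_univ, Fintype.card_unique, one_smul]
    exact Fintype.sum_equiv (Equiv.funUnique (Fin 1) S) _ _ (fun s => rfl)
  | succ H ih =>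
    have key := ih (fun y => ∑ x, ∑ b, f x * (p 0 x b * P 0 x b y)) (fun h => p h.succ)
      (fun h => P h.succ) (fun h s => hp _ s) (fun h s a => hP _ s a)
    have hR : ∑ y, ∑ x, ∑ b, f x * (p 0 x b * P 0 x b y) = ∑ x, f x := by
      rw [Finset.sum_comm]
      refine Finset.sum_congr rfl fun x _ => ?_
      rw [Finset.sum_comm]
      simp only [← Finset.mul_sum, hP, mul_one, hp]
    rw [← hR, ← key]
    rw [← (Fin.consEquiv fun _ : Fin (H + 2) => S).sum_comp, Fintype.sum_prod_type,
      Finset.sum_comm]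
    refine Finset.sum_congr rfl fun s _ => ?_
    simp only [← (Fin.consEquiv fun _ : Fin (H + 1) => A).sum_comp, Fintype.sum_prod_type]
    simp only [Finset.sum_mul]
    symm
    rw [Finset.sum_comm]
    refine Finset.sum_congr rfl fun x _ => ?_
    rw [Finset.sum_comm]
    refine Finset.sum_congr rfl fun b _ => ?_
    refine Finset.sum_congr rfl fun a _ => ?_
    rw [Fin.prod_univ_succ]
    simp [Fin.consEquiv, mul_assoc]

theorem pathProb_nonneg (M : MDP S A H) (π : Policy S A H) (s : Fin (H + 1) → S) (a : Fin H → A) :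
    0 ≤ pathProb M π s a :=
  mul_nonneg (M.init_nonneg _)
    (Finset.prod_nonneg fun _ _ => mul_nonneg (π.prob_nonneg _ _ _) (M.P_nonneg _ _ _ _))

instance [MeasurableSpace S] [MeasurableSpace A] (M : MDP S A H) (π : Policy S A H) :
    IsProbabilityMeasure (episodeLaw M π) := by
  constructor
  have hR : ∀ h s a, IsProbabilityMeasure (M.R h s a) := M.R_prob
  have h1 : ∀ (s : Fin (H + 1) → S) (a : Fin H → A),
      ((Measure.pi fun h : Fin H => M.R h (s h.castSucc) (a h)).map
        fun r => ((s, a, r) : Episode S A H)) Set.univ = 1 := fun s a => by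
    rw [Measure.map_apply (by fun_prop) MeasurableSet.univ]; simp
  simp only [episodeLaw, Measure.coe_finsetSum, Finset.sum_apply, Measure.smul_apply, h1,
    smul_eq_mul, mul_one]
  have h2 := sum_path_aux H M.init π.prob M.P π.prob_sum M.P_sum
  have h3 : ∑ s : Fin (H + 1) → S, ∑ a : Fin H → A, pathProb M π s a = 1 := by
    rw [← M.init_sum, ← h2]; rfl
  rw [← ENNReal.ofReal_one, ← h3,
    ENNReal.ofReal_sum_of_nonneg fun s _ => Finset.sum_nonneg fun a _ => pathProb_nonneg M π s a]
  refine Finset.sum_congr rfl fun s _ => ?_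
  exact (ENNReal.ofReal_sum_of_nonneg fun a _ => pathProb_nonneg M π s a).symm

variable [MeasurableSpace S] [MeasurableSpace A]

/-- The marginal state-action probability `d^π_h(s, a)`. -/
def occupancy (M : MDP S A H) (π : Policy S A H) (h : Fin H) (s : S) (a : A) : ℝ :=
  (episodeLaw M π).real {e | e.state h = s ∧ e.action h = a}

/-- The performance `v^π`: the expected total reward of an episode under `π`. -/
def value (M : MDP S A H) (π : Policy S A H) : ℝ :=
  ∫ e, ∑ h : Fin H, e.reward h ∂(episodeLaw M π)

/-- The optimal performance `v^⋆`. -/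
def optimalValue (M : MDP S A H) : ℝ := ⨆ π : Policy S A H, value M π

/-- The single-policy concentrability coefficient `max_{h,s,a} d^π_h(s,a) / d^μ_h(s,a)`, with
`0 / 0 = 0` and `x / 0 = ∞` for `x > 0`. -/
def concentrability (M : MDP S A H) (π μ : Policy S A H) : ENNReal :=
  ⨆ (h : Fin H) (s : S) (a : A),
    ENNReal.ofReal (occupancy M π h s a) / ENNReal.ofReal (occupancy M μ h s a)

/-- The smallest positive value of `d^μ_h(s, a)`. -/
def minOccupancy (M : MDP S A H) (μ : Policy S A H) : ℝ :=
  sInf {x : ℝ | 0 < x ∧ ∃ h s a, occupancy M μ h s a = x}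

/-- The law of `n` independent episodes collected with the behaviour policy `μ`. -/
def dataLaw (M : MDP S A H) (μ : Policy S A H) (n : ℕ) : Measure (Fin n → Episode S A H) :=
  Measure.pi fun _ => episodeLaw M μ

end Model

section Algorithm

variable {S A : Type*} [Fintype S] [Fintype A] {H n : ℕ}

open Classical in
/-- The episodes of the data set that visit `(s, a)` at step `h`. -/
def visits (D : Fin n → Episode S A H) (h : Fin H) (s : S) (a : A) : Finset (Fin n) :=
  {τ | (D τ).state h = s ∧ (D τ).action h = a}

/-- The number `n_{s_h, a_h}` of visits to `(s, a)` at step `h`. -/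
def count (D : Fin n → Episode S A H) (h : Fin H) (s : S) (a : A) : ℕ := (visits D h s a).card

open Classical in
/-- The plug-in estimate of the transition kernel; uniform at pairs that were never visited. -/
def Phat (D : Fin n → Episode S A H) (h : Fin H) (s : S) (a : A) (s' : S) : ℝ :=
  if count D h s a = 0 then 1 / Fintype.card S
  else ({τ ∈ visits D h s a | (D τ).next h = s'} : Finset (Fin n)).card / count D h s a

/-- The plug-in estimate of the mean reward; zero at pairs that were never visited. -/
def rhat (D : Fin n → Episode S A H) (h : Fin H) (s : S) (a : A) : ℝ :=
  if count D h s a = 0 then 0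
  else (∑ τ ∈ visits D h s a, (D τ).reward h) / count D h s a

/-- `Q̂_h(s, a) = r̂_h(s, a) + (P̂_h V)(s, a)`. -/
def Qhat (D : Fin n → Episode S A H) (h : Fin H) (V : S → ℝ) (s : S) (a : A) : ℝ :=
  rhat D h s a + ∑ s', Phat D h s a s' * V s'

/-- The empirical variance of `r_h + V(s_{h+1})` over the observed visits to `(s, a)` at step `h`.
The mean of `r_h + V(s_{h+1})` over these visits is `Q̂_h(s, a)`. -/
def varHat (D : Fin n → Episode S A H) (h : Fin H) (V : S → ℝ) (s : S) (a : A) : ℝ :=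
  (∑ τ ∈ visits D h s a, ((D τ).reward h + V ((D τ).next h) - Qhat D h V s a) ^ 2) /
    count D h s a

/-- `ι = log (H S A / δ)`. -/
def iota (S A : Type*) [Fintype S] [Fintype A] (H : ℕ) (δ : ℝ) : ℝ :=
  Real.log (H * Fintype.card S * Fintype.card A / δ)

/-- The Bernstein-type pessimistic penalty, with the constants `C₁ = 2` and `C₂ = 14` at visited
pairs and the constant `C` at pairs that were never visited. -/
def penalty (D : Fin n → Episode S A H) (δ C : ℝ) (h : Fin H) (V : S → ℝ) (s : S) (a : A) : ℝ :=
  if 1 ≤ count D h s a then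
    2 * √(varHat D h V s a * iota S A H δ / count D h s a)
      + 14 * H * iota S A H δ / count D h s a
  else C * H * iota S A H δ

/-- The pessimistic update: `min {Q̂_h - Γ_h, H - h + 1}^+` for the step `h` counted from `1`. -/
def Qbar (D : Fin n → Episode S A H) (δ C : ℝ) (h : Fin H) (V : S → ℝ) (s : S) (a : A) : ℝ :=
  max (min (Qhat D h V s a - penalty D δ C h V s a) ((H : ℝ) - (h : ℕ))) 0

/-- `πhat` is an output of Adaptive Pessimistic Value Iteration on the data set `D` with failure
probability `δ`, for some way to break ties in the `argmax`. -/
def IsAPVIOutput (D : Fin n → Episode S A H) (δ C : ℝ) (πhat : Policy S A H) : Prop :=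
  ∃ V : Fin (H + 1) → S → ℝ, (∀ s, V (Fin.last H) s = 0) ∧
    ∀ (h : Fin H) (s : S),
      (∀ q : A → ℝ, (∀ a, 0 ≤ q a) → ∑ a, q a = 1 →
        ∑ a, Qbar D δ C h (V h.succ) s a * q a
          ≤ ∑ a, Qbar D δ C h (V h.succ) s a * πhat.prob h s a) ∧
      V h.castSucc s = ∑ a, Qbar D δ C h (V h.succ) s a * πhat.prob h s a

end Algorithm

end OfflineRL

end

set_option linter.unusedSectionVars false

/-! Notation: `L` is ι, Λ = log(HSAn/δ), N = n·d̄_m, and V̂ is the pessimistic value computed by the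
algorithm. The gap is split at the expected initial pessimistic value: v* − v^π̂ = (v* − E V̂₁) + (E
V̂₁ − v^π̂). The second bracket has to be of higher order (approximate pessimism), and the first
carries the leading term.

Second bracket. It suffices that Q̄_h ≤ r_h + P_h V̂_{h+1} + ε with ε = O(H²Λ³/N), since ε then
accumulates over at most H steps (`init_stableV_sub_value_le`). The obstacle is that V̂_{h+1} is
computed from the very episodes that estimate step h, so the summands r + V̂_{h+1}(s') are not
independent. The penalty leaves no room for a union bound over value functions: 2√L times the
empirical deviation is exactly an empirical Bernstein bound at confidence exp(−2L) for one fixed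
function. The remedy is algorithmic stability. A surrogate of V̂, in which sample sizes are bounded
below by N/2, changes by at most β = O(H²L/N) when one episode is replaced (`bddDiff_stableV`).
Perturbations pass through each backward step with factor at most 1 + 1/H, hence grow by at most e
over the horizon. For stable functions, the deviation of the sum is that of an independent sum, with
the averaged function in place of the random one, plus a decoupling error of order mβ·log m·L for m
visits (`measure_sum_gt_stable_bernstein`). Dividing by m leaves a term of order 1/N. The decoupling
error is bounded by recursive halving of the sample (`integral_exp_decoupled_le`). Conditioning on
which episodes visit (s,a) at step h makes those episodes i.i.d. (`measure_coordsIn_le`). On regular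
data the surrogate coincides with V̂ (`IsAPVIOutput.stableV_eq`).

First bracket. V* − V̂ is telescoped along π* in the empirical model. The local errors are the
deviation of the empirical Bellman update at the fixed function V*, which raises no dependence
problem, and the penalty at V̂. Both are of Bernstein form √(L·variance/count) + HL/count.
Cauchy–Schwarz separates the variances from the inverse counts. The law of total variance for the
empirical chain bounds the sum of the variances by O(H² + H·error), a self-bounding inequality
(`wsum_le_of_bernstein`). The sum of the inverse counts under the empirical occupancy of π* is
transferred to the true model by a multiplicative Chernoff bound with relative error 1/H per step
(`wsum_le_of_multiplicative`). There it is at most HSC*/n, because a deterministic policy uses one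
action per state. Altogether the leading term is H·√(L·HSC*/n).

The cases A = 1, N < 80H²L and leading term above H are trivial and are removed beforehand. -/

namespace OfflineRL

/-! ### Averaging over blocks of coordinates of a product measure -/

/-- Bounded measurable real functions. -/
structure BddMeas {X : Type*} [MeasurableSpace X] (g : X → ℝ) : Prop where
  meas : Measurable g
  bdd : ∃ c, ∀ x, |g x| ≤ c

namespace BddMeas

variable {X : Type*} [MeasurableSpace X] {f g : X → ℝ}

theorem const (c : ℝ) : BddMeas fun _ : X => c := ⟨measurable_const, |c|, fun _ => le_rfl⟩

theorem add (hf : BddMeas f) (hg : BddMeas g) : BddMeas fun x => f x + g x := by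
  obtain ⟨c, hc⟩ := hf.bdd
  obtain ⟨d, hd⟩ := hg.bdd
  exact ⟨hf.meas.add hg.meas, c + d, fun x => (abs_add_le _ _).trans (add_le_add (hc x) (hd x))⟩

theorem mul (hf : BddMeas f) (hg : BddMeas g) : BddMeas fun x => f x * g x := by
  obtain ⟨c, hc⟩ := hf.bdd
  obtain ⟨d, hd⟩ := hg.bdd
  refine ⟨hf.meas.mul hg.meas, c * d, fun x => ?_⟩
  rw [abs_mul]
  exact mul_le_mul (hc x) (hd x) (abs_nonneg _) ((abs_nonneg _).trans (hc x))

theorem const_mul (c : ℝ) (hf : BddMeas f) : BddMeas fun x => c * f x := (const c).mul hf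

theorem sub (hf : BddMeas f) (hg : BddMeas g) : BddMeas fun x => f x - g x := by
  have := hf.add (hg.const_mul (-1))
  simpa [sub_eq_add_neg] using this

theorem pow (hf : BddMeas f) (n : ℕ) : BddMeas fun x => f x ^ n := by
  induction n with
  | zero => simpa using const (X := X) 1
  | succ n ih => simpa [pow_succ] using ih.mul hf

theorem sum {κ : Type*} (s : Finset κ) {F : κ → X → ℝ} (h : ∀ i ∈ s, BddMeas (F i)) :
    BddMeas fun x => ∑ i ∈ s, F i x := by
  classical
  induction s using Finset.induction_on with
  | empty => simpa using const (X := X) 0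
  | insert a s ha ih =>
    simp only [Finset.sum_insert ha]
    exact (h a (by simp)).add (ih fun i hi => h i (by simp [hi]))

theorem exp (hf : BddMeas f) : BddMeas fun x => Real.exp (f x) := by
  obtain ⟨c, hc⟩ := hf.bdd
  refine ⟨hf.meas.exp, Real.exp c, fun x => ?_⟩
  rw [abs_of_pos (Real.exp_pos _)]
  exact Real.exp_le_exp.2 ((le_abs_self _).trans (hc x))

theorem comp {Y : Type*} [MeasurableSpace Y] (hf : BddMeas f) {φ : Y → X} (hφ : Measurable φ) :
    BddMeas fun y => f (φ y) :=
  ⟨hf.meas.comp hφ, hf.bdd.imp fun _ hc _ => hc _⟩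

theorem integrable (hf : BddMeas f) (ν : Measure X) [IsFiniteMeasure ν] : Integrable f ν := by
  obtain ⟨c, hc⟩ := hf.bdd
  exact Integrable.of_bound hf.meas.aestronglyMeasurable c (Filter.Eventually.of_forall hc)

end BddMeas

section Average

variable {ι E : Type*} [Fintype ι] [DecidableEq ι] [MeasurableSpace E]

theorem measurable_piecewise_coord (B : Finset ι) :
    Measurable fun p : (ι → E) × (ι → E) => B.piecewise p.2 p.1 := by
  refine measurable_pi_lambda _ fun i => ?_
  by_cases h : i ∈ B
  · simp only [Finset.piecewise_eq_of_mem _ _ _ h]; fun_prop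
  · simp only [Finset.piecewise_eq_of_notMem _ _ _ h]; fun_prop

theorem measurePreserving_piecewise_coord (Q : ι → Measure E) [∀ i, IsProbabilityMeasure (Q i)]
    (B : Finset ι) :
    MeasurePreserving (fun p : (ι → E) × (ι → E) => B.piecewise p.2 p.1)
      ((Measure.pi Q).prod (Measure.pi Q)) (Measure.pi Q) := by
  refine ⟨measurable_piecewise_coord B, ?_⟩
  symm
  refine Measure.pi_eq fun s hs => ?_
  rw [Measure.map_apply (measurable_piecewise_coord B) (MeasurableSet.univ_pi hs)]
  have : (fun p : (ι → E) × (ι → E) => B.piecewise p.2 p.1) ⁻¹' (Set.univ.pi s)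
      = (Set.univ.pi fun i => if i ∈ B then Set.univ else s i) ×ˢ
        (Set.univ.pi fun i => if i ∈ B then s i else Set.univ) := by
    ext p
    simp only [Set.mem_preimage, Set.mem_pi, Set.mem_univ, true_imp_iff, Set.mem_prod]
    constructor
    · intro h
      constructor <;> intro i <;> have := h i <;> by_cases hi : i ∈ B <;>
        simp_all [Finset.piecewise]
    · rintro ⟨h1, h2⟩ i
      have := h1 i
      have := h2 i
      by_cases hi : i ∈ B <;> simp_all [Finset.piecewise]
  rw [this, Measure.prod_prod, Measure.pi_pi, Measure.pi_pi, ← Finset.prod_mul_distrib]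
  refine Finset.prod_congr rfl fun i _ => ?_
  by_cases hi : i ∈ B <;> simp [hi]

variable (Q : ι → Measure E)

/-- The average of `g` over the coordinates in `B`, the others being fixed. -/
noncomputable def blockAvg (B : Finset ι) (g : (ι → E) → ℝ) (x : ι → E) : ℝ :=
  ∫ y, g (B.piecewise y x) ∂(Measure.pi Q)

/-- `g` does not depend on the coordinates in `B`. -/
def FreeOf (B : Finset ι) (g : (ι → E) → ℝ) : Prop := ∀ x y, g (B.piecewise y x) = g x

/-- Changing one coordinate in `B` changes `g` by at most `β`. -/
def BddDiff (B : Finset ι) (β : ℝ) (g : (ι → E) → ℝ) : Prop :=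
  ∀ i ∈ B, ∀ x v, |g (Function.update x i v) - g x| ≤ β

theorem piecewise_piecewise_union (B C : Finset ι) (x y z : ι → E) :
    C.piecewise z (B.piecewise y x) = (B ∪ C).piecewise (C.piecewise z y) x := by
  funext i
  by_cases h1 : i ∈ C <;> by_cases h2 : i ∈ B <;> simp [h1, h2]

theorem FreeOf.mono {B C : Finset ι} {g : (ι → E) → ℝ} (h : FreeOf C g) (hBC : B ⊆ C) :
    FreeOf B g := fun x y => by
  have h1 := h (B.piecewise y x) x
  have h2 : C.piecewise x (B.piecewise y x) = x := by
    funext i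
    by_cases h1 : i ∈ C <;> by_cases h2 : i ∈ B <;> simp [h1, h2]
    exact absurd (hBC h2) h1
  rw [h2] at h1
  exact h1.symm

theorem piecewise_singleton_eq_update (i : ι) (x y : ι → E) :
    ({i} : Finset ι).piecewise y x = Function.update x i (y i) := by
  funext j
  by_cases h : j = i
  · subst h; simp
  · simp [h]

theorem BddDiff.mono {B C : Finset ι} {β : ℝ} {g : (ι → E) → ℝ} (h : BddDiff C β g) (hBC : B ⊆ C) :
    BddDiff B β g := fun i hi => h i (hBC hi)

variable [∀ i, IsProbabilityMeasure (Q i)]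

variable {Q} {B C : Finset ι} {f g : (ι → E) → ℝ}

theorem BddMeas.section (hg : BddMeas g) (B : Finset ι) (x : ι → E) :
    BddMeas fun y => g (B.piecewise y x) :=
  hg.comp ((measurable_piecewise_coord B).comp (measurable_const.prodMk measurable_id))

theorem BddMeas.blockAvg (hg : BddMeas g) (B : Finset ι) : BddMeas (blockAvg Q B g) := by
  refine ⟨?_, ?_⟩
  · have h : StronglyMeasurable fun p : (ι → E) × (ι → E) => g (B.piecewise p.2 p.1) :=
      (hg.meas.comp (measurable_piecewise_coord B)).stronglyMeasurable
    exact h.integral_prod_right.measurable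
  · obtain ⟨c, hc⟩ := hg.bdd
    refine ⟨c, fun x => ?_⟩
    have := norm_integral_le_of_norm_le_const (μ := Measure.pi Q)
      (f := fun y => g (B.piecewise y x)) (Filter.Eventually.of_forall fun y => hc _)
    simpa [OfflineRL.blockAvg] using this

theorem integral_blockAvg (hg : BddMeas g) (B : Finset ι) :
    ∫ x, blockAvg Q B g x ∂(Measure.pi Q) = ∫ x, g x ∂(Measure.pi Q) := by
  have h := (measurePreserving_piecewise_coord Q B)
  have hi : Integrable (fun p : (ι → E) × (ι → E) => g (B.piecewise p.2 p.1))
      ((Measure.pi Q).prod (Measure.pi Q)) :=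
    (hg.comp (measurable_piecewise_coord B)).integrable _
  have h1 := integral_prod _ hi
  rw [← h.map_eq, integral_map h.measurable.aemeasurable hg.meas.aestronglyMeasurable, h1]
  simp only [h.map_eq]
  rfl

theorem blockAvg_blockAvg (hg : BddMeas g) :
    blockAvg Q B (blockAvg Q C g) = blockAvg Q (B ∪ C) g := by
  funext x
  have h := integral_blockAvg (Q := Q) (hg.section (B ∪ C) x) C
  rw [blockAvg, blockAvg, ← h]
  refine integral_congr_ae (Filter.Eventually.of_forall fun y => ?_)
  simp only [blockAvg, piecewise_piecewise_union]

theorem freeOf_blockAvg : FreeOf B (blockAvg Q B g) := fun x y => by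
  simp only [blockAvg]
  congr 1
  funext z
  rw [piecewise_piecewise_union, Finset.union_self]
  congr 1
  funext i
  by_cases h : i ∈ B <;> simp [h]

theorem FreeOf.blockAvg (h : FreeOf B g) (C : Finset ι) : FreeOf B (blockAvg Q C g) := fun x y => by
  simp only [OfflineRL.blockAvg]
  congr 1
  funext z
  rw [← h (C.piecewise z x) (C.piecewise z y)]
  congr 1
  funext i
  by_cases h1 : i ∈ B <;> by_cases h2 : i ∈ C <;> simp [h1, h2]

theorem FreeOf.blockAvg_eq (h : FreeOf B g) : OfflineRL.blockAvg Q B g = g := by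
  funext x
  simp [OfflineRL.blockAvg, h x]

theorem blockAvg_empty : blockAvg Q ∅ g = g :=
  FreeOf.blockAvg_eq fun x y => by simp

theorem FreeOf.blockAvg_mul (h : FreeOf B f) (g : (ι → E) → ℝ) :
    OfflineRL.blockAvg Q B (fun x => f x * g x) = fun x => f x * OfflineRL.blockAvg Q B g x := by
  funext x
  simp only [OfflineRL.blockAvg, h x]
  exact integral_const_mul _ _

theorem blockAvg_sub (hf : BddMeas f) (hg : BddMeas g) :
    blockAvg Q B (fun x => f x - g x) = fun x => blockAvg Q B f x - blockAvg Q B g x := by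
  funext x
  exact integral_sub ((hf.section B x).integrable _) ((hg.section B x).integrable _)

theorem blockAvg_sum {κ : Type*} (s : Finset κ) {F : κ → (ι → E) → ℝ} (h : ∀ i ∈ s, BddMeas (F i)) :
    blockAvg Q B (fun x => ∑ i ∈ s, F i x) = fun x => ∑ i ∈ s, blockAvg Q B (F i) x := by
  funext x
  exact integral_finsetSum _ fun i hi => ((h i hi).section B x).integrable _

theorem BddDiff.blockAvg {β : ℝ} (hβ : 0 ≤ β) (hm : BddMeas g) (h : BddDiff C β g) (B : Finset ι) :
    BddDiff C β (OfflineRL.blockAvg Q B g) := by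
  intro i hi x v
  simp only [OfflineRL.blockAvg]
  rw [← integral_sub ((hm.section B _).integrable _) ((hm.section B _).integrable _)]
  have key : ∀ y, ‖g (B.piecewise y (Function.update x i v)) - g (B.piecewise y x)‖ ≤ β := by
    intro y
    by_cases hiB : i ∈ B
    · rw [Finset.piecewise_congr (g' := x) (f' := y) B (by simp) (fun j hj => by
        rw [Function.update_of_ne]; rintro rfl; exact hj hiB)]
      simpa using hβ
    · rw [← Finset.update_piecewise_of_notMem B y x hiB]
      exact h i hi _ _
  have := norm_integral_le_of_norm_le_const (μ := Measure.pi Q) (Filter.Eventually.of_forall key)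
  simpa using this

theorem BddDiff.abs_sub_blockAvg_singleton {β : ℝ} {i : ι} (hm : BddMeas g)
    (h : BddDiff {i} β g) (x : ι → E) : |g x - OfflineRL.blockAvg Q {i} g x| ≤ β := by
  have h1 : g x = ∫ _y : ι → E, g x ∂(Measure.pi Q) := by simp
  rw [OfflineRL.blockAvg, h1,
    ← integral_sub (integrable_const _) ((hm.section _ x).integrable _)]
  have := norm_integral_le_of_norm_le_const (μ := Measure.pi Q)
    (f := fun y => g x - g (({i} : Finset ι).piecewise y x)) (C := β)
    (Filter.Eventually.of_forall fun y => by
      rw [piecewise_singleton_eq_update, Real.norm_eq_abs, abs_sub_comm]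
      exact h i (by simp) _ _)
  simpa using this

/-! ### Exponential moments by replacing one coordinate at a time -/

/-- The linear term integrates to zero for centred variables, so this trades an exponential moment
of `x` for one of `x ^ 2`, without any bound on the size of `x`. -/
theorem exp_le_self_add_exp_sq (x : ℝ) : Real.exp x ≤ x + Real.exp (x ^ 2) := by
  have h0 : x ^ 2 + 1 ≤ Real.exp (x ^ 2) := Real.add_one_le_exp _
  rcases le_or_gt |x| 1 with h | h
  · have := (abs_le.1 (Real.abs_exp_sub_one_sub_id_le h)).2
    nlinarith
  · rcases lt_abs.1 h with h1 | h1
    · have : Real.exp x ≤ Real.exp (x ^ 2) := Real.exp_le_exp.2 (by nlinarith)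
      linarith
    · have : Real.exp x ≤ 1 := Real.exp_le_one_iff.2 (by linarith)
      nlinarith

/-- Since φ does not depend on coordinate `i` while Y averages to zero over it, the linear term φ·Y
of `exp_le_self_add_exp_sq` has integral zero. -/
theorem integral_mul_exp_le {φ Y : (ι → E) → ℝ} {i : ι} (hφ : BddMeas φ) (hφ0 : ∀ x, 0 ≤ φ x)
    (hφi : FreeOf {i} φ) (hY : BddMeas Y) (hYi : ∀ x, blockAvg Q {i} Y x = 0) :
    ∫ x, φ x * Real.exp (Y x) ∂(Measure.pi Q)
      ≤ ∫ x, φ x * Real.exp (Y x ^ 2) ∂(Measure.pi Q) := by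
  have h0 : ∫ x, φ x * Y x ∂(Measure.pi Q) = 0 := by
    rw [← integral_blockAvg (hφ.mul hY) {i}, hφi.blockAvg_mul]
    simp [hYi]
  have h1 : ∫ x, φ x * Real.exp (Y x) ∂(Measure.pi Q)
      ≤ ∫ x, (φ x * Y x + φ x * Real.exp (Y x ^ 2)) ∂(Measure.pi Q) := by
    refine integral_mono ((hφ.mul hY.exp).integrable _)
      (((hφ.mul hY).add (hφ.mul (hY.pow 2).exp)).integrable _) fun x => ?_
    have := mul_le_mul_of_nonneg_left (exp_le_self_add_exp_sq (Y x)) (hφ0 x)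
    simpa [mul_add] using this
  rwa [integral_add ((hφ.mul hY).integrable _) ((hφ.mul (hY.pow 2).exp).integrable _), h0,
    zero_add] at h1

/-- Given the coordinates outside `B` the terms are independent and centred. The exponents are
squared one index at a time: `J` collects the indices already treated, and all factors other than
the `i`-th are free of coordinate `i`. Dependence on coordinates outside `B` is allowed, which is
what the halving argument needs. -/
theorem integral_exp_sum_le (B : Finset ι) {Y : ι → (ι → E) → ℝ} (hY : ∀ i ∈ B, BddMeas (Y i))
    (h0 : ∀ i ∈ B, ∀ x, blockAvg Q {i} (Y i) x = 0)
    (hfree : ∀ i ∈ B, ∀ j ∈ B, j ≠ i → FreeOf {j} (Y i)) :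
    ∫ x, Real.exp (∑ i ∈ B, Y i x) ∂(Measure.pi Q)
      ≤ ∫ x, Real.exp (∑ i ∈ B, Y i x ^ 2) ∂(Measure.pi Q) := by
  have key : ∀ J ⊆ B, ∫ x, Real.exp (∑ i ∈ B, Y i x) ∂(Measure.pi Q)
      ≤ ∫ x, Real.exp (∑ i ∈ J, Y i x ^ 2 + ∑ i ∈ B \ J, Y i x) ∂(Measure.pi Q) := by
    intro J
    induction J using Finset.induction_on with
    | empty => intro _; simp
    | insert i J hiJ ih =>
      intro hJ
      have hiB : i ∈ B := hJ (by simp)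
      have hJB : J ⊆ B := fun j hj => hJ (by simp [hj])
      refine (ih hJB).trans ?_
      have hsplit : B \ J = insert i (B \ insert i J) := by
        ext j
        simp only [Finset.mem_sdiff, Finset.mem_insert]
        by_cases hj : j = i
        · subst hj; simp [hiB, hiJ]
        · simp [hj]
      have hni : i ∉ B \ insert i J := by simp
      have h := integral_mul_exp_le (Q := Q) (i := i) (Y := Y i)
        (φ := fun x => Real.exp (∑ j ∈ J, Y j x ^ 2 + ∑ j ∈ B \ insert i J, Y j x))
        ((BddMeas.sum _ fun j hj => (hY j (hJB hj)).pow 2).add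
          (BddMeas.sum _ fun j hj => hY j (Finset.mem_sdiff.1 hj).1)).exp
        (fun x => (Real.exp_pos _).le)
        (fun x y => by
          have e1 : ∑ j ∈ J, Y j (({i} : Finset ι).piecewise y x) ^ 2 = ∑ j ∈ J, Y j x ^ 2 :=
            Finset.sum_congr rfl fun j hj => by
              rw [hfree j (hJB hj) i hiB (by rintro rfl; exact hiJ hj)]
          have e2 : ∑ j ∈ B \ insert i J, Y j (({i} : Finset ι).piecewise y x)
              = ∑ j ∈ B \ insert i J, Y j x :=
            Finset.sum_congr rfl fun j hj => by
              rw [hfree j (Finset.mem_sdiff.1 hj).1 i hiB (by rintro rfl; exact hni hj)]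
          simp only [e1, e2])
        (hY i hiB) (h0 i hiB)
      simp only [← Real.exp_add] at h
      have e1 : ∀ x, ∑ j ∈ J, Y j x ^ 2 + ∑ j ∈ B \ J, Y j x
          = ∑ j ∈ J, Y j x ^ 2 + ∑ j ∈ B \ insert i J, Y j x + Y i x := fun x => by
        rw [hsplit, Finset.sum_insert hni]; ring
      have e2 : ∀ x, ∑ j ∈ insert i J, Y j x ^ 2 + ∑ j ∈ B \ insert i J, Y j x
          = ∑ j ∈ J, Y j x ^ 2 + ∑ j ∈ B \ insert i J, Y j x + Y i x ^ 2 := fun x => by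
        rw [Finset.sum_insert hiJ]; ring
      simpa only [e1, e2] using h
  simpa using key B subset_rfl

theorem exp_sum_mul_le {κ : Type*} (s : Finset κ) (w a : κ → ℝ) (hw : ∀ i ∈ s, 0 ≤ w i)
    (h1 : ∑ i ∈ s, w i = 1) : Real.exp (∑ i ∈ s, w i * a i) ≤ ∑ i ∈ s, w i * Real.exp (a i) := by
  have := convexOn_exp.map_sum_le (t := s) (w := w) (p := a) hw h1 (fun _ _ => Set.mem_univ _)
  simpa using this

/-- Functions with bounded differences are sub-Gaussian around their average. -/
theorem integral_exp_sq_le {K : Finset ι} {β t : ℝ} (hβ : 0 ≤ β) (ht : 0 ≤ t)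
    (hg : BddMeas g) (hd : BddDiff K β g) (htK : 12 * t * K.card * β ^ 2 ≤ 1) :
    ∫ x, Real.exp (t * (g x - blockAvg Q K g x) ^ 2) ∂(Measure.pi Q) ≤ 2 := by
  -- The coefficient in the exponent grows by the factor 1 + 8tβ² with each coordinate averaged out.
  -- By the hypothesis on `t`, |K|·8tβ² ≤ 2/3 and exp(2/3) ≤ 2, so it never exceeds 2t.
  set T : ℕ → ℝ := fun k => t * (1 + 8 * t * β ^ 2) ^ k with hT
  have hT0 : ∀ k, 0 ≤ T k := fun k => by positivity
  have hTle : ∀ k ≤ K.card, T k ≤ 2 * t := by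
    intro k hk
    have h1 : (1 + 8 * t * β ^ 2) ^ k ≤ Real.exp (2 / 3) := by
      calc (1 + 8 * t * β ^ 2) ^ k ≤ (Real.exp (8 * t * β ^ 2)) ^ k := by
            gcongr
            linarith [Real.add_one_le_exp (8 * t * β ^ 2)]
        _ = Real.exp (k * (8 * t * β ^ 2)) := by rw [← Real.exp_nat_mul]
        _ ≤ Real.exp (2 / 3) := by
            refine Real.exp_le_exp.2 ?_
            have : (k : ℝ) * (8 * t * β ^ 2) ≤ K.card * (8 * t * β ^ 2) := by gcongr
            nlinarith
    have h2 : Real.exp (2 / 3) ≤ 2 := by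
      have : (2 / 3 : ℝ) ≤ Real.log 2 := by linarith [Real.log_two_gt_d9]
      calc Real.exp (2 / 3) ≤ Real.exp (Real.log 2) := Real.exp_le_exp.2 this
        _ = 2 := Real.exp_log (by norm_num)
    simp only [hT]
    nlinarith
  -- Martingale-type induction: each new coordinate `i` splits the deviation into a + D, where `a`
  -- is free of `i` and D is centred in `i` with |D| ≤ β. The term D² goes into the prefactor.
  have key : ∀ J ⊆ K, ∫ x, Real.exp (t * (g x - blockAvg Q K g x) ^ 2) ∂(Measure.pi Q)
      ≤ Real.exp (J.card * (2 * t * β ^ 2)) *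
        ∫ x, Real.exp (T J.card * (blockAvg Q J g x - blockAvg Q K g x) ^ 2)
          ∂(Measure.pi Q) := by
    intro J
    induction J using Finset.induction_on with
    | empty => intro _; simp [hT, blockAvg_empty]
    | insert i J hiJ ih =>
      intro hJ
      have hiK : i ∈ K := hJ (by simp)
      have hJK : J ⊆ K := fun j hj => hJ (by simp [hj])
      refine (ih hJK).trans ?_
      rw [Finset.card_insert_of_notMem hiJ]
      have hcard : J.card < K.card := by
        have := Finset.card_le_card hJ
        rw [Finset.card_insert_of_notMem hiJ] at this
        omega
      set s := T J.card with hs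
      have hs2 : s ≤ 2 * t := hTle _ hcard.le
      have hs0 : 0 ≤ s := hT0 _
      set G := blockAvg Q J g with hG
      set a : (ι → E) → ℝ := fun x => blockAvg Q (insert i J) g x - blockAvg Q K g x with ha
      set D : (ι → E) → ℝ := fun x => G x - blockAvg Q {i} G x with hD
      have hGm : BddMeas G := hg.blockAvg J
      have hGi : blockAvg Q {i} G = blockAvg Q (insert i J) g := by
        rw [hG, blockAvg_blockAvg hg]; rfl
      have ham : BddMeas a := (hg.blockAvg _).sub (hg.blockAvg _)
      have hDm : BddMeas D := hGm.sub (hGm.blockAvg _)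
      have hafree : FreeOf {i} a := fun x y => by
        have h1 : FreeOf {i} (blockAvg Q (insert i J) g) := by
          rw [← hGi]; exact freeOf_blockAvg
        have h2 : FreeOf {i} (blockAvg Q K g) := (freeOf_blockAvg).mono (by simpa using hiK)
        simp only [ha, h1 x y, h2 x y]
      have hDi : ∀ x, blockAvg Q {i} D x = 0 := fun x => by
        rw [hD, blockAvg_sub hGm (hGm.blockAvg _), blockAvg_blockAvg hGm]
        simp
      have hDβ : ∀ x, D x ^ 2 ≤ β ^ 2 := fun x => by
        have h1 := ((hd.blockAvg hβ hg J).mono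
          (by simpa using hiK : ({i} : Finset ι) ⊆ K)).abs_sub_blockAvg_singleton (Q := Q) hGm x
        rw [← sq_abs]
        exact pow_le_pow_left₀ (abs_nonneg _) h1 2
      have hsplit : ∀ x, G x - blockAvg Q K g x = a x + D x := fun x => by
        simp only [ha, hD, hGi]; ring
      have step1 : ∫ x, Real.exp (s * (G x - blockAvg Q K g x) ^ 2) ∂(Measure.pi Q)
          ≤ Real.exp (2 * t * β ^ 2) * ∫ x, Real.exp (s * a x ^ 2) *
              Real.exp (2 * s * (a x * D x)) ∂(Measure.pi Q) := by
        rw [← integral_const_mul]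
        refine integral_mono
          ((((hGm.sub (hg.blockAvg K)).pow 2).const_mul s).exp.integrable _)
          (((((ham.pow 2).const_mul s).exp.mul
            ((ham.mul hDm).const_mul (2 * s)).exp).const_mul _).integrable _) fun x => ?_
        simp only [hsplit, ← Real.exp_add]
        refine Real.exp_le_exp.2 ?_
        have := mul_le_mul hs2 (hDβ x) (sq_nonneg _) (by positivity)
        nlinarith
      -- The cross term 2s·a·D is centred in coordinate `i`, so it may be replaced by its square
      -- 4s²a²D² ≤ s·8tβ²·a². This is the increase of `T`.
      have step2 : ∫ x, Real.exp (s * a x ^ 2) * Real.exp (2 * s * (a x * D x)) ∂(Measure.pi Q)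
          ≤ ∫ x, Real.exp (s * a x ^ 2) * Real.exp ((2 * s * (a x * D x)) ^ 2)
              ∂(Measure.pi Q) := by
        refine integral_mul_exp_le (i := i) ((ham.pow 2).const_mul s).exp
          (fun x => (Real.exp_pos _).le) (fun x y => by simp only [hafree x y])
          ((ham.mul hDm).const_mul (2 * s)) fun x => ?_
        have : (fun x => 2 * s * (a x * D x)) = fun x => (2 * s * a x) * D x := by
          funext x; ring
        rw [this, FreeOf.blockAvg_mul (f := fun x => 2 * s * a x)
          (fun x y => by simp only [hafree x y])]
        simp [hDi]
      have step3 : ∫ x, Real.exp (s * a x ^ 2) * Real.exp ((2 * s * (a x * D x)) ^ 2)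
            ∂(Measure.pi Q)
          ≤ ∫ x, Real.exp (T (J.card + 1) * a x ^ 2) ∂(Measure.pi Q) := by
        refine integral_mono
          ((((ham.pow 2).const_mul s).exp.mul
            (((ham.mul hDm).const_mul (2 * s)).pow 2).exp).integrable _)
          (((ham.pow 2).const_mul _).exp.integrable _) fun x => ?_
        simp only [← Real.exp_add]
        refine Real.exp_le_exp.2 ?_
        have hT1 : T (J.card + 1) = s * (1 + 8 * t * β ^ 2) := by
          simp only [hs, hT, pow_succ]; ring
        have h4 : s * D x ^ 2 ≤ 2 * t * β ^ 2 := by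
          have := mul_le_mul hs2 (hDβ x) (sq_nonneg _) (by positivity)
          exact this
        have h5 : (4 * s * a x ^ 2) * (s * D x ^ 2) ≤ (4 * s * a x ^ 2) * (2 * t * β ^ 2) :=
          mul_le_mul_of_nonneg_left h4 (by positivity)
        rw [hT1]
        nlinarith
      have h6 : Real.exp (((J.card + 1 : ℕ) : ℝ) * (2 * t * β ^ 2))
          = Real.exp (J.card * (2 * t * β ^ 2)) * Real.exp (2 * t * β ^ 2) := by
        rw [← Real.exp_add]; congr 1; push_cast; ring
      rw [h6, mul_assoc (Real.exp (J.card * (2 * t * β ^ 2)))]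
      refine mul_le_mul_of_nonneg_left (step1.trans ?_) (Real.exp_pos _).le
      exact mul_le_mul_of_nonneg_left (step2.trans step3) (Real.exp_pos _).le
  have h := key K subset_rfl
  simp only [sub_self, ne_eq, OfNat.ofNat_ne_zero, not_false_eq_true, zero_pow, mul_zero,
    Real.exp_zero, integral_const, probReal_univ, smul_eq_mul, mul_one] at h
  refine h.trans ?_
  have : (2 / 3 : ℝ) ≤ Real.log 2 := by linarith [Real.log_two_gt_d9]
  calc Real.exp (K.card * (2 * t * β ^ 2)) ≤ Real.exp (Real.log 2) :=
        Real.exp_le_exp.2 (by nlinarith)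
    _ = 2 := Real.exp_log (by norm_num)

end Average

theorem measure_ge_le_of_integral_exp_le {X : Type*} [MeasurableSpace X] {ν : Measure X}
    [IsFiniteMeasure ν] {Z : X → ℝ} (hZ : BddMeas Z) {c : ℝ}
    (h : ∫ x, Real.exp (Z x) ∂ν ≤ c) (t : ℝ) :
    ν {x | t ≤ Z x} ≤ ENNReal.ofReal (c * Real.exp (-t)) := by
  have h1 := mul_meas_ge_le_integral_of_nonneg (μ := ν) (f := fun x => Real.exp (Z x))
    (Filter.Eventually.of_forall fun x => (Real.exp_pos _).le) (hZ.exp.integrable ν) (Real.exp t)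
  simp only [Real.exp_le_exp] at h1
  have h2 : ν.real {x | t ≤ Z x} ≤ c * Real.exp (-t) := by
    rw [Real.exp_neg, ← div_eq_mul_inv, le_div_iff₀ (Real.exp_pos t)]
    linarith
  rw [← ENNReal.ofReal_toReal (measure_ne_top ν {x | t ≤ Z x})]
  exact ENNReal.ofReal_le_ofReal h2

/-! ### Decoupling sums of stable functions by recursive halving. -/

section Decoupling

variable {ι E : Type*} [Fintype ι] [DecidableEq ι] [MeasurableSpace E]
  {Q : ι → Measure E} [∀ i, IsProbabilityMeasure (Q i)]

/-- The interaction between two halves. After averaging over `B₁.erase i`, the `i`-th term depends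
within `B₁` on coordinate `i` alone, so given `B₂` the terms are independent and centred, and
`integral_exp_sum_le` applies. Each of them is a fluctuation in the coordinates of `B₂`, hence
sub-Gaussian of variance of order |B₂|β². -/
theorem integral_exp_halves_le {B₁ B₂ : Finset ι} (hdisj : Disjoint B₁ B₂) {m β lam : ℝ}
    (h1 : B₁.card ≤ m) (h2 : B₂.card ≤ m) (hβ : 0 ≤ β) (hlam : 0 ≤ lam)
    (hle : lam * (4 * m * β) ≤ 1) {g : ι → (ι → E) → ℝ} (hg : ∀ i ∈ B₁, BddMeas (g i))
    (h0 : ∀ i ∈ B₁, ∀ x, blockAvg Q {i} (g i) x = 0) (hd : ∀ i ∈ B₁, BddDiff B₂ β (g i)) :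
    ∫ x, Real.exp (lam * ∑ i ∈ B₁, (blockAvg Q (B₁.erase i) (g i) x
      - blockAvg Q ((B₁ ∪ B₂).erase i) (g i) x)) ∂(Measure.pi Q) ≤ 2 := by
  rcases B₁.eq_empty_or_nonempty with rfl | hne
  · simp
  have hcard : (0 : ℝ) < B₁.card := by exact_mod_cast hne.card_pos
  set G : ι → (ι → E) → ℝ := fun i => blockAvg Q (B₁.erase i) (g i) with hG
  have hGm : ∀ i ∈ B₁, BddMeas (G i) := fun i hi => (hg i hi).blockAvg _
  have hGB : ∀ i ∈ B₁, blockAvg Q B₂ (G i) = blockAvg Q ((B₁ ∪ B₂).erase i) (g i) := by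
    intro i hi
    rw [hG, blockAvg_blockAvg (hg i hi), Finset.erase_union_distrib,
      Finset.erase_eq_of_notMem (Finset.disjoint_left.1 hdisj hi), Finset.union_comm]
  set Y : ι → (ι → E) → ℝ := fun i x => lam * (G i x - blockAvg Q B₂ (G i) x) with hY
  have hYm : ∀ i ∈ B₁, BddMeas (Y i) := fun i hi =>
    ((hGm i hi).sub ((hGm i hi).blockAvg _)).const_mul _
  have hYi : ∀ i ∈ B₁, ∀ x, blockAvg Q {i} (Y i) x = 0 := by
    intro i hi x
    have hz : ∀ C : Finset ι, blockAvg Q {i} (blockAvg Q C (g i)) x = 0 := fun C => by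
      rw [blockAvg_blockAvg (hg i hi), Finset.union_comm, ← blockAvg_blockAvg (hg i hi),
        show blockAvg Q {i} (g i) = fun _ => 0 from funext (h0 i hi)]
      simp [blockAvg]
    have hc : FreeOf {i} (fun _ : ι → E => lam) := fun _ _ => rfl
    rw [hY, hc.blockAvg_mul, blockAvg_sub (hGm i hi) ((hGm i hi).blockAvg _), hGB i hi]
    simp [hG, hz]
  have hYf : ∀ i ∈ B₁, ∀ j ∈ B₁, j ≠ i → FreeOf {j} (Y i) := by
    intro i hi j hj hji
    have hf : FreeOf {j} (G i) :=
      freeOf_blockAvg.mono (by simpa using ⟨hji, hj⟩)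
    intro x y
    simp only [hY, hf x y, hf.blockAvg B₂ x y]
  have e : ∀ x, lam * ∑ i ∈ B₁, (blockAvg Q (B₁.erase i) (g i) x
      - blockAvg Q ((B₁ ∪ B₂).erase i) (g i) x) = ∑ i ∈ B₁, Y i x := fun x => by
    rw [Finset.mul_sum]
    refine Finset.sum_congr rfl fun i hi => ?_
    rw [hY, ← hGB i hi]
  simp only [e]
  refine (integral_exp_sum_le B₁ hYm hYi hYf).trans ?_
  -- Jensen with uniform weights reduces the sum of squares to single squares with coefficient
  -- |B₁|λ². The condition of `integral_exp_sq_le` then reads 12·λ²|B₁||B₂|β² ≤ 1, which follows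
  -- from (4λmβ)² ≤ 1.
  have hconv : ∀ x, Real.exp (∑ i ∈ B₁, Y i x ^ 2) ≤ ∑ i ∈ B₁, (B₁.card : ℝ)⁻¹ *
      Real.exp (B₁.card * lam ^ 2 * (G i x - blockAvg Q B₂ (G i) x) ^ 2) := fun x => by
    have := exp_sum_mul_le B₁ (fun _ => (B₁.card : ℝ)⁻¹)
      (fun i => B₁.card * lam ^ 2 * (G i x - blockAvg Q B₂ (G i) x) ^ 2)
      (fun _ _ => by positivity) (by simp [hcard.ne'])
    refine le_trans (le_of_eq ?_) this
    congr 1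
    refine Finset.sum_congr rfl fun i _ => ?_
    simp only [hY]
    field_simp
  have hint : ∀ i ∈ B₁, BddMeas fun x => (B₁.card : ℝ)⁻¹ *
      Real.exp (B₁.card * lam ^ 2 * (G i x - blockAvg Q B₂ (G i) x) ^ 2) := fun i hi =>
    ((((hGm i hi).sub ((hGm i hi).blockAvg _)).pow 2).const_mul _).exp.const_mul _
  calc ∫ x, Real.exp (∑ i ∈ B₁, Y i x ^ 2) ∂(Measure.pi Q)
      ≤ ∫ x, ∑ i ∈ B₁, (B₁.card : ℝ)⁻¹ *
          Real.exp (B₁.card * lam ^ 2 * (G i x - blockAvg Q B₂ (G i) x) ^ 2) ∂(Measure.pi Q) :=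
        integral_mono ((BddMeas.sum _ fun i hi => (hYm i hi).pow 2).exp.integrable _)
          ((BddMeas.sum _ hint).integrable _) hconv
    _ = ∑ i ∈ B₁, (B₁.card : ℝ)⁻¹ * ∫ x,
          Real.exp (B₁.card * lam ^ 2 * (G i x - blockAvg Q B₂ (G i) x) ^ 2) ∂(Measure.pi Q) := by
        rw [integral_finsetSum _ fun i hi => (hint i hi).integrable _]
        simp only [integral_const_mul]
    _ ≤ ∑ i ∈ B₁, (B₁.card : ℝ)⁻¹ * 2 := by
        refine Finset.sum_le_sum fun i hi => mul_le_mul_of_nonneg_left ?_ (by positivity)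
        refine integral_exp_sq_le hβ (by positivity) (hGm i hi) ((hd i hi).blockAvg hβ (hg i hi) _) ?_
        have hm : 0 ≤ m := hcard.le.trans h1
        have hp : (B₁.card : ℝ) * B₂.card ≤ m * m := mul_le_mul h1 h2 (by positivity) hm
        have hq : (lam * (4 * m * β)) ^ 2 ≤ 1 := pow_le_one₀ (by positivity) hle
        have hr : lam ^ 2 * β ^ 2 * (B₁.card * B₂.card) ≤ lam ^ 2 * β ^ 2 * (m * m) :=
          mul_le_mul_of_nonneg_left hp (by positivity)
        nlinarith
    _ = 2 := by
        rw [Finset.sum_const, nsmul_eq_mul]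
        field_simp

/-- Sums of stable, coordinatewise centred functions differ little from sums of independent
variables. -/
theorem integral_exp_decoupled_le (l : ℕ) {β : ℝ} (hβ : 0 ≤ β) {g : ι → (ι → E) → ℝ} :
    ∀ (B : Finset ι) (lam : ℝ), B.card ≤ 2 ^ l → 0 ≤ lam → lam * (4 * 2 ^ l * β * (l + 1)) ≤ 1 →
      (∀ i ∈ B, BddMeas (g i)) → (∀ i ∈ B, ∀ x, blockAvg Q {i} (g i) x = 0) →
      (∀ i ∈ B, BddDiff (B.erase i) β (g i)) →
    ∫ x, Real.exp (lam * ∑ i ∈ B, (g i x - blockAvg Q (B.erase i) (g i) x)) ∂(Measure.pi Q) ≤ 2 := by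
  induction l with
  | zero =>
    intro B lam hB _ _ _ _ _
    have : ∀ x, ∑ i ∈ B, (g i x - blockAvg Q (B.erase i) (g i) x) = 0 := fun x =>
      Finset.sum_eq_zero fun i hi => by
        have : B.erase i = ∅ := by
          rw [← Finset.card_eq_zero, Finset.card_erase_of_mem hi]
          simp at hB; omega
        rw [this, blockAvg_empty, sub_self]
    simp [this]
  | succ l ih =>
    intro B lam hB hlam hle hg h0 hd
    -- For i in one half, the deviation of `g i` from its average over the rest of `B` is its
    -- deviation from the average over the rest of that half, handled by induction, plus a
    -- difference of two averages handled by `integral_exp_halves_le`.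
    obtain ⟨B₁, hB₁, hc₁⟩ := Finset.exists_subset_card_eq (Nat.div_le_self B.card 2)
    set B₂ := B \ B₁ with hB₂
    have hdisj : Disjoint B₁ B₂ := Finset.disjoint_sdiff
    have hun : B₁ ∪ B₂ = B := Finset.union_sdiff_of_subset hB₁
    have hB₂B : B₂ ⊆ B := Finset.sdiff_subset
    have hc₂ : B₂.card = B.card - B.card / 2 := by rw [hB₂, Finset.card_sdiff_of_subset hB₁, hc₁]
    have hp1 : B₁.card ≤ 2 ^ l := by rw [hc₁]; rw [pow_succ] at hB; omega
    have hp2 : B₂.card ≤ 2 ^ l := by rw [hc₂]; rw [pow_succ] at hB; omega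
    have hp1' : (B₁.card : ℝ) ≤ 2 ^ l := by exact_mod_cast hp1
    have hp2' : (B₂.card : ℝ) ≤ 2 ^ l := by exact_mod_cast hp2
    have hl : (0 : ℝ) < l + 1 := by positivity
    have hl2 : (0 : ℝ) < l + 2 := by positivity
    rw [pow_succ] at hle
    push_cast at hle
    have hsub : ∀ {C : Finset ι} (_ : C ⊆ B), ∀ i ∈ C, BddDiff (C.erase i) β (g i) :=
      fun hC i hi => (hd i (hC hi)).mono (Finset.erase_subset_erase i hC)
    have hcross : ∀ {C D : Finset ι} (_ : C ⊆ B) (_ : D ⊆ B) (_ : Disjoint C D),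
        ∀ i ∈ C, BddDiff D β (g i) := fun hC hD hCD i hi =>
      (hd i (hC hi)).mono fun j hj => Finset.mem_erase.2
        ⟨by rintro rfl; exact Finset.disjoint_left.1 hCD hi hj, hD hj⟩
    -- The weights `w`, `w`, `v`, `v` below add up to one and satisfy w·a = v·b = λ, so convexity of
    -- exp bounds the target by a mean of four integrals that are each at most 2. With this choice
    -- the induction hypothesis at level `l` and the halves bound both need exactly the inequality
    -- assumed at level l + 1. Hence halving costs only a factor linear in the number of levels.
    set a := lam * (2 * (l + 2) / (l + 1)) with ha
    set b := lam * (2 * (l + 2)) with hb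
    have ha0 : 0 ≤ a := by positivity
    have hb0 : 0 ≤ b := by positivity
    have ha1 : a * (4 * 2 ^ l * β * (l + 1)) ≤ 1 := by
      refine le_trans (le_of_eq ?_) hle
      rw [ha]; field_simp; ring
    have hb1 : b * (4 * 2 ^ l * β) ≤ 1 := by
      refine le_trans (le_of_eq ?_) hle
      rw [hb]; ring
    have i1 := ih B₁ a hp1 ha0 ha1 (fun i hi => hg i (hB₁ hi)) (fun i hi => h0 i (hB₁ hi))
      (hsub hB₁)
    have i2 := ih B₂ a hp2 ha0 ha1 (fun i hi => hg i (hB₂B hi)) (fun i hi => h0 i (hB₂B hi))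
      (hsub hB₂B)
    have i3 := integral_exp_halves_le (Q := Q) hdisj hp1' hp2' hβ hb0 hb1
      (fun i hi => hg i (hB₁ hi)) (fun i hi => h0 i (hB₁ hi)) (hcross hB₁ hB₂B hdisj)
    have i4 := integral_exp_halves_le (Q := Q) hdisj.symm hp2' hp1' hβ hb0 hb1
      (fun i hi => hg i (hB₂B hi)) (fun i hi => h0 i (hB₂B hi)) (hcross hB₂B hB₁ hdisj.symm)
    rw [Finset.union_comm B₂ B₁] at i4
    rw [hun] at i3 i4
    set Z₁ : (ι → E) → ℝ := fun x => a * ∑ i ∈ B₁, (g i x - blockAvg Q (B₁.erase i) (g i) x)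
      with hZ₁
    set Z₂ : (ι → E) → ℝ := fun x => a * ∑ i ∈ B₂, (g i x - blockAvg Q (B₂.erase i) (g i) x)
      with hZ₂
    set W₁ : (ι → E) → ℝ := fun x => b * ∑ i ∈ B₁, (blockAvg Q (B₁.erase i) (g i) x
      - blockAvg Q (B.erase i) (g i) x) with hW₁
    set W₂ : (ι → E) → ℝ := fun x => b * ∑ i ∈ B₂, (blockAvg Q (B₂.erase i) (g i) x
      - blockAvg Q (B.erase i) (g i) x) with hW₂
    have mZ : ∀ C ⊆ B, ∀ c : ℝ, BddMeas fun x =>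
        c * ∑ i ∈ C, (g i x - blockAvg Q (C.erase i) (g i) x) := fun C hC c =>
      (BddMeas.sum _ fun i hi => (hg i (hC hi)).sub ((hg i (hC hi)).blockAvg _)).const_mul _
    have mW : ∀ C ⊆ B, ∀ c : ℝ, BddMeas fun x =>
        c * ∑ i ∈ C, (blockAvg Q (C.erase i) (g i) x - blockAvg Q (B.erase i) (g i) x) :=
      fun C hC c => (BddMeas.sum _ fun i hi =>
        ((hg i (hC hi)).blockAvg _).sub ((hg i (hC hi)).blockAvg _)).const_mul _
    have m1 : BddMeas Z₁ := mZ B₁ hB₁ a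
    have m2 : BddMeas Z₂ := mZ B₂ hB₂B a
    have m3 : BddMeas W₁ := mW B₁ hB₁ b
    have m4 : BddMeas W₂ := mW B₂ hB₂B b
    set w := ((l : ℝ) + 1) / (2 * (l + 2)) with hw
    set v := (1 : ℝ) / (2 * (l + 2)) with hv
    have hw0 : 0 ≤ w := by positivity
    have hv0 : 0 ≤ v := by positivity
    have hwv : w + w + v + v = 1 := by rw [hw, hv]; field_simp; ring
    have hwa : w * a = lam := by rw [hw, ha]; field_simp
    have hvb : v * b = lam := by rw [hv, hb]; field_simp
    have hpt : ∀ x, Real.exp (lam * ∑ i ∈ B, (g i x - blockAvg Q (B.erase i) (g i) x))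
        ≤ w * Real.exp (Z₁ x) + w * Real.exp (Z₂ x) + v * Real.exp (W₁ x)
          + v * Real.exp (W₂ x) := fun x => by
      have h := exp_sum_mul_le (Finset.univ : Finset (Fin 4)) ![w, w, v, v]
        ![Z₁ x, Z₂ x, W₁ x, W₂ x]
        (fun i _ => by fin_cases i <;> simpa using by assumption)
        (by simpa [Fin.sum_univ_four] using hwv)
      simp only [Fin.sum_univ_four, Matrix.cons_val] at h
      refine le_trans (le_of_eq ?_) h
      congr 1
      simp only [hZ₁, hZ₂, hW₁, hW₂, ← mul_assoc, hwa, hvb]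
      rw [← hun, Finset.sum_union hdisj, hun]
      simp only [Finset.sum_sub_distrib]
      ring
    refine (integral_mono ((mZ B subset_rfl lam).exp.integrable _)
      (((((m1.exp.const_mul w).add (m2.exp.const_mul w)).add (m3.exp.const_mul v)).add
        (m4.exp.const_mul v)).integrable _) hpt).trans ?_
    rw [integral_add ((((m1.exp.const_mul w).add (m2.exp.const_mul w)).add
        (m3.exp.const_mul v)).integrable _) ((m4.exp.const_mul v).integrable _),
      integral_add (((m1.exp.const_mul w).add (m2.exp.const_mul w)).integrable _)
        ((m3.exp.const_mul v).integrable _),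
      integral_add ((m1.exp.const_mul w).integrable _) ((m2.exp.const_mul w).integrable _)]
    simp only [integral_const_mul]
    have j1 := mul_le_mul_of_nonneg_left i1 hw0
    have j2 := mul_le_mul_of_nonneg_left i2 hw0
    have j3 := mul_le_mul_of_nonneg_left i3 hv0
    have j4 := mul_le_mul_of_nonneg_left i4 hv0
    linarith

end Decoupling

/-! ### Deviations of a finite family from its mean -/

section Deviation

variable {ι : Type*} [DecidableEq ι] (I : Finset ι)

/-- The mean of a finite family. -/
noncomputable def finMean (y : ι → ℝ) : ℝ := (∑ i ∈ I, y i) / I.card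

/-- The Euclidean distance of a finite family from its mean. -/
noncomputable def devNorm (y : ι → ℝ) : ℝ := √(∑ i ∈ I, (y i - finMean I y) ^ 2)

variable {I}

theorem devNorm_nonneg (y : ι → ℝ) : 0 ≤ devNorm I y := Real.sqrt_nonneg _

theorem card_mul_finMean (y : ι → ℝ) : I.card * finMean I y = ∑ i ∈ I, y i := by
  rcases I.eq_empty_or_nonempty with rfl | h
  · simp
  · have : (I.card : ℝ) ≠ 0 := by exact_mod_cast h.card_pos.ne'
    rw [finMean]; field_simp

theorem sum_sub_sq (y : ι → ℝ) (c : ℝ) : ∑ i ∈ I, (y i - c) ^ 2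
    = ∑ i ∈ I, (y i - finMean I y) ^ 2 + I.card * (finMean I y - c) ^ 2 := by
  have h := card_mul_finMean (I := I) y
  have h1 : ∀ i, (y i - c) ^ 2 = (y i - finMean I y) ^ 2
      + (2 * (finMean I y - c) * y i - 2 * (finMean I y - c) * finMean I y)
      + (finMean I y - c) ^ 2 := fun i => by ring
  simp only [h1, Finset.sum_add_distrib, Finset.sum_sub_distrib, ← Finset.mul_sum, ← h,
    Finset.sum_const, nsmul_eq_mul]
  ring

theorem devNorm_sq (y : ι → ℝ) : devNorm I y ^ 2 = ∑ i ∈ I, (y i - finMean I y) ^ 2 :=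
  Real.sq_sqrt (Finset.sum_nonneg fun _ _ => sq_nonneg _)

theorem devNorm_le (y : ι → ℝ) (c : ℝ) : devNorm I y ≤ √(∑ i ∈ I, (y i - c) ^ 2) := by
  refine Real.sqrt_le_sqrt ?_
  rw [sum_sub_sq y c]
  have : 0 ≤ (I.card : ℝ) * (finMean I y - c) ^ 2 := by positivity
  linarith

theorem sqrt_sum_add_sq_le (a b : ι → ℝ) :
    √(∑ i ∈ I, (a i + b i) ^ 2) ≤ √(∑ i ∈ I, a i ^ 2) + √(∑ i ∈ I, b i ^ 2) := by
  have := Real.Lp_add_le I a b (p := 2) (by norm_num)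
  simpa [Real.sqrt_eq_rpow, sq_abs] using this

theorem devNorm_le_add {y z : ι → ℝ} {ε : ℝ} (hε : 0 ≤ ε) (h : ∀ i ∈ I, |y i - z i| ≤ ε) :
    devNorm I y ≤ devNorm I z + √I.card * ε := by
  refine (devNorm_le y (finMean I z)).trans ?_
  have h1 := sqrt_sum_add_sq_le (I := I) (fun i => z i - finMean I z) (fun i => y i - z i)
  have e : ∀ i, z i - finMean I z + (y i - z i) = y i - finMean I z := fun i => by ring
  simp only [e] at h1
  refine h1.trans (add_le_add le_rfl ?_)
  calc √(∑ i ∈ I, (y i - z i) ^ 2) ≤ √(∑ _i ∈ I, ε ^ 2) := by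
        refine Real.sqrt_le_sqrt (Finset.sum_le_sum fun i hi => ?_)
        rw [← sq_abs]
        exact pow_le_pow_left₀ (abs_nonneg _) (h i hi) 2
    _ = √I.card * ε := by
        rw [Finset.sum_const, nsmul_eq_mul, Real.sqrt_mul (by positivity), Real.sqrt_sq hε]

theorem finMean_mem {y : ι → ℝ} {M : ℝ} (hM : 0 ≤ M) (h : ∀ i ∈ I, y i ∈ Set.Icc 0 M) :
    finMean I y ∈ Set.Icc 0 M := by
  constructor
  · exact div_nonneg (Finset.sum_nonneg fun i hi => (h i hi).1) (by positivity)
  · rcases I.eq_empty_or_nonempty with rfl | hne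
    · simpa [finMean] using hM
    · have : (0 : ℝ) < I.card := by exact_mod_cast hne.card_pos
      rw [finMean, div_le_iff₀ this]
      calc ∑ i ∈ I, y i ≤ ∑ _i ∈ I, M := Finset.sum_le_sum fun i hi => (h i hi).2
        _ = M * I.card := by rw [Finset.sum_const, nsmul_eq_mul, mul_comm]

theorem devNorm_le_sqrt_card {y : ι → ℝ} {M : ℝ} (hM : 0 ≤ M) (h : ∀ i ∈ I, y i ∈ Set.Icc 0 M) :
    devNorm I y ≤ √I.card * M := by
  refine (devNorm_le y 0).trans ?_
  calc √(∑ i ∈ I, (y i - 0) ^ 2) ≤ √(∑ _i ∈ I, M ^ 2) := by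
        refine Real.sqrt_le_sqrt (Finset.sum_le_sum fun i hi => ?_)
        rw [sub_zero]
        exact pow_le_pow_left₀ (h i hi).1 (h i hi).2 2
    _ = √I.card * M := by
        rw [Finset.sum_const, nsmul_eq_mul, Real.sqrt_mul (by positivity), Real.sqrt_sq hM]

theorem devNorm_le_insert {y : ι → ℝ} {j : ι} (hj : j ∉ I) :
    devNorm I y ≤ devNorm (insert j I) y := by
  refine (devNorm_le y (finMean (insert j I) y)).trans (Real.sqrt_le_sqrt ?_)
  rw [Finset.sum_insert hj]
  have := sq_nonneg (y j - finMean (insert j I) y)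
  linarith

theorem devNorm_insert_le {y : ι → ℝ} {j : ι} {M : ℝ} (hM : 0 ≤ M)
    (h : ∀ i ∈ insert j I, y i ∈ Set.Icc 0 M) (hj : j ∉ I) :
    devNorm (insert j I) y ≤ devNorm I y + M := by
  refine (devNorm_le y (finMean I y)).trans ?_
  rw [Finset.sum_insert hj, ← devNorm_sq]
  refine Real.sqrt_le_iff.2 ⟨add_nonneg (devNorm_nonneg _) hM, ?_⟩
  have h1 := finMean_mem hM fun i hi => h i (Finset.mem_insert_of_mem hi)
  have h2 := h j (Finset.mem_insert_self _ _)
  have h3 : (y j - finMean I y) ^ 2 ≤ M ^ 2 := by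
    rw [← sq_abs]
    refine pow_le_pow_left₀ (abs_nonneg _) (abs_sub_le_iff.2 ⟨?_, ?_⟩) 2 <;>
      linarith [h1.1, h1.2, h2.1, h2.2]
  nlinarith [mul_nonneg (devNorm_nonneg (I := I) y) hM]

end Deviation

/-! ### Chernoff bounds for independent coordinates -/

section Chernoff

theorem exp_le_of_abs_le_one {x : ℝ} (hx : |x| ≤ 1) :
    Real.exp x ≤ 1 + x + x ^ 2 / 2 * (1 + |x|) := by
  have h := Real.exp_bound hx (n := 3) (by norm_num)
  simp only [Finset.sum_range_succ, Finset.sum_range_zero, Nat.factorial] at h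
  have h1 := (abs_le.1 h).2
  have h2 : |x| ^ 3 = x ^ 2 * |x| := by rw [pow_succ, sq_abs]
  have h3 : 0 ≤ x ^ 2 * |x| := by positivity
  norm_num at h1
  rw [h2] at h1
  nlinarith

/-- Because (1 − x + x²/2)(1 + x + x²/2) = 1 + x⁴/4 ≥ 1, while the second factor is at most exp x.
-/
theorem exp_neg_le_of_nonneg {x : ℝ} (hx : 0 ≤ x) : Real.exp (-x) ≤ 1 - x + x ^ 2 / 2 := by
  have h1 : (1 - x + x ^ 2 / 2) * (1 + x + x ^ 2 / 2) = 1 + x ^ 4 / 4 := by ring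
  have h2 := Real.quadratic_le_exp_of_nonneg hx
  have h3 : Real.exp (-x) * Real.exp x = 1 := by rw [← Real.exp_add]; simp
  have h4 : 0 < 1 - x + x ^ 2 / 2 := by nlinarith [sq_nonneg (x - 1)]
  have h5 : (1 - x + x ^ 2 / 2) * (1 + x + x ^ 2 / 2) ≤ (1 - x + x ^ 2 / 2) * Real.exp x :=
    mul_le_mul_of_nonneg_left h2 h4.le
  have h6 : Real.exp (-x) * Real.exp x ≤ (1 - x + x ^ 2 / 2) * Real.exp x := by
    rw [h3]; nlinarith [sq_nonneg (x ^ 2)]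
  exact le_of_mul_le_mul_right h6 (Real.exp_pos x)

variable {ι E : Type*} [Fintype ι] [DecidableEq ι] [MeasurableSpace E]
  {Q : ι → Measure E} [∀ i, IsProbabilityMeasure (Q i)] {Q₀ : Measure E} [IsProbabilityMeasure Q₀]
  {I : Finset ι}

/-- Only the coordinates in `I` need the law `Q₀`. The others stay arbitrary because, after
conditioning, they are the episodes that miss the given state-action pair and have a different law.
-/
theorem measure_sum_ge_le (hQ : ∀ i ∈ I, Q i = Q₀) {ψ : E → ℝ} (hψ : BddMeas ψ) {v : ℝ}
    (hv : ∫ e, Real.exp (ψ e) ∂Q₀ ≤ Real.exp v) (t : ℝ) :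
    Measure.pi Q {x | t ≤ ∑ i ∈ I, ψ (x i)} ≤ ENNReal.ofReal (Real.exp (I.card * v - t)) := by
  have h1 : ∫ x, Real.exp (∑ i ∈ I, ψ (x i)) ∂(Measure.pi Q) ≤ Real.exp (I.card * v) := by
    have e : ∀ x : ι → E, Real.exp (∑ i ∈ I, ψ (x i))
        = ∏ i, (if i ∈ I then fun e => Real.exp (ψ e) else fun _ => 1) (x i) := fun x => by
      rw [Real.exp_sum, ← Finset.prod_subset (Finset.subset_univ I)
        (fun i _ hi => by simp [hi])]
      exact Finset.prod_congr rfl fun i hi => by simp [hi]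
    simp only [e]
    rw [integral_fintype_prod_eq_prod]
    calc ∏ i, ∫ x, (if i ∈ I then fun e => Real.exp (ψ e) else fun _ => 1) x ∂(Q i)
        = ∏ i ∈ I, ∫ e, Real.exp (ψ e) ∂Q₀ := by
          rw [← Finset.prod_subset (Finset.subset_univ I) (fun i _ hi => by simp [hi])]
          exact Finset.prod_congr rfl fun i hi => by simp [hi, hQ i hi]
      _ ≤ ∏ i ∈ I, Real.exp v :=
          Finset.prod_le_prod (fun _ _ => integral_nonneg fun _ => (Real.exp_pos _).le)
            fun _ _ => hv
      _ = Real.exp (I.card * v) := by rw [Finset.prod_const, ← Real.exp_nat_mul]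
  refine (measure_ge_le_of_integral_exp_le
    (BddMeas.sum _ fun i _ => hψ.comp (measurable_pi_apply i)) h1 t).trans (le_of_eq ?_)
  rw [← Real.exp_add]
  rfl

theorem measure_sum_gt_bernstein (hQ : ∀ i ∈ I, Q i = Q₀) {ψ : E → ℝ} (hψ : Measurable ψ) {M : ℝ}
    (hM : 0 < M) (hb : ∀ e, |ψ e| ≤ M) (h0 : ∫ e, ψ e ∂Q₀ = 0) {u : ℝ} (hu : 0 ≤ u) :
    Measure.pi Q {x | √(2 * I.card * (∫ e, ψ e ^ 2 ∂Q₀) * u) + 3 * M * u < ∑ i ∈ I, ψ (x i)}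
      ≤ ENNReal.ofReal (Real.exp (-u)) := by
  have hm : BddMeas ψ := ⟨hψ, M, hb⟩
  set V := ∫ e, ψ e ^ 2 ∂Q₀ with hV
  have hV0 : 0 ≤ V := integral_nonneg fun _ => sq_nonneg _
  set m : ℝ := (I.card : ℝ) with hmc
  have hm0 : 0 ≤ m := by positivity
  have mgf : ∀ lam : ℝ, 0 ≤ lam → lam * M ≤ 1 →
      ∫ e, Real.exp (lam * ψ e) ∂Q₀ ≤ Real.exp (lam ^ 2 / 2 * (1 + lam * M) * V) := by
    intro lam hl hlM
    have h1 : ∀ e, Real.exp (lam * ψ e)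
        ≤ 1 + lam * ψ e + lam ^ 2 / 2 * (1 + lam * M) * ψ e ^ 2 := fun e => by
      have ha : |lam * ψ e| ≤ lam * M := by
        rw [abs_mul, abs_of_nonneg hl]; exact mul_le_mul_of_nonneg_left (hb e) hl
      have := exp_le_of_abs_le_one (ha.trans hlM)
      have h2 : (lam * ψ e) ^ 2 / 2 * (1 + |lam * ψ e|)
          ≤ (lam * ψ e) ^ 2 / 2 * (1 + lam * M) := by gcongr
      nlinarith
    have h2 := integral_mono ((hm.const_mul lam).exp.integrable Q₀)
      ((((BddMeas.const 1).add (hm.const_mul lam)).add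
        ((hm.pow 2).const_mul (lam ^ 2 / 2 * (1 + lam * M)))).integrable Q₀) h1
    rw [integral_add (((BddMeas.const 1).add (hm.const_mul lam)).integrable Q₀)
      (((hm.pow 2).const_mul _).integrable Q₀),
      integral_add ((BddMeas.const 1).integrable Q₀) ((hm.const_mul lam).integrable Q₀),
      integral_const_mul, integral_const_mul, h0, ← hV] at h2
    refine h2.trans ?_
    have := Real.add_one_le_exp (lam ^ 2 / 2 * (1 + lam * M) * V)
    simp only [integral_const, probReal_univ, smul_eq_mul, mul_one, mul_zero, add_zero]
    linarith
  set t := √(2 * m * V * u) + 3 * M * u with ht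
  have main : ∀ lam : ℝ, 0 ≤ lam → lam * M ≤ 1 →
      m * (lam ^ 2 / 2 * (1 + lam * M) * V) - lam * t ≤ -u →
      Measure.pi Q {x | t < ∑ i ∈ I, ψ (x i)} ≤ ENNReal.ofReal (Real.exp (-u)) := by
    intro lam hl hlM hfin
    refine (measure_mono ?_).trans ((measure_sum_ge_le (I := I) hQ (hm.const_mul lam)
      (mgf lam hl hlM) (lam * t)).trans (ENNReal.ofReal_le_ofReal (Real.exp_le_exp.2 hfin)))
    intro x hx
    simp only [Set.mem_ofPred_eq, ← Finset.mul_sum] at hx ⊢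
    exact mul_le_mul_of_nonneg_left hx.le hl
  -- The optimal λ = √(2u/(mV)) is admissible (λM ≤ 1) exactly when 2uM² ≤ mV. Otherwise λ = 1/M is
  -- used: then mV/M² ≤ 2u, and the term 3Mu in the threshold pays for it.
  by_cases hc : 2 * u * M ^ 2 ≤ m * V ∧ 0 < u
  · obtain ⟨hc, hu⟩ := hc
    have hmV : 0 < m * V := lt_of_lt_of_le (by positivity) hc
    have hmne : m ≠ 0 := left_ne_zero_of_mul hmV.ne'
    have hVne : V ≠ 0 := right_ne_zero_of_mul hmV.ne'
    set lam := √(2 * u / (m * V)) with hlam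
    have hl2 : lam ^ 2 = 2 * u / (m * V) := Real.sq_sqrt (by positivity)
    have hlM : lam * M ≤ 1 := by
      rw [← abs_of_nonneg (show 0 ≤ lam * M by positivity)]
      refine abs_le_one_iff_mul_self_le_one.2 ?_
      have : lam * M * (lam * M) = lam ^ 2 * M ^ 2 := by ring
      rw [this, hl2, div_mul_eq_mul_div, div_le_one hmV]
      exact hc
    have hst : lam * √(2 * m * V * u) = 2 * u := by
      rw [hlam, ← Real.sqrt_mul (by positivity)]
      have : 2 * u / (m * V) * (2 * m * V * u) = (2 * u) ^ 2 := by field_simp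
      rw [this, Real.sqrt_sq (by positivity)]
    refine main lam (Real.sqrt_nonneg _) hlM ?_
    have h1 : m * (lam ^ 2 / 2 * (1 + lam * M) * V) = u * (1 + lam * M) := by
      rw [hl2]; field_simp
    rw [h1, ht, mul_add lam, hst]
    nlinarith [mul_nonneg (mul_nonneg (Real.sqrt_nonneg (2 * u / (m * V))) hM.le) hu.le]
  · rcases hu.eq_or_lt with rfl | hu'
    · simpa using prob_le_one
    · have hc' : m * V < 2 * u * M ^ 2 := by
        by_contra h
        exact hc ⟨not_lt.1 h, hu'⟩
      refine main M⁻¹ (by positivity) (by field_simp; exact le_rfl) ?_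
      have h1 : m * (M⁻¹ ^ 2 / 2 * (1 + M⁻¹ * M) * V) = m * V / M ^ 2 := by field_simp; ring
      have h2 : m * V / M ^ 2 ≤ 2 * u := by
        rw [div_le_iff₀ (by positivity)]; exact hc'.le
      have h3 : M⁻¹ * t = M⁻¹ * √(2 * m * V * u) + 3 * u := by rw [ht]; field_simp
      have h4 : 0 ≤ M⁻¹ * √(2 * m * V * u) := by positivity
      rw [h1, h3]
      linarith

/-- For nonnegative variables the lower tail needs no variance: w² ≤ b·w turns the second-order term
of exp(−λw) into a multiple of the mean. It serves both the visit counts and the empirical second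
moment. -/
theorem measure_sum_lt_le (hQ : ∀ i ∈ I, Q i = Q₀) {w : E → ℝ} (hw : Measurable w) {b : ℝ}
    (hb : ∀ e, w e ∈ Set.Icc 0 b) {u : ℝ} (hu : 0 ≤ u) :
    Measure.pi Q {x | ∑ i ∈ I, w (x i) <
        I.card * (∫ e, w e ∂Q₀) - √(2 * I.card * b * (∫ e, w e ∂Q₀) * u)}
      ≤ ENNReal.ofReal (Real.exp (-u)) := by
  have hm : BddMeas w := ⟨hw, b, fun e => by rw [abs_of_nonneg (hb e).1]; exact (hb e).2⟩
  set p := ∫ e, w e ∂Q₀ with hp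
  have hp0 : 0 ≤ p := integral_nonneg fun e => (hb e).1
  set m : ℝ := (I.card : ℝ) with hmc
  have hm0 : 0 ≤ m := by positivity
  have hb0 : 0 ≤ b := by
    obtain ⟨e⟩ := nonempty_of_isProbabilityMeasure Q₀
    exact (hb e).1.trans (hb e).2
  by_cases hpos : 0 < m * b * p * u
  · have hmbp : 0 < m * b * p := by
      rcases (mul_nonneg (mul_nonneg hm0 hb0) hp0).eq_or_lt with h | h
      · rw [← h, zero_mul] at hpos; exact absurd hpos (lt_irrefl _)
      · exact h
    have hpne : p ≠ 0 := right_ne_zero_of_mul hmbp.ne'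
    have hmne : m ≠ 0 := left_ne_zero_of_mul (left_ne_zero_of_mul hmbp.ne')
    have hbne : b ≠ 0 := right_ne_zero_of_mul (left_ne_zero_of_mul hmbp.ne')
    have mgf : ∀ lam : ℝ, 0 ≤ lam →
        ∫ e, Real.exp (-lam * w e) ∂Q₀ ≤ Real.exp (-lam * p + lam ^ 2 * b * p / 2) := by
      intro lam hl
      have h1 : ∀ e, Real.exp (-lam * w e) ≤ 1 + (-lam + lam ^ 2 * b / 2) * w e := fun e => by
        have := exp_neg_le_of_nonneg (mul_nonneg hl (hb e).1)
        have h2 : w e * w e ≤ b * w e := mul_le_mul_of_nonneg_right (hb e).2 (hb e).1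
        have h3 := mul_le_mul_of_nonneg_left h2 (sq_nonneg lam)
        rw [neg_mul]
        nlinarith
      have h2 := integral_mono ((hm.const_mul (-lam)).exp.integrable Q₀)
        (((BddMeas.const 1).add (hm.const_mul (-lam + lam ^ 2 * b / 2))).integrable Q₀) h1
      rw [integral_add ((BddMeas.const 1).integrable Q₀) ((hm.const_mul _).integrable Q₀),
        integral_const_mul, ← hp] at h2
      have h3 := Real.add_one_le_exp (-lam * p + lam ^ 2 * b * p / 2)
      simp only [integral_const, probReal_univ, smul_eq_mul, mul_one] at h2
      nlinarith
    set lam := √(2 * u / (m * b * p)) with hlam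
    have hl2 : lam ^ 2 = 2 * u / (m * b * p) := Real.sq_sqrt (by positivity)
    set s := √(2 * m * b * p * u) with hs
    have hst : lam * s = 2 * u := by
      rw [hlam, hs, ← Real.sqrt_mul (by positivity)]
      have : 2 * u / (m * b * p) * (2 * m * b * p * u) = (2 * u) ^ 2 := by field_simp
      rw [this, Real.sqrt_sq (by positivity)]
    have hl0 : 0 ≤ lam := Real.sqrt_nonneg _
    refine (measure_mono ?_).trans ((measure_sum_ge_le (I := I) hQ (hm.const_mul (-lam))
      (mgf lam hl0) (-lam * (m * p - s))).trans
        (ENNReal.ofReal_le_ofReal (Real.exp_le_exp.2 ?_)))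
    · intro x hx
      simp only [Set.mem_ofPred_eq, ← Finset.mul_sum] at hx ⊢
      nlinarith
    · have h1 : m * (lam ^ 2 * b * p / 2) = u := by rw [hl2]; field_simp
      nlinarith
  · have hz : 2 * m * b * p * u = 0 := by
      have : 0 ≤ m * b * p * u := by positivity
      nlinarith
    rcases hu.eq_or_lt with rfl | hu'
    · simpa using prob_le_one
    have hmp : m * p = 0 := by
      rcases hm0.eq_or_lt with h | h
      · rw [← h, zero_mul]
      rcases hp0.eq_or_lt with h' | h'
      · rw [← h', mul_zero]
      rcases hb0.eq_or_lt with h'' | h''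
      · have : p ≤ 0 := by
          rw [hp]
          exact integral_nonpos fun e => by simpa [← h''] using (hb e).2
        linarith
      · exact absurd (by positivity) hpos
    have : {x : ι → E | ∑ i ∈ I, w (x i) < m * p - √(2 * m * b * p * u)} = ∅ := by
      ext x
      simp only [Set.mem_ofPred_eq, Set.mem_empty_iff_false, iff_false, not_lt, hz, hmp,
        Real.sqrt_zero, sub_zero]
      exact Finset.sum_nonneg fun i _ => (hb _).1
    rw [this, measure_empty]
    exact zero_le

/-- With λ = 1/(Kb) the exponent is at most 1/K, so exp(y) ≤ 1 + y + y² ≤ 1 + (1 + 1/K)y. The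
relative error 1/K is kept as a parameter: for K = H it compounds to a constant over the horizon. -/
theorem measure_sum_gt_multiplicative (hQ : ∀ i ∈ I, Q i = Q₀) {w : E → ℝ} (hw : Measurable w)
    {b K : ℝ} (hb0 : 0 < b) (hK : 1 ≤ K) (hb : ∀ e, w e ∈ Set.Icc 0 b) (u : ℝ) :
    Measure.pi Q {x | I.card * ((1 + 1 / K) * ∫ e, w e ∂Q₀) + K * b * u < ∑ i ∈ I, w (x i)}
      ≤ ENNReal.ofReal (Real.exp (-u)) := by
  have hm : BddMeas w := ⟨hw, b, fun e => by rw [abs_of_nonneg (hb e).1]; exact (hb e).2⟩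
  set p := ∫ e, w e ∂Q₀ with hp
  have hK0 : 0 < K := by linarith
  set lam := 1 / (K * b) with hlam
  have hl0 : 0 < lam := by positivity
  have hlb : lam * b = 1 / K := by rw [hlam]; field_simp
  have hK1 : 1 / K ≤ 1 := by rw [div_le_one hK0]; exact hK
  have mgf : ∫ e, Real.exp (lam * w e) ∂Q₀ ≤ Real.exp (lam * ((1 + 1 / K) * p)) := by
    have h1 : ∀ e, Real.exp (lam * w e) ≤ 1 + lam * (1 + 1 / K) * w e := fun e => by
      have h2 : lam * w e ≤ 1 / K := by
        rw [← hlb]; exact mul_le_mul_of_nonneg_left (hb e).2 hl0.le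
      have h3 : 0 ≤ lam * w e := mul_nonneg hl0.le (hb e).1
      have h4 : |lam * w e| ≤ 1 := by rw [abs_of_nonneg h3]; linarith
      have := (abs_le.1 (Real.abs_exp_sub_one_sub_id_le h4)).2
      nlinarith
    have h2 := integral_mono ((hm.const_mul lam).exp.integrable Q₀)
      (((BddMeas.const 1).add (hm.const_mul (lam * (1 + 1 / K)))).integrable Q₀) h1
    rw [integral_add ((BddMeas.const 1).integrable Q₀) ((hm.const_mul _).integrable Q₀),
      integral_const_mul, ← hp] at h2
    have h3 := Real.add_one_le_exp (lam * ((1 + 1 / K) * p))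
    simp only [integral_const, probReal_univ, smul_eq_mul, mul_one] at h2
    nlinarith
  refine (measure_mono ?_).trans ((measure_sum_ge_le (I := I) hQ (hm.const_mul lam) mgf
    (lam * (I.card * ((1 + 1 / K) * p) + K * b * u))).trans
      (ENNReal.ofReal_le_ofReal (Real.exp_le_exp.2 ?_)))
  · intro x hx
    simp only [Set.mem_ofPred_eq, ← Finset.mul_sum] at hx ⊢
    exact mul_le_mul_of_nonneg_left hx.le hl0.le
  · have : lam * (K * b * u) = u := by rw [hlam]; field_simp
    nlinarith

end Chernoff

/-! ### Bernstein inequalities with the empirical deviation. -/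

section EmpiricalBernstein

/-- The deterministic part of the comparison between true and empirical standard deviation: W is the
sum of squares around the true mean, D² the one around the empirical mean, and T²/m the difference
between them. -/
theorem sqrt_mul_sd_le {m σ M u D T W : ℝ} (hm : 0 < m) (hσ : 0 ≤ σ) (hσM : σ ≤ M) (hu : 0 ≤ u)
    (hD : 0 ≤ D) (hW : W = D ^ 2 + T ^ 2 / m)
    (h1 : m * σ ^ 2 - √(2 * m * M ^ 2 * σ ^ 2 * u) ≤ W)
    (h2 : |T| ≤ √(2 * m * σ ^ 2 * u) + 3 * M * u) :
    √m * σ ≤ D + 10 * M * √u := by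
  have hM : 0 ≤ M := hσ.trans hσM
  set r := √u with hr
  set k := √m with hk
  have hr0 : 0 ≤ r := Real.sqrt_nonneg _
  have hk0 : 0 < k := Real.sqrt_pos.2 hm
  have hr2 : u = r ^ 2 := (Real.sq_sqrt hu).symm
  have hk2 : m = k ^ 2 := (Real.sq_sqrt hm.le).symm
  have h2s : √2 ≤ 1.42 := Real.sqrt_le_iff.2 ⟨by norm_num, by norm_num⟩
  -- If √m ≤ 10√u the claim follows from σ ≤ M. Otherwise √u/√m ≤ 1/10 makes T²/m small enough that,
  -- with s = √m·σ and r = √u, (s − Mr)² ≤ D² + 2(Mr)².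
  by_cases hc : k ≤ 10 * r
  · have : k * σ ≤ 10 * r * M := mul_le_mul hc hσM hσ (by positivity)
    nlinarith
  · replace hc : 10 * r < k := not_le.1 hc
    set s := k * σ with hs
    have hs0 : 0 ≤ s := by positivity
    have e1 : √(2 * m * M ^ 2 * σ ^ 2 * u) = √2 * (M * s * r) := by
      have : 2 * m * M ^ 2 * σ ^ 2 * u = 2 * (M * s * r) ^ 2 := by rw [hr2, hk2]; ring
      rw [this, Real.sqrt_mul (by norm_num), Real.sqrt_sq (by positivity)]
    have e2 : √(2 * m * σ ^ 2 * u) = √2 * (s * r) := by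
      have : 2 * m * σ ^ 2 * u = 2 * (s * r) ^ 2 := by rw [hr2, hk2]; ring
      rw [this, Real.sqrt_mul (by norm_num), Real.sqrt_sq (by positivity)]
    rw [e1] at h1
    rw [e2] at h2
    have hT : T ^ 2 ≤ 4 * (s * r) ^ 2 + 18 * (M * r ^ 2) ^ 2 := by
      have h3 : T ^ 2 ≤ (√2 * (s * r) + 3 * M * u) ^ 2 := by
        rw [← sq_abs]; exact pow_le_pow_left₀ (abs_nonneg _) h2 2
      have h4 : (√2 * (s * r)) ^ 2 = 2 * (s * r) ^ 2 := by
        rw [mul_pow, Real.sq_sqrt (by norm_num)]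
      have h5 := sq_nonneg (√2 * (s * r) - 3 * M * u)
      rw [hr2] at h3 h5
      nlinarith
    have hT2 : T ^ 2 / m ≤ 0.4 * (M * s * r) + 0.18 * (M * r) ^ 2 := by
      rw [div_le_iff₀ hm, hk2]
      have a1 : (s * r) ^ 2 ≤ s * r * (k * M) * (k / 10) := by
        have : s * r * (s * r) ≤ s * r * ((k * M) * (k / 10)) := by
          refine mul_le_mul_of_nonneg_left ?_ (by positivity)
          exact mul_le_mul (mul_le_mul_of_nonneg_left hσM hk0.le) (by linarith) hr0 (by positivity)
        nlinarith
      have a2 : (M * r ^ 2) ^ 2 ≤ (M * r) ^ 2 * (k / 10) ^ 2 := by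
        have : r ^ 2 ≤ (k / 10) ^ 2 := pow_le_pow_left₀ hr0 (by linarith) 2
        have := mul_le_mul_of_nonneg_left this (sq_nonneg (M * r))
        nlinarith
      nlinarith
    have h6 : m * σ ^ 2 = s ^ 2 := by rw [hk2, hs]; ring
    have h7 : √2 * (M * s * r) ≤ 1.42 * (M * s * r) := by gcongr
    have h8 : s ^ 2 ≤ D ^ 2 + 2 * (M * s * r) + (M * r) ^ 2 := by
      have : 0 ≤ M * s * r := by positivity
      nlinarith [sq_nonneg (M * r)]
    have h9 : 0 ≤ M * r := by positivity
    by_contra hcon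
    push Not at hcon
    have h10 : D + 9 * (M * r) < s - M * r := by linarith
    have h11 : (D + 9 * (M * r)) ^ 2 < (s - M * r) ^ 2 :=
      pow_lt_pow_left₀ h10 (by positivity) (by norm_num)
    have h12 : (D + 9 * (M * r)) ^ 2 = D ^ 2 + 18 * (D * (M * r)) + 81 * (M * r) ^ 2 := by ring
    have h13 : (s - M * r) ^ 2 = s ^ 2 - 2 * (M * s * r) + (M * r) ^ 2 := by ring
    rw [h12, h13] at h11
    have h14 := mul_nonneg hD h9
    have h15 := sq_nonneg (M * r)
    linarith

variable {ι E : Type*} [Fintype ι] [DecidableEq ι] [MeasurableSpace E]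
  {Q : ι → Measure E} [∀ i, IsProbabilityMeasure (Q i)] {Q₀ : Measure E} [IsProbabilityMeasure Q₀]
  {I : Finset ι}

theorem abs_sub_integral_le {y : E → ℝ} (hy : Measurable y) {M : ℝ}
    (hb : ∀ e, y e ∈ Set.Icc 0 M) (e : E) : |y e - ∫ e', y e' ∂Q₀| ≤ M := by
  have hm : BddMeas y := ⟨hy, M, fun e => by rw [abs_of_nonneg (hb e).1]; exact (hb e).2⟩
  have h1 : 0 ≤ ∫ e', y e' ∂Q₀ := integral_nonneg fun e => (hb e).1
  have h2 : ∫ e', y e' ∂Q₀ ≤ M := by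
    simpa using integral_mono (hm.integrable Q₀) (integrable_const M) fun e => (hb e).2
  exact abs_sub_le_iff.2 ⟨by linarith [(hb e).2], by linarith [(hb e).1]⟩

/-- Three failure events: the lower tail of the sum of squares around the true mean, and the two
tails of the centred sum, which control the squared error of the empirical mean. -/
theorem measure_sd_gt_le (hI : I.Nonempty) (hQ : ∀ i ∈ I, Q i = Q₀) {y : E → ℝ}
    (hy : Measurable y) {M : ℝ} (hM : 0 < M) (hb : ∀ e, y e ∈ Set.Icc 0 M) {u : ℝ} (hu : 0 ≤ u) :
    Measure.pi Q {x | devNorm I (fun i => y (x i)) + 10 * M * √u <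
        √I.card * √(∫ e, (y e - ∫ e', y e' ∂Q₀) ^ 2 ∂Q₀)}
      ≤ 3 * ENNReal.ofReal (Real.exp (-u)) := by
  set μ := ∫ e', y e' ∂Q₀ with hμ
  have hcb : ∀ e, |y e - μ| ≤ M := abs_sub_integral_le hy hb
  have hym : BddMeas y := ⟨hy, M, fun e => by rw [abs_of_nonneg (hb e).1]; exact (hb e).2⟩
  have h0 : ∫ e, (y e - μ) ∂Q₀ = 0 := by
    rw [integral_sub (hym.integrable _) (integrable_const _)]; simp [hμ]
  set V := ∫ e, (y e - μ) ^ 2 ∂Q₀ with hV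
  have hV0 : 0 ≤ V := integral_nonneg fun _ => sq_nonneg _
  have hVM : V ≤ M ^ 2 := by
    have := integral_mono (((hym.sub (BddMeas.const μ)).pow 2).integrable Q₀)
      (integrable_const (M ^ 2)) fun e => by
        show (y e - μ) ^ 2 ≤ M ^ 2
        rw [← sq_abs]; exact pow_le_pow_left₀ (abs_nonneg _) (hcb e) 2
    simpa using this
  have hm : (0 : ℝ) < I.card := by exact_mod_cast hI.card_pos
  have e1 := measure_sum_lt_le (I := I) (Q₀ := Q₀) hQ (w := fun e => (y e - μ) ^ 2)
    ((hy.sub_const μ).pow_const 2) (b := M ^ 2) (fun e => ⟨sq_nonneg _, by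
      rw [← sq_abs]; exact pow_le_pow_left₀ (abs_nonneg _) (hcb e) 2⟩) hu
  have e2 := measure_sum_gt_bernstein (I := I) (Q₀ := Q₀) hQ (ψ := fun e => y e - μ)
    (hy.sub_const μ) hM hcb h0 hu
  have e3 := measure_sum_gt_bernstein (I := I) (Q₀ := Q₀) hQ (ψ := fun e => -(y e - μ))
    (hy.sub_const μ).neg hM (fun e => by rw [abs_neg]; exact hcb e)
    (by rw [integral_neg, h0, neg_zero]) hu
  simp only [neg_sq, ← hV, Finset.sum_neg_distrib] at e1 e2 e3
  have hsum : (3 : ENNReal) * ENNReal.ofReal (Real.exp (-u)) = ENNReal.ofReal (Real.exp (-u))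
      + (ENNReal.ofReal (Real.exp (-u)) + ENNReal.ofReal (Real.exp (-u))) := by ring
  rw [hsum]
  refine (measure_mono ?_).trans ((measure_union_le _ _).trans (add_le_add e1
    ((measure_union_le _ _).trans (add_le_add e2 e3))))
  intro x hx
  by_contra hcon
  simp only [Set.mem_union, Set.mem_ofPred_eq, not_or, not_lt] at hcon hx
  obtain ⟨c1, c2, c3⟩ := hcon
  refine absurd hx (not_lt.2 ?_)
  refine sqrt_mul_sd_le (T := ∑ i ∈ I, (y (x i) - μ)) (W := ∑ i ∈ I, (y (x i) - μ) ^ 2) hm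
    (Real.sqrt_nonneg _) (Real.sqrt_le_iff.2 ⟨hM.le, hVM⟩) hu (devNorm_nonneg _) ?_ ?_ ?_
  · rw [sum_sub_sq (fun i => y (x i)) μ, devNorm_sq]
    have : ∑ i ∈ I, (y (x i) - μ) = I.card * (finMean I (fun i => y (x i)) - μ) := by
      rw [mul_sub, card_mul_finMean]; simp
    rw [this]
    field_simp
  · rw [Real.sq_sqrt hV0]; exact c1
  · rw [Real.sq_sqrt hV0]
    exact abs_le.2 ⟨by linarith, c2⟩

theorem sqrt_two_mul_mul_eq {m V u : ℝ} (hu : 0 ≤ u) (hm : 0 ≤ m) :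
    √(2 * m * V * u) = √(2 * u) * (√m * √V) := by
  rw [show 2 * m * V * u = 2 * u * (m * V) by ring, Real.sqrt_mul (by positivity),
    Real.sqrt_mul hm]

/-- One-sided empirical Bernstein inequality; the confidence level `u'` of the variance estimate
enters only the lower-order term. -/
theorem measure_sum_gt_empirical_bernstein (hI : I.Nonempty) (hQ : ∀ i ∈ I, Q i = Q₀) {y : E → ℝ}
    (hy : Measurable y) {M : ℝ} (hM : 0 < M) (hb : ∀ e, y e ∈ Set.Icc 0 M) {u u' : ℝ} (hu : 0 ≤ u)
    (hu' : 0 ≤ u') :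
    Measure.pi Q {x | √(2 * u) * (devNorm I (fun i => y (x i)) + 10 * M * √u') + 3 * M * u <
        ∑ i ∈ I, (y (x i) - ∫ e, y e ∂Q₀)}
      ≤ ENNReal.ofReal (Real.exp (-u)) + 3 * ENNReal.ofReal (Real.exp (-u')) := by
  set μ := ∫ e', y e' ∂Q₀ with hμ
  have hym : BddMeas y := ⟨hy, M, fun e => by rw [abs_of_nonneg (hb e).1]; exact (hb e).2⟩
  have h0 : ∫ e, (y e - μ) ∂Q₀ = 0 := by
    rw [integral_sub (hym.integrable _) (integrable_const _)]; simp [hμ]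
  have e1 := measure_sum_gt_bernstein (I := I) (Q₀ := Q₀) hQ (ψ := fun e => y e - μ)
    (hy.sub_const μ) hM (abs_sub_integral_le hy hb) h0 hu
  refine (measure_mono ?_).trans ((measure_union_le _ _).trans (add_le_add e1
    (measure_sd_gt_le hI hQ hy hM hb hu')))
  intro x hx
  by_contra hcon
  simp only [Set.mem_union, Set.mem_ofPred_eq, not_or, not_lt] at hcon hx
  obtain ⟨c1, c2⟩ := hcon
  rw [sqrt_two_mul_mul_eq hu (by positivity)] at c1
  have := mul_le_mul_of_nonneg_left c2 (Real.sqrt_nonneg (2 * u))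
  linarith

theorem measure_abs_sum_gt_empirical_bernstein (hI : I.Nonempty) (hQ : ∀ i ∈ I, Q i = Q₀)
    {y : E → ℝ} (hy : Measurable y) {M : ℝ} (hM : 0 < M) (hb : ∀ e, y e ∈ Set.Icc 0 M) {u : ℝ}
    (hu : 0 ≤ u) :
    Measure.pi Q {x | √(2 * u) * (devNorm I (fun i => y (x i)) + 10 * M * √u) + 3 * M * u <
        |∑ i ∈ I, (y (x i) - ∫ e, y e ∂Q₀)|}
      ≤ 8 * ENNReal.ofReal (Real.exp (-u)) := by
  -- Reflection y ↦ M − y keeps the deviation norm and the range and swaps the two tails.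
  set z : E → ℝ := fun e => M - y e with hz
  have hzb : ∀ e, z e ∈ Set.Icc 0 M := fun e =>
    ⟨by linarith [(hb e).2], by simp only [hz]; linarith [(hb e).1]⟩
  have hym : BddMeas y := ⟨hy, M, fun e => by rw [abs_of_nonneg (hb e).1]; exact (hb e).2⟩
  have hzμ : ∫ e, z e ∂Q₀ = M - ∫ e, y e ∂Q₀ := by
    rw [hz, integral_sub (integrable_const _) (hym.integrable _)]; simp
  have hm : (0 : ℝ) < I.card := by exact_mod_cast hI.card_pos
  have hdev : ∀ x : ι → E, devNorm I (fun i => z (x i)) = devNorm I (fun i => y (x i)) := by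
    intro x
    have hmean : finMean I (fun i => z (x i)) = M - finMean I (fun i => y (x i)) := by
      simp only [finMean, hz, Finset.sum_sub_distrib, Finset.sum_const, nsmul_eq_mul]
      field_simp
    simp only [devNorm, hmean]
    congr 1
    refine Finset.sum_congr rfl fun i _ => ?_
    simp only [hz]; ring
  have e1 := measure_sum_gt_empirical_bernstein hI hQ hy hM hb hu hu
  have e2 := measure_sum_gt_empirical_bernstein hI hQ (y := z) (hy.const_sub M) hM hzb hu hu
  have hsum : (8 : ENNReal) * ENNReal.ofReal (Real.exp (-u))
      = (ENNReal.ofReal (Real.exp (-u)) + 3 * ENNReal.ofReal (Real.exp (-u)))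
      + (ENNReal.ofReal (Real.exp (-u)) + 3 * ENNReal.ofReal (Real.exp (-u))) := by ring
  rw [hsum]
  refine (measure_mono ?_).trans ((measure_union_le _ _).trans (add_le_add e1 e2))
  intro x hx
  simp only [Set.mem_union, Set.mem_ofPred_eq, hdev, hzμ] at hx ⊢
  rcases lt_abs.1 hx with h | h
  · exact Or.inl h
  · right
    refine h.trans_eq ?_
    rw [← Finset.sum_neg_distrib]
    refine Finset.sum_congr rfl fun i _ => ?_
    simp only [hz]; ring

end EmpiricalBernstein

/-! ### Empirical Bernstein inequality for data-dependent, stable functions. -/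

section StableBernstein

variable {ι E : Type*} [Fintype ι] [DecidableEq ι] [MeasurableSpace E]
  {Q : ι → Measure E} [∀ i, IsProbabilityMeasure (Q i)] {Q₀ : Measure E} [IsProbabilityMeasure Q₀]
  {I : Finset ι} {S : Type*} [Fintype S] [MeasurableSpace S] [DiscreteMeasurableSpace S]

theorem measure_abs_sub_blockAvg_ge_le {K : Finset ι} (hK : K.Nonempty) {β : ℝ} (hβ : 0 < β)
    {g : (ι → E) → ℝ} (hg : BddMeas g) (hd : BddDiff K β g) {u : ℝ} (hu : 0 ≤ u) :
    Measure.pi Q {x | β * √(12 * K.card * u) < |g x - blockAvg Q K g x|}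
      ≤ 2 * ENNReal.ofReal (Real.exp (-u)) := by
  have hm : (0 : ℝ) < K.card := by exact_mod_cast hK.card_pos
  set t : ℝ := 1 / (12 * K.card * β ^ 2) with ht
  have h1 := integral_exp_sq_le (Q := Q) (t := t) hβ.le (by positivity) hg hd
    (by rw [ht]; field_simp; exact le_rfl)
  have h2 := measure_ge_le_of_integral_exp_le (((hg.sub (hg.blockAvg K)).pow 2).const_mul t) h1 u
  rw [ENNReal.ofReal_mul (by norm_num), ENNReal.ofReal_ofNat] at h2
  refine (measure_mono fun x hx => ?_).trans h2
  simp only [Set.mem_ofPred_eq] at hx ⊢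
  have h3 : (β * √(12 * K.card * u)) ^ 2 ≤ (g x - blockAvg Q K g x) ^ 2 := by
    rw [← sq_abs (g x - _)]
    exact pow_le_pow_left₀ (by positivity) hx.le 2
  rw [mul_pow, Real.sq_sqrt (by positivity)] at h3
  calc u = t * (β ^ 2 * (12 * K.card * u)) := by rw [ht]; field_simp
    _ ≤ _ := mul_le_mul_of_nonneg_left h3 (by positivity)

theorem integral_comp_eq_sum {X : E → S} (hX : Measurable X) (ν : Measure E) [IsFiniteMeasure ν]
    (c : S → ℝ) : ∫ e, c (X e) ∂ν = ∑ s, ν.real (X ⁻¹' {s}) * c s := by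
  have hc : Measurable c := measurable_of_countable c
  rw [← integral_map hX.aemeasurable hc.aestronglyMeasurable,
    integral_fintype (Integrable.of_finite)]
  refine Finset.sum_congr rfl fun s _ => ?_
  rw [Measure.real, Measure.map_apply hX (measurableSet_singleton s), smul_eq_mul, Measure.real]

open Classical in
/-- Empirical Bernstein inequality for a function that depends on the sample in a stable way. -/
theorem measure_sum_gt_stable_bernstein (hI : I.Nonempty) (hQ : ∀ i ∈ I, Q i = Q₀)
    {X : E → S} (hX : Measurable X) {ρ : E → ℝ} (hρ : Measurable ρ)
    (hρ1 : ∀ e, ρ e ∈ Set.Icc (0 : ℝ) 1) {f : S → (ι → E) → ℝ} {M β : ℝ} (hβ : 0 < β)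
    (hf : ∀ s, Measurable (f s)) (hM : 1 ≤ M) (hfM : ∀ s x, f s x ∈ Set.Icc 0 (M - 1))
    (hd : ∀ s, BddDiff I β (f s)) {c : S → ℝ} (hc : ∀ s x, blockAvg Q I (f s) x = c s)
    {l : ℕ} (hl : I.card ≤ 2 ^ l) {u u' : ℝ} (hu : 0 ≤ u) (hu' : 0 ≤ u') :
    Measure.pi Q {x | √(2 * u) * (devNorm I (fun i => ρ (x i) + f (X (x i)) x)
          + √I.card * (β * √(12 * I.card * u')) + 10 * M * √u') + 3 * M * u
          + 2 * I.card * β + 8 * 2 ^ l * β * (l + 1) * u' <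
        ∑ i ∈ I, (ρ (x i) + f (X (x i)) x
          - (∫ e, ρ e ∂Q₀ + ∑ s, Q₀.real (X ⁻¹' {s}) * f s x))}
      ≤ ENNReal.ofReal (Real.exp (-u))
        + (5 + 2 * Fintype.card S) * ENNReal.ofReal (Real.exp (-u')) := by
  set q : S → ℝ := fun s => Q₀.real (X ⁻¹' {s}) with hq
  have hq0 : ∀ s, 0 ≤ q s := fun s => measureReal_nonneg
  have hq1 : ∑ s, q s = 1 := by
    have := integral_comp_eq_sum hX Q₀ (fun _ => 1)
    simpa using this.symm
  have hfm : ∀ s, BddMeas (f s) := fun s =>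
    ⟨hf s, M - 1, fun x => by rw [abs_of_nonneg (hfM s x).1]; exact (hfM s x).2⟩
  have hcM : ∀ s, c s ∈ Set.Icc 0 (M - 1) := fun s => by
    obtain ⟨x⟩ : Nonempty (ι → E) := nonempty_of_isProbabilityMeasure (Measure.pi Q)
    rw [← hc s x]
    constructor
    · exact integral_nonneg fun y => (hfM s _).1
    · have := integral_mono (((hfm s).section I x).integrable (Measure.pi Q))
        (integrable_const (M - 1)) fun y => (hfM s _).2
      simpa [blockAvg] using this
  -- the three good events
  have ev1 := measure_sum_gt_empirical_bernstein (I := I) (Q₀ := Q₀) hI hQ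
    (y := fun e => ρ e + c (X e)) (hρ.add ((measurable_of_countable c).comp hX)) (M := M)
    (by linarith) (fun e => ⟨add_nonneg (hρ1 e).1 (hcM _).1, by
      linarith [(hρ1 e).2, (hcM (X e)).2]⟩) hu hu'
  have ev2 : Measure.pi Q (⋃ s, {x | β * √(12 * I.card * u') < |f s x - c s|})
      ≤ (2 * Fintype.card S) * ENNReal.ofReal (Real.exp (-u')) := by
    refine (measure_iUnion_fintype_le _ _).trans ?_
    calc ∑ s, Measure.pi Q {x | β * √(12 * I.card * u') < |f s x - c s|}
        ≤ ∑ _s : S, 2 * ENNReal.ofReal (Real.exp (-u')) := Finset.sum_le_sum fun s _ => by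
          have := measure_abs_sub_blockAvg_ge_le (Q := Q) hI hβ (hfm s) (hd s) hu'
          simpa only [hc] using this
      _ = _ := by rw [Finset.sum_const, nsmul_eq_mul, Finset.card_univ]; ring
  -- Centred indicators: the sum over s of a i s · φ s is φ(X_i) minus its mean under `Q₀`. This
  -- isolates the dependence on coordinate `i`, and the total mass of |a i ·| is at most 2.
  set a : ι → S → (ι → E) → ℝ := fun i s x => (if X (x i) = s then 1 else 0) - q s with ha
  have ham : ∀ i s, BddMeas (a i s) := fun i s => by
    refine BddMeas.sub ⟨?_, 1, fun x => ?_⟩ (BddMeas.const _)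
    · exact Measurable.ite ((measurableSet_singleton s).preimage (hX.comp (measurable_pi_apply i)))
        measurable_const measurable_const
    · split_ifs <;> simp
  have ha1 : ∀ i x, ∑ s, |a i s x| ≤ 2 := fun i x => by
    calc ∑ s, |a i s x| ≤ ∑ s, ((if X (x i) = s then 1 else 0) + q s) := by
          refine Finset.sum_le_sum fun s _ => (abs_sub _ _).trans ?_
          rw [abs_of_nonneg (hq0 s)]
          split_ifs <;> simp
      _ = 2 := by rw [Finset.sum_add_distrib, hq1]; simp; norm_num
  -- Averaging `f s` over the coordinate `i` itself makes the coefficient free of `i`, so that `g i`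
  -- is centred in `i`. By stability this replacement costs at most 2β per summand.
  set F : ι → S → (ι → E) → ℝ := fun i s => blockAvg Q {i} (f s) with hF
  have hFm : ∀ i s, BddMeas (F i s) := fun i s => (hfm s).blockAvg _
  set g : ι → (ι → E) → ℝ := fun i x => ∑ s, a i s x * F i s x with hg
  have hgm : ∀ i, BddMeas (g i) := fun i => BddMeas.sum _ fun s _ => (ham i s).mul (hFm i s)
  have hg0 : ∀ i ∈ I, ∀ x, blockAvg Q {i} (g i) x = 0 := by
    intro i hi x
    rw [hg, blockAvg_sum _ fun s _ => (ham i s).mul (hFm i s)]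
    refine Finset.sum_eq_zero fun s _ => ?_
    have hfree : FreeOf {i} (F i s) := freeOf_blockAvg
    have : (fun x => a i s x * F i s x) = fun x => F i s x * a i s x := by funext x; ring
    rw [this, hfree.blockAvg_mul]
    have h1 : blockAvg Q {i} (a i s) x = 0 := by
      have hint : ∫ y : ι → E, (if X (y i) = s then (1 : ℝ) else 0) ∂(Measure.pi Q) = q s := by
        have h2 := (measurePreserving_eval (μ := Q) i)
        have h3 : ∫ e, (if X e = s then (1 : ℝ) else 0) ∂(Q i) = q s := by
          rw [hQ i hi, integral_comp_eq_sum hX Q₀ (fun s' => if s' = s then (1 : ℝ) else 0)]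
          simp [hq]
        rw [← h3, ← h2.map_eq, integral_map h2.measurable.aemeasurable]
        · exact (Measurable.ite ((measurableSet_singleton s).preimage hX)
            measurable_const measurable_const).aestronglyMeasurable
      have hm1 : BddMeas fun y : ι → E => (if X (y i) = s then (1 : ℝ) else 0) := by
        have := (ham i s).add (BddMeas.const (q s))
        simpa [ha] using this
      simp only [blockAvg, ha, Finset.piecewise_singleton, Function.update_self]
      rw [integral_sub (hm1.integrable _) (integrable_const _), hint]
      simp
    simp [h1]
  have hgd : ∀ i ∈ I, BddDiff (I.erase i) (2 * β) (g i) := by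
    intro i _ j hj x v
    have hji : i ≠ j := (Finset.ne_of_mem_erase hj).symm
    have hai : ∀ s, a i s (Function.update x j v) = a i s x := fun s => by
      simp [ha, hji]
    simp only [hg, hai, ← Finset.sum_sub_distrib, ← mul_sub]
    refine (Finset.abs_sum_le_sum_abs _ _).trans ?_
    calc ∑ s, |a i s x * (F i s (Function.update x j v) - F i s x)|
        ≤ ∑ s, |a i s x| * β := Finset.sum_le_sum fun s _ => by
          rw [abs_mul]
          exact mul_le_mul_of_nonneg_left
            (((hd s).blockAvg hβ.le (hfm s) {i}) j (Finset.mem_of_mem_erase hj) x v)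
            (abs_nonneg _)
      _ ≤ 2 * β := by rw [← Finset.sum_mul]; exact mul_le_mul_of_nonneg_right (ha1 i x) hβ.le
  have hgavg : ∀ i ∈ I, ∀ x, blockAvg Q (I.erase i) (g i) x = ∑ s, a i s x * c s := by
    intro i hi x
    rw [hg, blockAvg_sum _ fun s _ => (ham i s).mul (hFm i s)]
    refine Finset.sum_congr rfl fun s _ => ?_
    have hfree : FreeOf (I.erase i) (a i s) := fun x y => by simp [ha]
    rw [hfree.blockAvg_mul, hF, blockAvg_blockAvg (hfm s), Finset.union_comm,
      ← Finset.insert_eq, Finset.insert_erase hi]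
    simp only [hc]
  -- The reciprocal of `D` is the largest λ that the decoupling lemma permits with stability
  -- constant 2β. The resulting tail is D·u' with probability of failure 2exp(−u').
  set D : ℝ := 4 * 2 ^ l * (2 * β) * (l + 1) with hD
  have hD0 : 0 < D := by positivity
  have ev3' := integral_exp_decoupled_le (Q := Q) l (β := 2 * β) (by positivity) (g := g) I (1 / D)
    hl (by positivity) (by rw [← hD]; field_simp; exact le_rfl) (fun i _ => hgm i) hg0 hgd
  have ev3 := measure_ge_le_of_integral_exp_le
    ((BddMeas.sum I fun i _ => (hgm i).sub ((hgm i).blockAvg (I.erase i))).const_mul (1 / D))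
    ev3' u'
  rw [ENNReal.ofReal_mul (by norm_num), ENNReal.ofReal_ofNat] at ev3
  have hsum : ENNReal.ofReal (Real.exp (-u))
        + (5 + 2 * Fintype.card S) * ENNReal.ofReal (Real.exp (-u'))
      = (ENNReal.ofReal (Real.exp (-u)) + 3 * ENNReal.ofReal (Real.exp (-u')))
        + ((2 * Fintype.card S) * ENNReal.ofReal (Real.exp (-u'))
          + 2 * ENNReal.ofReal (Real.exp (-u'))) := by ring
  rw [hsum]
  refine (measure_mono ?_).trans ((measure_union_le _ _).trans (add_le_add ev1
    ((measure_union_le _ _).trans (add_le_add ev2 ev3))))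
  intro x hx
  by_contra hcon
  simp only [Set.mem_union, Set.mem_ofPred_eq, Set.mem_iUnion, not_or, not_lt, not_exists,
    not_le] at hcon hx
  obtain ⟨c1, c2, c3⟩ := hcon
  refine absurd hx (not_lt.2 ?_)
  have hmean : ∫ e, (ρ e + c (X e)) ∂Q₀ = ∫ e, ρ e ∂Q₀ + ∑ s, q s * c s := by
    rw [integral_add, integral_comp_eq_sum hX]
    · exact (BddMeas.integrable ⟨hρ, 1, fun e => by
        rw [abs_of_nonneg (hρ1 e).1]; exact (hρ1 e).2⟩ _)
    · exact (BddMeas.integrable ⟨(measurable_of_countable c).comp hX, M - 1, fun e =>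
        (abs_of_nonneg (hcM (X e)).1).trans_le (hcM (X e)).2⟩ _)
  rw [hmean] at c1
  have c3' : ∑ i ∈ I, (g i x - blockAvg Q (I.erase i) (g i) x) ≤ D * u' := by
    rw [one_div, inv_mul_lt_iff₀ hD0] at c3
    exact c3.le
  have hapick : ∀ i, ∀ φ : S → ℝ, ∑ s, a i s x * φ s = φ (X (x i)) - ∑ s, q s * φ s := by
    intro i φ
    simp [ha, sub_mul, Finset.sum_sub_distrib]
  -- Each summand is an i.i.d. term in the averaged function `c`, plus the decoupled fluctuation of
  -- `g i` (whose average over the other coordinates of `I` is the `c`-term), plus the 2β for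
  -- passing from `f` to `F`.
  have hsplit : ∀ i ∈ I, ρ (x i) + f (X (x i)) x - (∫ e, ρ e ∂Q₀ + ∑ s, q s * f s x)
      ≤ (ρ (x i) + c (X (x i)) - (∫ e, ρ e ∂Q₀ + ∑ s, q s * c s))
        + (g i x - blockAvg Q (I.erase i) (g i) x) + 2 * β := by
    intro i hi
    rw [hgavg i hi, hapick i c]
    have h1 : f (X (x i)) x - ∑ s, q s * f s x - g i x ≤ 2 * β := by
      rw [← hapick i (fun s => f s x), hg]
      simp only [← Finset.sum_sub_distrib, ← mul_sub]
      refine (le_abs_self _).trans ((Finset.abs_sum_le_sum_abs _ _).trans ?_)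
      calc ∑ s, |a i s x * (f s x - F i s x)| ≤ ∑ s, |a i s x| * β :=
            Finset.sum_le_sum fun s _ => by
              rw [abs_mul]
              exact mul_le_mul_of_nonneg_left (((hd s).mono
                (Finset.singleton_subset_iff.2 hi)).abs_sub_blockAvg_singleton (hfm s) x)
                (abs_nonneg _)
        _ ≤ 2 * β := by rw [← Finset.sum_mul]; exact mul_le_mul_of_nonneg_right (ha1 i x) hβ.le
    linarith
  have htot := Finset.sum_le_sum hsplit
  rw [Finset.sum_add_distrib, Finset.sum_add_distrib, Finset.sum_const, nsmul_eq_mul] at htot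
  -- The Bernstein bound for `c` involves the deviation of the targets built from `c`, but the
  -- penalty uses the random `f`. Uniform closeness of `f` and `c` on the second good event bridges
  -- the two.
  have hdev : devNorm I (fun i => ρ (x i) + c (X (x i)))
      ≤ devNorm I (fun i => ρ (x i) + f (X (x i)) x)
        + √I.card * (β * √(12 * I.card * u')) := by
    refine devNorm_le_add (by positivity) fun i _ => ?_
    rw [add_sub_add_left_eq_sub, abs_sub_comm]
    exact c2 _
  have hdev' := mul_le_mul_of_nonneg_left hdev (Real.sqrt_nonneg (2 * u))
  have hDe : D * u' = 8 * 2 ^ l * β * (l + 1) * u' := by rw [hD]; ring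
  rw [hDe] at c3'
  linarith

end StableBernstein

/-! ### Conditioning on the set of coordinates that fall into a given set -/

section Conditioning

variable {ι E : Type*} [Fintype ι] [DecidableEq ι] [MeasurableSpace E]

open Classical in
/-- The coordinates of `x` that lie in `v`. -/
noncomputable def coordsIn (v : Set E) (x : ι → E) : Finset ι := {i | x i ∈ v}

theorem mem_coordsIn {v : Set E} {x : ι → E} {i : ι} : i ∈ coordsIn v x ↔ x i ∈ v := by
  simp [coordsIn]

variable {ν : Measure E} [IsProbabilityMeasure ν]

theorem coordsIn_eq_iff {v : Set E} {I : Finset ι} {x : ι → E} :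
    coordsIn v x = I ↔ x ∈ Set.univ.pi fun i => if i ∈ I then v else vᶜ := by
  simp only [Finset.ext_iff, mem_coordsIn, Set.mem_pi, Set.mem_univ, true_imp_iff]
  refine forall_congr' fun i => ?_
  by_cases h : i ∈ I <;> simp [h]

theorem measurableSet_coordsIn_eq {v : Set E} (hv : MeasurableSet v) (I : Finset ι) :
    MeasurableSet {x : ι → E | coordsIn v x = I} := by
  have : {x : ι → E | coordsIn v x = I} = Set.univ.pi fun i => if i ∈ I then v else vᶜ := by
    ext x; exact coordsIn_eq_iff
  rw [this]
  refine MeasurableSet.univ_pi fun i => ?_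
  split_ifs
  exacts [hv, hv.compl]

/-- The event that exactly the coordinates in `I` lie in `v` is a box, so conditioning on it
preserves the product structure, and the coordinates in `I` become i.i.d. with the conditional law.
It is then enough to bound the probability with the other coordinates frozen. -/
theorem measure_inter_coordsIn_le {v : Set E} (hv : MeasurableSet v) {I : Finset ι}
    {A : Set (ι → E)} (hA : MeasurableSet A) {η : ENNReal}
    (h : ∀ Q : ι → Measure E, (∀ i, IsProbabilityMeasure (Q i)) →
      (∀ i ∈ I, Q i = ProbabilityTheory.cond ν v) → ∀ x,
      Measure.pi Q {y | I.piecewise y x ∈ A} ≤ η) :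
    Measure.pi (fun _ => ν) (A ∩ {x | coordsIn v x = I})
      ≤ η * Measure.pi (fun _ => ν) {x : ι → E | coordsIn v x = I} := by
  set s : ι → Set E := fun i => if i ∈ I then v else vᶜ with hs
  have hsm : ∀ i, MeasurableSet (s i) := fun i => by
    simp only [hs]; split_ifs
    exacts [hv, hv.compl]
  have hbox : {x : ι → E | coordsIn v x = I} = Set.univ.pi s := by
    ext x; exact coordsIn_eq_iff
  rw [hbox]
  by_cases hz : ∀ i, ν (s i) ≠ 0
  · set Q : ι → Measure E := fun i => ProbabilityTheory.cond ν (s i) with hQ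
    have hQp : ∀ i, IsProbabilityMeasure (Q i) := fun i =>
      ProbabilityTheory.cond_isProbabilityMeasure (hz i)
    have e1 : Measure.pi (fun i => ν.restrict (s i))
        = (∏ i, ν (s i)) • Measure.pi Q := by
      refine Measure.pi_eq fun t _ => ?_
      rw [Measure.smul_apply, Measure.pi_pi, smul_eq_mul, ← Finset.prod_mul_distrib]
      refine Finset.prod_congr rfl fun i _ => ?_
      simp only [hQ, ProbabilityTheory.cond, Measure.smul_apply, smul_eq_mul]
      rw [← mul_assoc, ENNReal.mul_inv_cancel (hz i) (measure_ne_top _ _), one_mul]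
    have e2 : Measure.pi (fun _ => ν) (A ∩ Set.univ.pi s)
        = Measure.pi (fun _ => ν) (Set.univ.pi s) * Measure.pi Q A := by
      rw [← Measure.restrict_apply hA, Measure.restrict_pi_pi, e1, Measure.smul_apply,
        Measure.pi_pi, smul_eq_mul]
    -- Resampling the coordinates in `I` leaves the product measure invariant, so by Fubini the
    -- bound may be checked for each fixed value of the remaining coordinates.
    have e3 : Measure.pi Q A ≤ η := by
      have hp := measurePreserving_piecewise_coord Q I
      rw [← hp.map_eq, Measure.map_apply hp.measurable hA,
        Measure.prod_apply (hp.measurable hA)]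
      calc ∫⁻ x, Measure.pi Q (Prod.mk x ⁻¹' ((fun p : (ι → E) × (ι → E) =>
              I.piecewise p.2 p.1) ⁻¹' A)) ∂(Measure.pi Q)
          ≤ ∫⁻ _x, η ∂(Measure.pi Q) := lintegral_mono fun x =>
            h Q hQp (fun i hi => by simp only [hQ, hs, hi, if_true]) x
        _ = η := by simp
    rw [e2, mul_comm]
    gcongr
  · push Not at hz
    obtain ⟨i, hi⟩ := hz
    have : Measure.pi (fun _ => ν) (Set.univ.pi s) = 0 := by
      rw [Measure.pi_pi]
      exact Finset.prod_eq_zero (Finset.mem_univ i) hi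
    rw [measure_mono_null Set.inter_subset_right this]
    exact zero_le

/-- The boxes for different `I` partition the space, so the conditional bounds average to the same
bound, without a union bound over `I`. -/
theorem measure_coordsIn_le {v : Set E} (hv : MeasurableSet v) {A : Finset ι → Set (ι → E)}
    (hA : ∀ I, MeasurableSet (A I)) {p : Finset ι → Prop} {η : ENNReal}
    (h : ∀ I, p I → ∀ Q : ι → Measure E, (∀ i, IsProbabilityMeasure (Q i)) →
      (∀ i ∈ I, Q i = ProbabilityTheory.cond ν v) → ∀ x,
      Measure.pi Q {y | I.piecewise y x ∈ A I} ≤ η) :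
    Measure.pi (fun _ => ν) {x | p (coordsIn v x) ∧ x ∈ A (coordsIn v x)} ≤ η := by
  have hsub : {x | p (coordsIn v x) ∧ x ∈ A (coordsIn v x)}
      ⊆ ⋃ I : Finset ι, {x | p I ∧ x ∈ A I ∩ {x | coordsIn v x = I}} := fun x hx => by
    simp only [Set.mem_iUnion]
    exact ⟨coordsIn v x, hx.1, hx.2, rfl⟩
  refine (measure_mono hsub).trans ((measure_iUnion_fintype_le _ _).trans ?_)
  calc ∑ I : Finset ι, Measure.pi (fun _ => ν) {x | p I ∧ x ∈ A I ∩ {x | coordsIn v x = I}}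
      ≤ ∑ I : Finset ι, η * Measure.pi (fun _ => ν) {x : ι → E | coordsIn v x = I} := by
        refine Finset.sum_le_sum fun I _ => ?_
        by_cases hp : p I
        · refine (measure_mono fun x hx => hx.2).trans
            (measure_inter_coordsIn_le hv (hA I) (h I hp))
        · have : {x | p I ∧ x ∈ A I ∩ {x | coordsIn v x = I}} = ∅ := by
            ext x; simp [hp]
          rw [this, measure_empty]; exact zero_le
    _ = η * ∑ I : Finset ι, Measure.pi (fun _ => ν) {x : ι → E | coordsIn v x = I} := by
        rw [Finset.mul_sum]
    _ = η := by
        have hd : Pairwise (Function.onFun Disjoint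
            fun I : Finset ι => {x : ι → E | coordsIn v x = I}) := fun I J hIJ => by
          refine Set.disjoint_left.2 fun x hx hy => hIJ ?_
          exact hx.symm.trans hy
        have := measure_iUnion (μ := Measure.pi (fun _ : ι => ν)) hd
          (fun I => measurableSet_coordsIn_eq hv I)
        rw [tsum_fintype] at this
        rw [← this]
        have hu : (⋃ I : Finset ι, {x : ι → E | coordsIn v x = I}) = Set.univ := by
          ext x; simp
        rw [hu, measure_univ, mul_one]

variable {S : Type*} [Fintype S] [MeasurableSpace S] [DiscreteMeasurableSpace S]

theorem measurable_devNorm {Ω : Type*} [MeasurableSpace Ω] (I : Finset ι) {y : Ω → ι → ℝ}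
    (hy : ∀ i, Measurable fun x => y x i) : Measurable fun x => devNorm I (y x) := by
  unfold devNorm finMean
  fun_prop

theorem measure_cond_abs_sum_gt_le {v : Set E} (hv : MeasurableSet v) (hν : ν v ≠ 0)
    {y : E → ℝ} (hy : Measurable y) {M : ℝ} (hM : 0 < M) (hb : ∀ e, y e ∈ Set.Icc 0 M) {u : ℝ}
    (hu : 0 ≤ u) :
    Measure.pi (fun _ => ν) {x : ι → E | (coordsIn v x).Nonempty ∧
        √(2 * u) * (devNorm (coordsIn v x) (fun i => y (x i)) + 10 * M * √u) + 3 * M * u <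
        |∑ i ∈ coordsIn v x, (y (x i) - ∫ e, y e ∂(ProbabilityTheory.cond ν v))|}
      ≤ 8 * ENNReal.ofReal (Real.exp (-u)) := by
  have := ProbabilityTheory.cond_isProbabilityMeasure hν
  refine measure_coordsIn_le hv (p := fun I => I.Nonempty) (A := fun I => {x : ι → E |
    √(2 * u) * (devNorm I (fun i => y (x i)) + 10 * M * √u) + 3 * M * u <
        |∑ i ∈ I, (y (x i) - ∫ e, y e ∂(ProbabilityTheory.cond ν v))|}) (fun I => ?_)
    fun I hI Q hQp hQ x => ?_
  · have := measurable_devNorm I (y := fun (x : ι → E) i => y (x i)) fun i => by fun_prop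
    refine measurableSet_lt (by fun_prop) (Measurable.abs ?_)
    fun_prop
  · refine le_trans (le_of_eq ?_) (measure_abs_sum_gt_empirical_bernstein hI hQ hy hM hb hu)
    congr 1
    ext z
    have h1 : ∀ i ∈ I, I.piecewise z x i = z i := fun i hi => by simp [hi]
    have h2 : ∑ i ∈ I, (y (I.piecewise z x i) - ∫ e, y e ∂(ProbabilityTheory.cond ν v))
        = ∑ i ∈ I, (y (z i) - ∫ e, y e ∂(ProbabilityTheory.cond ν v)) :=
      Finset.sum_congr rfl fun i hi => by rw [h1 i hi]
    have h3 : devNorm I (fun i => y (I.piecewise z x i)) = devNorm I (fun i => y (z i)) := by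
      have h4 : ∑ i ∈ I, y (I.piecewise z x i) = ∑ i ∈ I, y (z i) :=
        Finset.sum_congr rfl fun i hi => by rw [h1 i hi]
      simp only [devNorm, finMean, h4]
      congr 1
      exact Finset.sum_congr rfl fun i hi => by rw [h1 i hi]
    simp only [Set.mem_ofPred_eq, h2, h3]

theorem measure_cond_sum_gt_multiplicative {v : Set E} (hv : MeasurableSet v) (hν : ν v ≠ 0)
    {w : E → ℝ} (hw : Measurable w) {b K : ℝ} (hb0 : 0 < b) (hK : 1 ≤ K)
    (hb : ∀ e, w e ∈ Set.Icc 0 b) (u : ℝ) :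
    Measure.pi (fun _ => ν) {x : ι → E | (coordsIn v x).card *
        ((1 + 1 / K) * ∫ e, w e ∂(ProbabilityTheory.cond ν v)) + K * b * u
          < ∑ i ∈ coordsIn v x, w (x i)}
      ≤ ENNReal.ofReal (Real.exp (-u)) := by
  have := ProbabilityTheory.cond_isProbabilityMeasure hν
  have key := measure_coordsIn_le (ν := ν) hv (p := fun _ => True) (A := fun I => {x : ι → E |
    I.card * ((1 + 1 / K) * ∫ e, w e ∂(ProbabilityTheory.cond ν v)) + K * b * u
          < ∑ i ∈ I, w (x i)}) (η := ENNReal.ofReal (Real.exp (-u))) (fun I => ?_)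
    fun I hI Q hQp hQ x => ?_
  · simpa using key
  · exact measurableSet_lt measurable_const (by fun_prop)
  · refine le_trans (le_of_eq ?_) (measure_sum_gt_multiplicative hQ hw hb0 hK hb u)
    congr 1
    ext z
    have h2 : ∑ i ∈ I, w (I.piecewise z x i) = ∑ i ∈ I, w (z i) :=
      Finset.sum_congr rfl fun i hi => by simp [hi]
    simp only [Set.mem_ofPred_eq, h2]

theorem BddDiff.section {I : Finset ι} {β : ℝ} {f : (ι → E) → ℝ} (h : BddDiff Finset.univ β f)
    (x : ι → E) : BddDiff I β fun y => f (I.piecewise y x) := by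
  intro i hi y z
  have : I.piecewise (Function.update y i z) x = Function.update (I.piecewise y x) i z := by
    funext j
    by_cases hj : j = i
    · subst hj; simp [hi]
    · by_cases hjI : j ∈ I <;> simp [hj, hjI]
  simp only [this]
  exact h i (Finset.mem_univ _) _ _

theorem measure_cond_sum_gt_stable_bernstein {v : Set E} (hv : MeasurableSet v) (hν : ν v ≠ 0)
    {X : E → S} (hX : Measurable X) {ρ : E → ℝ} (hρ : Measurable ρ)
    (hρ1 : ∀ e, ρ e ∈ Set.Icc (0 : ℝ) 1) {f : S → (ι → E) → ℝ} {M β : ℝ} (hβ : 0 < β)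
    (hf : ∀ s, Measurable (f s)) (hM : 1 ≤ M) (hfM : ∀ s x, f s x ∈ Set.Icc 0 (M - 1))
    (hd : ∀ s, BddDiff Finset.univ β (f s)) (L : ℕ → ℕ)
    (hL : ∀ m, m ≤ 2 ^ L m) {u u' : ℝ} (hu : 0 ≤ u) (hu' : 0 ≤ u') :
    Measure.pi (fun _ => ν) {x : ι → E | (coordsIn v x).Nonempty ∧
        √(2 * u) * (devNorm (coordsIn v x) (fun i => ρ (x i) + f (X (x i)) x)
          + √(coordsIn v x).card * (β * √(12 * (coordsIn v x).card * u')) + 10 * M * √u')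
          + 3 * M * u + 2 * (coordsIn v x).card * β
          + 8 * 2 ^ L (coordsIn v x).card * β * (L (coordsIn v x).card + 1) * u' <
        ∑ i ∈ coordsIn v x, (ρ (x i) + f (X (x i)) x
          - (∫ e, ρ e ∂(ProbabilityTheory.cond ν v)
            + ∑ s, (ProbabilityTheory.cond ν v).real (X ⁻¹' {s}) * f s x))}
      ≤ ENNReal.ofReal (Real.exp (-u))
        + (5 + 2 * Fintype.card S) * ENNReal.ofReal (Real.exp (-u')) := by
  have := ProbabilityTheory.cond_isProbabilityMeasure hν
  have hfX : ∀ i : ι, Measurable fun x : ι → E => f (X (x i)) x := fun i => by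
    classical
    have : (fun x : ι → E => f (X (x i)) x)
        = fun x => ∑ s, if X (x i) = s then f s x else 0 := by
      funext x; simp
    rw [this]
    refine Finset.measurable_sum _ fun s _ => Measurable.ite ?_ (hf s) measurable_const
    exact (measurableSet_singleton s).preimage (hX.comp (measurable_pi_apply i))
  refine measure_coordsIn_le hv (p := fun I => I.Nonempty) (A := fun I => {x : ι → E |
        √(2 * u) * (devNorm I (fun i => ρ (x i) + f (X (x i)) x)
          + √I.card * (β * √(12 * I.card * u')) + 10 * M * √u')
          + 3 * M * u + 2 * I.card * β
          + 8 * 2 ^ L I.card * β * (L I.card + 1) * u' <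
        ∑ i ∈ I, (ρ (x i) + f (X (x i)) x
          - (∫ e, ρ e ∂(ProbabilityTheory.cond ν v)
            + ∑ s, (ProbabilityTheory.cond ν v).real (X ⁻¹' {s}) * f s x))}) (fun I => ?_)
    fun I hI Q hQp hQ x => ?_
  · have := measurable_devNorm I (y := fun (x : ι → E) i => ρ (x i) + f (X (x i)) x)
      fun i => (hρ.comp (measurable_pi_apply i)).add (hfX i)
    refine measurableSet_lt (by fun_prop) (Finset.measurable_sum _ fun i _ => ?_)
    exact ((hρ.comp (measurable_pi_apply i)).add (hfX i)).sub (by fun_prop)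
  -- With the coordinates outside `I` frozen, the function depends on `I` only, so its average over
  -- `I` is a constant, as `measure_sum_gt_stable_bernstein` requires.
  · have hc : ∀ s z, blockAvg Q I (fun y => f s (I.piecewise y x)) z
        = ∫ y, f s (I.piecewise y x) ∂(Measure.pi Q) := fun s z => by
      simp only [blockAvg]
      congr 1
      funext y
      congr 1
      funext i
      by_cases hi : i ∈ I <;> simp [hi]
    have hm : ∀ s, Measurable fun y => f s (I.piecewise y x) := fun s =>
      (hf s).comp ((measurable_piecewise_coord I).comp (measurable_const.prodMk measurable_id))
    have key := measure_sum_gt_stable_bernstein hI hQ hX hρ hρ1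
      (f := fun s y => f s (I.piecewise y x)) hβ hm hM (fun s y => hfM s _)
      (fun s => (hd s).section x) hc (hL I.card) hu hu'
    refine le_trans (le_of_eq ?_) key
    congr 1
    ext z
    have h1 : ∀ i ∈ I, I.piecewise z x i = z i := fun i hi => by simp [hi]
    have h3 : devNorm I (fun i => ρ (I.piecewise z x i)
          + f (X (I.piecewise z x i)) (I.piecewise z x))
        = devNorm I (fun i => ρ (z i) + f (X (z i)) (I.piecewise z x)) := by
      have h4 : ∑ i ∈ I, (ρ (I.piecewise z x i) + f (X (I.piecewise z x i)) (I.piecewise z x))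
          = ∑ i ∈ I, (ρ (z i) + f (X (z i)) (I.piecewise z x)) :=
        Finset.sum_congr rfl fun i hi => by rw [h1 i hi]
      simp only [devNorm, finMean, h4]
      congr 1
      exact Finset.sum_congr rfl fun i hi => by rw [h1 i hi]
    have h5 : ∀ c : ℝ, ∑ i ∈ I, (ρ (I.piecewise z x i)
          + f (X (I.piecewise z x i)) (I.piecewise z x) - c)
        = ∑ i ∈ I, (ρ (z i) + f (X (z i)) (I.piecewise z x) - c) := fun c =>
      Finset.sum_congr rfl fun i hi => by rw [h1 i hi]
    simp only [Set.mem_ofPred_eq, h3, h5]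

end Conditioning

/-! ### State distributions and the Markov property -/

section Flow

variable {S A : Type*} [Fintype S] [Fintype A]

/-- The state distributions of the chain with initial weights `f`, action weights `p` and
transition weights `P`. -/
noncomputable def stateDist {H : ℕ} (f : S → ℝ) (p : Fin H → S → A → ℝ)
    (P : Fin H → S → A → S → ℝ) : Fin (H + 1) → S → ℝ :=
  Fin.induction f fun h g y => ∑ x, ∑ b, g x * (p h x b * P h x b y)

variable {H : ℕ} {f : S → ℝ} {p : Fin H → S → A → ℝ} {P : Fin H → S → A → S → ℝ}

theorem stateDist_zero : stateDist f p P 0 = f := rfl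

theorem stateDist_succ (h : Fin H) : stateDist f p P h.succ
    = fun y => ∑ x, ∑ b, stateDist f p P h.castSucc x * (p h x b * P h x b y) := by
  simp only [stateDist, Fin.induction_succ]

theorem stateDist_nonneg (hf : ∀ s, 0 ≤ f s) (hp : ∀ h s a, 0 ≤ p h s a)
    (hP : ∀ h s a s', 0 ≤ P h s a s') (h : Fin (H + 1)) (s : S) : 0 ≤ stateDist f p P h s := by
  induction h using Fin.induction generalizing s with
  | zero => exact hf s
  | succ h ih =>
    rw [stateDist_succ]
    exact Finset.sum_nonneg fun x _ => Finset.sum_nonneg fun b _ =>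
      mul_nonneg (ih x) (mul_nonneg (hp _ _ _) (hP _ _ _ _))

theorem sum_stateDist (hp : ∀ h s, ∑ a, p h s a = 1) (hP : ∀ h s a, ∑ s', P h s a s' = 1)
    (h : Fin (H + 1)) : ∑ s, stateDist f p P h s = ∑ s, f s := by
  induction h using Fin.induction with
  | zero => rfl
  | succ h ih =>
    rw [stateDist_succ, Finset.sum_comm, ← ih]
    refine Finset.sum_congr rfl fun x _ => ?_
    rw [Finset.sum_comm]
    simp only [← Finset.mul_sum, hP, mul_one, hp]

/-- Telescoping along the chain. -/
theorem sum_init_eq (hp : ∀ h s, ∑ a, p h s a = 1) (U : Fin (H + 1) → S → ℝ)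
    (hU : ∀ s, U (Fin.last H) s = 0) :
    ∑ s, f s * U 0 s = ∑ h : Fin H, ∑ s, ∑ a, stateDist f p P h.castSucc s * p h s a *
      (U h.castSucc s - ∑ s', P h s a s' * U h.succ s') := by
  have step : ∀ h : Fin H, ∑ s, ∑ a, stateDist f p P h.castSucc s * p h s a *
      (U h.castSucc s - ∑ s', P h s a s' * U h.succ s')
      = ∑ s, stateDist f p P h.castSucc s * U h.castSucc s
        - ∑ s, stateDist f p P h.succ s * U h.succ s := by
    intro h
    have e1 : ∑ s, stateDist f p P h.succ s * U h.succ s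
        = ∑ s, ∑ a, stateDist f p P h.castSucc s * p h s a * ∑ s', P h s a s' * U h.succ s' := by
      rw [stateDist_succ]
      simp only [Finset.sum_mul, Finset.mul_sum]
      rw [Finset.sum_comm]
      refine Finset.sum_congr rfl fun x _ => ?_
      rw [Finset.sum_comm]
      refine Finset.sum_congr rfl fun b _ => Finset.sum_congr rfl fun y _ => ?_
      ring
    have e2 : ∑ s, stateDist f p P h.castSucc s * U h.castSucc s
        = ∑ s, ∑ a, stateDist f p P h.castSucc s * p h s a * U h.castSucc s := by
      refine Finset.sum_congr rfl fun s _ => ?_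
      rw [← Finset.sum_mul, ← Finset.mul_sum, hp, mul_one]
    rw [e1, e2]
    simp only [mul_sub, Finset.sum_sub_distrib]
  have tele : ∀ g : Fin (H + 1) → ℝ, ∑ h : Fin H, (g h.castSucc - g h.succ)
      = g 0 - g (Fin.last H) := fun g => by
    rw [Finset.sum_sub_distrib]
    have h1 := Fin.sum_univ_succ g
    have h2 := Fin.sum_univ_castSucc g
    linarith
  simp only [step]
  rw [tele fun h => ∑ s, stateDist f p P h s * U h s]
  simp [hU, stateDist_zero]

theorem stateDist_succ_eq_tail {H : ℕ} {f : S → ℝ} {p : Fin (H + 1) → S → A → ℝ}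
    {P : Fin (H + 1) → S → A → S → ℝ} (k : Fin (H + 1)) :
    stateDist f p P k.succ = stateDist (fun y => ∑ x, ∑ b, f x * (p 0 x b * P 0 x b y))
      (fun h => p h.succ) (fun h => P h.succ) k := by
  induction k using Fin.induction with
  | zero => rw [stateDist_succ]; rfl
  | succ k ih =>
    rw [stateDist_succ, stateDist_succ, ← ih]
    rfl

theorem sum_paths_succ {H : ℕ} (F : (Fin (H + 2) → S) → (Fin (H + 1) → A) → ℝ) :
    ∑ s, ∑ a, F s a = ∑ s : Fin (H + 1) → S, ∑ a : Fin H → A, ∑ x, ∑ b,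
      F (Fin.cons x s) (Fin.cons b a) := by
  rw [← (Fin.consEquiv fun _ : Fin (H + 2) => S).sum_comp, Fintype.sum_prod_type, Finset.sum_comm]
  refine Finset.sum_congr rfl fun s _ => ?_
  simp only [← (Fin.consEquiv fun _ : Fin (H + 1) => A).sum_comp, Fintype.sum_prod_type]
  symm
  rw [Finset.sum_comm]
  refine Finset.sum_congr rfl fun x _ => ?_
  rw [Finset.sum_comm]
  rfl

/-- The joint law of a state, its action and the next state. The first step of the path is peeled
off: for k = 0 the test function is absorbed into the initial weights of the tail chain, whose total
mass is `sum_path_aux`; for later k the tail chain starts from the distribution after one step.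
Nonnegativity is not required, which permits this absorption. -/
theorem sum_path_step (hp : ∀ h s, ∑ a, p h s a = 1) (hP : ∀ h s a, ∑ s', P h s a s' = 1)
    (k : Fin H) (ψ : S → A → S → ℝ) :
    ∑ s : Fin (H + 1) → S, ∑ a : Fin H → A,
      f (s 0) * (∏ h : Fin H, p h (s h.castSucc) (a h) * P h (s h.castSucc) (a h) (s h.succ))
        * ψ (s k.castSucc) (a k) (s k.succ)
      = ∑ x, ∑ b, ∑ y, stateDist f p P k.castSucc x * (p k x b * P k x b y) * ψ x b y := by
  induction H generalizing f with
  | zero => exact k.elim0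
  | succ H ih =>
    rw [sum_paths_succ]
    refine Fin.cases ?_ (fun j => ?_) k
    · have key := sum_path_aux H (fun y => ∑ x, ∑ b, f x * (p 0 x b * P 0 x b y) * ψ x b y)
        (fun h => p h.succ) (fun h => P h.succ) (fun h s => hp _ s) (fun h s a => hP _ s a)
      have e : ∑ x, ∑ b, ∑ y, stateDist f p P (Fin.castSucc 0) x * (p 0 x b * P 0 x b y) * ψ x b y
          = ∑ y, ∑ x, ∑ b, f x * (p 0 x b * P 0 x b y) * ψ x b y := by
        rw [Fin.castSucc_zero, stateDist_zero]
        symm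
        rw [Finset.sum_comm]
        refine Finset.sum_congr rfl fun x _ => ?_
        rw [Finset.sum_comm]
      rw [e, ← key]
      refine Finset.sum_congr rfl fun s _ => Finset.sum_congr rfl fun a _ => ?_
      simp only [Finset.sum_mul]
      refine Finset.sum_congr rfl fun x _ => Finset.sum_congr rfl fun b _ => ?_
      rw [Fin.prod_univ_succ]
      simp
      ring
    · have key := ih (f := fun y => ∑ x, ∑ b, f x * (p 0 x b * P 0 x b y))
        (p := fun h => p h.succ) (P := fun h => P h.succ) (fun h s => hp _ s)
        (fun h s a => hP _ s a) j
      rw [← stateDist_succ_eq_tail] at key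
      rw [← Fin.succ_castSucc, ← key]
      refine Finset.sum_congr rfl fun s _ => Finset.sum_congr rfl fun a _ => ?_
      simp only [Finset.sum_mul]
      refine Finset.sum_congr rfl fun x _ => Finset.sum_congr rfl fun b _ => ?_
      rw [Fin.prod_univ_succ]
      simp [mul_assoc]

end Flow

section Markov

variable {S A : Type*} [Fintype S] [Fintype A] {H : ℕ}

/-- The occupancy measure, computed recursively. -/
noncomputable def occ (M : MDP S A H) (π : Policy S A H) (h : Fin H) (s : S) (a : A) : ℝ :=
  stateDist M.init π.prob M.P h.castSucc s * π.prob h s a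

theorem occ_nonneg (M : MDP S A H) (π : Policy S A H) (h : Fin H) (s : S) (a : A) :
    0 ≤ occ M π h s a :=
  mul_nonneg (stateDist_nonneg M.init_nonneg π.prob_nonneg M.P_nonneg _ _) (π.prob_nonneg _ _ _)

theorem sum_occ (M : MDP S A H) (π : Policy S A H) (h : Fin H) :
    ∑ s, ∑ a, occ M π h s a = 1 := by
  simp only [occ, ← Finset.mul_sum, π.prob_sum, mul_one]
  rw [sum_stateDist π.prob_sum M.P_sum, M.init_sum]

/-- Truncation to the unit interval. -/
noncomputable def clip01 (r : ℝ) : ℝ := max 0 (min r 1)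

theorem clip01_mem (r : ℝ) : clip01 r ∈ Set.Icc (0 : ℝ) 1 :=
  ⟨le_max_left _ _, max_le zero_le_one (min_le_right _ _)⟩

theorem clip01_of_mem {r : ℝ} (h : r ∈ Set.Icc (0 : ℝ) 1) : clip01 r = r := by
  rw [clip01, min_eq_left h.2, max_eq_right h.1]

theorem measurable_clip01 : Measurable clip01 :=
  measurable_const.max (measurable_id.min measurable_const)

/-- The mean reward. -/
noncomputable def meanReward (M : MDP S A H) (h : Fin H) (s : S) (a : A) : ℝ :=
  ∫ r, clip01 r ∂(M.R h s a)

theorem meanReward_mem (M : MDP S A H) (h : Fin H) (s : S) (a : A) :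
    meanReward M h s a ∈ Set.Icc (0 : ℝ) 1 := by
  have := M.R_prob h s a
  refine ⟨integral_nonneg fun r => (clip01_mem r).1, ?_⟩
  have hm : BddMeas clip01 := ⟨measurable_clip01, 1, fun r => by
    rw [abs_of_nonneg (clip01_mem r).1]; exact (clip01_mem r).2⟩
  have h1 := integral_mono (hm.integrable (M.R h s a)) (integrable_const 1)
    fun r => (clip01_mem r).2
  simp only [integral_const, probReal_univ, smul_eq_mul, mul_one] at h1
  exact h1

/-- The episodes that visit `(s, a)` at step `h`. -/
def visitSet {S A : Type*} {H : ℕ} (h : Fin H) (s : S) (a : A) : Set (Episode S A H) :=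
  {e | e.state h = s ∧ e.action h = a}

variable [MeasurableSpace S] [DiscreteMeasurableSpace S] [MeasurableSpace A]
  [DiscreteMeasurableSpace A]

theorem measurable_state (h : Fin H) : Measurable fun e : Episode S A H => e.state h := by
  unfold Episode.state; fun_prop

theorem measurable_action (h : Fin H) : Measurable fun e : Episode S A H => e.action h := by
  unfold Episode.action; fun_prop

theorem measurable_reward (h : Fin H) : Measurable fun e : Episode S A H => e.reward h := by
  unfold Episode.reward; fun_prop

theorem measurable_next (h : Fin H) : Measurable fun e : Episode S A H => e.next h := by
  unfold Episode.next; fun_prop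

theorem measurableSet_visitSet (h : Fin H) (s : S) (a : A) :
    MeasurableSet (visitSet (S := S) (A := A) h s a) :=
  ((measurableSet_singleton s).preimage (measurable_state h)).inter
    ((measurableSet_singleton a).preimage (measurable_action h))

theorem integral_episodeLaw (M : MDP S A H) (π : Policy S A H) {G : Episode S A H → ℝ}
    (hG : BddMeas G) : ∫ e, G e ∂(episodeLaw M π) = ∑ s, ∑ a, pathProb M π s a *
      ∫ r, G (s, a, r) ∂(Measure.pi fun h : Fin H => M.R h (s h.castSucc) (a h)) := by
  have hR : ∀ h s a, IsProbabilityMeasure (M.R h s a) := M.R_prob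
  have hmap : ∀ (s : Fin (H + 1) → S) (a : Fin H → A),
      Measurable fun r : Fin H → ℝ => ((s, a, r) : Episode S A H) := fun s a => by fun_prop
  have hint : ∀ (s : Fin (H + 1) → S) (a : Fin H → A), Integrable G
      (ENNReal.ofReal (pathProb M π s a) •
      (Measure.pi fun h : Fin H => M.R h (s h.castSucc) (a h)).map fun r => (s, a, r)) := fun s a =>
    (hG.integrable _).smul_measure ENNReal.ofReal_ne_top
  rw [episodeLaw, integral_finsetSum_measure
    (fun s _ => integrable_finsetSum_measure.2 fun a _ => hint s a)]
  refine Finset.sum_congr rfl fun s _ => ?_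
  rw [integral_finsetSum_measure (fun a _ => hint s a)]
  refine Finset.sum_congr rfl fun a _ => ?_
  rw [integral_smul_measure, ENNReal.toReal_ofReal (pathProb_nonneg M π s a),
    integral_map (hmap s a).aemeasurable hG.meas.aestronglyMeasurable, smul_eq_mul]

open Classical in
/-- The reward and the next state at a visited pair follow the model. -/
theorem integral_step (M : MDP S A H) (π : Policy S A H) (h : Fin H) (ψ : S → A → ℝ → S → ℝ)
    (hψ : ∀ s a s', BddMeas fun r => ψ s a r s') :
    ∫ e, ψ (e.state h) (e.action h) (e.reward h) (e.next h) ∂(episodeLaw M π)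
      = ∑ s, ∑ a, occ M π h s a * ∑ s', M.P h s a s' * ∫ r, ψ s a r s' ∂(M.R h s a) := by
  have hR : ∀ h s a, IsProbabilityMeasure (M.R h s a) := M.R_prob
  have hG : BddMeas fun e : Episode S A H =>
      ψ (e.state h) (e.action h) (e.reward h) (e.next h) := by
    have : (fun e : Episode S A H => ψ (e.state h) (e.action h) (e.reward h) (e.next h))
        = fun e => ∑ s, ∑ a, ∑ s', (if e.state h = s ∧ e.action h = a ∧ e.next h = s' then 1 else 0)
          * ψ s a (e.reward h) s' := by
      funext e
      rw [Finset.sum_eq_single (e.state h), Finset.sum_eq_single (e.action h),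
        Finset.sum_eq_single (e.next h)]
      · simp
      · intro b _ hb; simp [hb.symm]
      · simp
      · intro b _ hb; simp [hb.symm]
      · simp
      · intro b _ hb; simp [hb.symm]
      · simp
    rw [this]
    refine BddMeas.sum _ fun s _ => BddMeas.sum _ fun a _ => BddMeas.sum _ fun s' _ =>
      BddMeas.mul ⟨Measurable.ite ?_ measurable_const measurable_const, 1, fun e => ?_⟩
        ((hψ s a s').comp (measurable_reward h))
    · exact ((measurableSet_singleton s).preimage (measurable_state h)).inter
        (((measurableSet_singleton a).preimage (measurable_action h)).inter
          ((measurableSet_singleton s').preimage (measurable_next h)))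
    · split_ifs <;> simp
  rw [integral_episodeLaw M π hG]
  have e1 : ∀ (s : Fin (H + 1) → S) (a : Fin H → A),
      ∫ r, ψ (s h.castSucc) (a h) (r h) (s h.succ)
        ∂(Measure.pi fun h : Fin H => M.R h (s h.castSucc) (a h))
      = ∫ r, ψ (s h.castSucc) (a h) r (s h.succ) ∂(M.R h (s h.castSucc) (a h)) := fun s a => by
    have h2 := measurePreserving_eval (μ := fun h : Fin H => M.R h (s h.castSucc) (a h)) h
    rw [← h2.map_eq, integral_map h2.measurable.aemeasurable
      (hψ _ _ _).meas.aestronglyMeasurable]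
  have e2 := sum_path_step (f := M.init) π.prob_sum M.P_sum h
    (fun x b y => ∫ r, ψ x b r y ∂(M.R h x b))
  calc _ = _ := Finset.sum_congr rfl fun s _ => Finset.sum_congr rfl fun a _ => by
              exact congrArg (pathProb M π s a * ·) (e1 s a)
    _ = _ := e2
    _ = _ := Finset.sum_congr rfl fun x _ => Finset.sum_congr rfl fun b _ => by
      rw [Finset.mul_sum]
      refine Finset.sum_congr rfl fun y _ => ?_
      rw [occ]; ring

theorem ae_reward_mem (M : MDP S A H) (π : Policy S A H) :
    ∀ᵐ e ∂(episodeLaw M π), ∀ h, e.reward h ∈ Set.Icc (0 : ℝ) 1 := by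
  have hR : ∀ h s a, IsProbabilityMeasure (M.R h s a) := M.R_prob
  have hmap : ∀ (s : Fin (H + 1) → S) (a : Fin H → A),
      Measurable fun r : Fin H → ℝ => ((s, a, r) : Episode S A H) := fun s a => by fun_prop
  refine ae_all_iff.2 fun h => ?_
  have hm : MeasurableSet {e : Episode S A H | e.reward h ∈ Set.Icc (0 : ℝ) 1} :=
    measurableSet_Icc.preimage (measurable_reward h)
  rw [ae_iff, episodeLaw, Measure.coe_finsetSum, Finset.sum_apply]
  refine Finset.sum_eq_zero fun s _ => ?_
  rw [Measure.coe_finsetSum, Finset.sum_apply]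
  refine Finset.sum_eq_zero fun a _ => ?_
  rw [Measure.smul_apply, smul_eq_mul]
  change _ * Measure.map _ _ {e : Episode S A H | e.reward h ∈ Set.Icc (0 : ℝ) 1}ᶜ = 0
  rw [Measure.map_apply (hmap s a) hm.compl]
  refine mul_eq_zero_of_right _ ?_
  have h2 := (measurePreserving_eval (μ := fun h : Fin H => M.R h (s h.castSucc) (a h)) h)
  have h3 := h2.quasiMeasurePreserving.ae (M.R_mem h (s h.castSucc) (a h))
  exact ae_iff.1 h3

open Classical in
theorem occupancy_eq_occ (M : MDP S A H) (π : Policy S A H) (h : Fin H) (s : S) (a : A) :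
    occupancy M π h s a = occ M π h s a := by
  have h1 := integral_step M π h (fun s' a' _ _ => if s' = s ∧ a' = a then 1 else 0)
    fun _ _ _ => BddMeas.const _
  have hR : ∀ h s a, IsProbabilityMeasure (M.R h s a) := M.R_prob
  simp only [integral_const, probReal_univ, smul_eq_mul, one_mul, ← Finset.sum_mul, M.P_sum] at h1
  rw [Finset.sum_eq_single s (fun b _ hb => by simp [hb]) (by simp),
    Finset.sum_eq_single a (fun b _ hb => by simp [hb]) (by simp)] at h1
  simp only [and_self, if_true, mul_one] at h1
  rw [← h1]
  change (episodeLaw M π).real (visitSet h s a) = _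
  rw [← integral_indicator_one (measurableSet_visitSet h s a)]
  refine integral_congr_ae (Filter.Eventually.of_forall fun e => ?_)
  simp [Set.indicator_apply, visitSet]

theorem value_eq_sum (M : MDP S A H) (π : Policy S A H) :
    value M π = ∑ h, ∑ s, ∑ a, occ M π h s a * meanReward M h s a := by
  have hclip : BddMeas clip01 := ⟨measurable_clip01, 1, fun r => by
    rw [abs_of_nonneg (clip01_mem r).1]; exact (clip01_mem r).2⟩
  -- Rewards lie in [0, 1] only almost surely. Truncation changes nothing in the integral and makes
  -- the integrand bounded everywhere.
  have e1 : value M π = ∫ e, ∑ h : Fin H, clip01 (e.reward h) ∂(episodeLaw M π) := by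
    refine integral_congr_ae ?_
    filter_upwards [ae_reward_mem M π] with e he
    exact Finset.sum_congr rfl fun h _ => (clip01_of_mem (he h)).symm
  rw [e1, integral_finsetSum _ fun h _ => (hclip.comp (measurable_reward h)).integrable _]
  refine Finset.sum_congr rfl fun h _ => ?_
  rw [integral_step M π h (fun _ _ r _ => clip01 r) fun _ _ _ => hclip]
  simp only [← Finset.sum_mul, M.P_sum, one_mul]
  rfl

theorem value_mem (M : MDP S A H) (π : Policy S A H) : value M π ∈ Set.Icc (0 : ℝ) H := by
  rw [value_eq_sum]
  constructor
  · exact Finset.sum_nonneg fun h _ => Finset.sum_nonneg fun s _ => Finset.sum_nonneg fun a _ =>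
      mul_nonneg (occ_nonneg M π h s a) (meanReward_mem M h s a).1
  · calc _ ≤ ∑ h : Fin H, ∑ s, ∑ a, occ M π h s a := by
          refine Finset.sum_le_sum fun h _ => Finset.sum_le_sum fun s _ =>
            Finset.sum_le_sum fun a _ => ?_
          exact mul_le_of_le_one_right (occ_nonneg M π h s a) (meanReward_mem M h s a).2
      _ = H := by simp [sum_occ]

theorem bddAbove_value (M : MDP S A H) : BddAbove (Set.range fun π : Policy S A H => value M π) :=
  ⟨H, by rintro _ ⟨π, rfl⟩; exact (value_mem M π).2⟩

theorem value_le_optimalValue (M : MDP S A H) (π : Policy S A H) :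
    value M π ≤ optimalValue M := le_ciSup (bddAbove_value M) π

variable {M : MDP S A H} {π : Policy S A H} {h : Fin H} {s : S} {a : A}

theorem measure_visitSet : (episodeLaw M π).real (visitSet h s a) = occ M π h s a := by
  rw [← occupancy_eq_occ]; rfl

theorem measure_visitSet_ne_zero (hd : 0 < occ M π h s a) :
    episodeLaw M π (visitSet h s a) ≠ 0 := by
  intro h0
  rw [← measure_visitSet, Measure.real, h0] at hd
  simp at hd

open Classical in
-- Conditioning on the visit multiplies the test function by the indicator of the visit and divides
-- by its probability, so `integral_step` leaves the single term at (s, a).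
theorem integral_cond_step (hd : 0 < occ M π h s a) {φ : ℝ → S → ℝ}
    (hφ : ∀ s', BddMeas fun r => φ r s') :
    ∫ e, φ (e.reward h) (e.next h) ∂(ProbabilityTheory.cond (episodeLaw M π) (visitSet h s a))
      = ∑ s', M.P h s a s' * ∫ r, φ r s' ∂(M.R h s a) := by
  rw [ProbabilityTheory.cond, integral_smul_measure, ← integral_indicator
    (measurableSet_visitSet h s a)]
  have h1 := integral_step M π h (fun s' a' r y => if s' = s ∧ a' = a then φ r y else 0)
    fun s' a' y => by
      by_cases hc : s' = s ∧ a' = a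
      · simpa [hc] using hφ y
      · simpa [hc] using BddMeas.const 0
  rw [Finset.sum_eq_single s (fun b _ hb => by simp [hb]) (by simp),
    Finset.sum_eq_single a (fun b _ hb => by simp [hb]) (by simp)] at h1
  simp only [and_self, if_true] at h1
  have h2 : ∫ e, (visitSet h s a).indicator (fun e => φ (e.reward h) (e.next h)) e
        ∂(episodeLaw M π)
      = occ M π h s a * ∑ s', M.P h s a s' * ∫ r, φ r s' ∂(M.R h s a) := by
    rw [← h1]
    refine integral_congr_ae (Filter.Eventually.of_forall fun e => ?_)
    simp [Set.indicator_apply, visitSet]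
  rw [h2, ENNReal.toReal_inv, ← Measure.real, measure_visitSet, smul_eq_mul, ← mul_assoc,
    inv_mul_cancel₀ hd.ne', one_mul]

theorem integral_cond_next (hd : 0 < occ M π h s a) (c : S → ℝ) :
    ∫ e, c (e.next h) ∂(ProbabilityTheory.cond (episodeLaw M π) (visitSet h s a))
      = ∑ s', M.P h s a s' * c s' := by
  have := M.R_prob h s a
  rw [integral_cond_step hd (φ := fun _ y => c y) fun _ => BddMeas.const _]
  simp

theorem integral_cond_reward (hd : 0 < occ M π h s a) :
    ∫ e, clip01 (e.reward h) ∂(ProbabilityTheory.cond (episodeLaw M π) (visitSet h s a))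
      = meanReward M h s a := by
  rw [integral_cond_step hd (φ := fun r _ => clip01 r) fun _ => ⟨measurable_clip01, 1, fun r => by
    rw [abs_of_nonneg (clip01_mem r).1]; exact (clip01_mem r).2⟩]
  rw [← Finset.sum_mul, M.P_sum, one_mul]
  rfl

open Classical in
theorem cond_real_next (hd : 0 < occ M π h s a) (s' : S) :
    (ProbabilityTheory.cond (episodeLaw M π) (visitSet h s a)).real
      ((fun e : Episode S A H => e.next h) ⁻¹' {s'}) = M.P h s a s' := by
  have h1 := integral_cond_next hd (fun y => if y = s' then (1 : ℝ) else 0)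
  simp only [mul_ite, mul_one, mul_zero, Finset.sum_ite_eq', Finset.mem_univ, if_true] at h1
  rw [← h1, ← integral_indicator_one ((measurableSet_singleton s').preimage (measurable_next h))]
  refine integral_congr_ae (Filter.Eventually.of_forall fun e => ?_)
  simp [Set.indicator_apply]

open Classical in
/-- Almost surely every observed transition has positive probability. -/
theorem ae_transition_pos (M : MDP S A H) (π : Policy S A H) :
    ∀ᵐ e ∂(episodeLaw M π), ∀ h, 0 < occ M π h (e.state h) (e.action h) ∧
      0 < M.P h (e.state h) (e.action h) (e.next h) := by
  refine ae_all_iff.2 fun h => ?_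
  have hR : ∀ h s a, IsProbabilityMeasure (M.R h s a) := M.R_prob
  -- The indicator of an impossible transition. Its expectation vanishes term by term because the
  -- corresponding occupancy or transition probability is zero.
  set ψ : S → A → ℝ → S → ℝ := fun s a _ y =>
    if 0 < occ M π h s a ∧ 0 < M.P h s a y then 0 else 1 with hψ
  have h1 := integral_step M π h ψ fun s a y => BddMeas.const _
  have h2 : ∑ s, ∑ a, occ M π h s a * ∑ s', M.P h s a s' * ∫ r, ψ s a r s' ∂(M.R h s a) = 0 := by
    refine Finset.sum_eq_zero fun s _ => Finset.sum_eq_zero fun a _ => ?_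
    rw [Finset.mul_sum]
    refine Finset.sum_eq_zero fun y _ => ?_
    simp only [hψ, integral_const, probReal_univ, smul_eq_mul, one_mul]
    split_ifs with hc
    · simp
    · rcases (occ_nonneg M π h s a).eq_or_lt with h3 | h3
      · rw [← h3]; simp
      · rcases (M.P_nonneg h s a y).eq_or_lt with h4 | h4
        · rw [← h4]; simp
        · exact absurd ⟨h3, h4⟩ hc
  rw [h2] at h1
  have hnn : 0 ≤ fun e : Episode S A H =>
      ψ (e.state h) (e.action h) (e.reward h) (e.next h) := fun e => by
    simp only [hψ]; split_ifs <;> simp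
  have hm : BddMeas fun e : Episode S A H =>
      ψ (e.state h) (e.action h) (e.reward h) (e.next h) := by
    have : Measurable fun p : S × A × S => if 0 < occ M π h p.1 p.2.1 ∧ 0 < M.P h p.1 p.2.1 p.2.2
      then (0 : ℝ) else 1 := measurable_of_countable _
    refine ⟨this.comp ((measurable_state h).prodMk
      ((measurable_action h).prodMk (measurable_next h))), 1, fun e => ?_⟩
    simp only [hψ]; split_ifs <;> simp
  filter_upwards [(integral_eq_zero_iff_of_nonneg hnn (hm.integrable _)).1 h1] with e he
  by_contra hcon
  simp [hψ, hcon] at he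

end Markov

/-! ### A stable version of the algorithm -/

section PenalizedMean

variable {ι : Type*} [DecidableEq ι]

/-- The empirical mean minus the Bernstein penalty, with the sample size bounded below by `κ`. -/
noncomputable def penalizedMean (B L κ : ℝ) (Y : Finset ι) (y : ι → ℝ) : ℝ :=
  (∑ i ∈ Y, y i - 2 * √L * devNorm Y y - 14 * B * L) / max (Y.card : ℝ) κ

variable {B L κ : ℝ} {Y : Finset ι} {y z : ι → ℝ}

theorem penalizedMean_congr (h : ∀ i ∈ Y, y i = z i) :
    penalizedMean B L κ Y y = penalizedMean B L κ Y z := by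
  have h1 : ∑ i ∈ Y, y i = ∑ i ∈ Y, z i := Finset.sum_congr rfl h
  have h2 : devNorm Y y = devNorm Y z := by
    simp only [devNorm, finMean, h1]
    congr 1
    exact Finset.sum_congr rfl fun i hi => by rw [h i hi]
  rw [penalizedMean, penalizedMean, h1, h2]

/-- One further observation changes the numerator by O(B(1 + L)) and the denominator by at most one,
and the quotient itself is at most 17B in absolute value. The floor κ on the denominator keeps the
bound uniform over all data sets, including those with few visits. -/
theorem abs_penalizedMean_insert_sub_le (hB : 0 ≤ B) (hL : 0 ≤ L) (hκ : 0 < κ) (hLκ : L ≤ κ)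
    {j : ι} (hj : j ∉ Y) (hy : ∀ i ∈ insert j Y, y i ∈ Set.Icc 0 B) :
    |penalizedMean B L κ (insert j Y) y - penalizedMean B L κ Y y| ≤ B * (19 + L) / κ := by
  set K := max (Y.card : ℝ) κ with hK
  set K' := max ((insert j Y).card : ℝ) κ with hK'
  have hcard : ((insert j Y).card : ℝ) = Y.card + 1 := by
    rw [Finset.card_insert_of_notMem hj]; push_cast; rfl
  have hκK : κ ≤ K := le_max_right _ _
  have hκK' : κ ≤ K' := le_max_right _ _
  have hYK : (Y.card : ℝ) ≤ K := le_max_left _ _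
  have hK0 : 0 < K := hκ.trans_le hκK
  have hK'0 : 0 < K' := hκ.trans_le hκK'
  have hKK' : K ≤ K' := max_le_max (by rw [hcard]; linarith) le_rfl
  have hK'K : K' ≤ K + 1 := max_le (by rw [hcard]; linarith) (by linarith)
  have hyY : ∀ i ∈ Y, y i ∈ Set.Icc 0 B := fun i hi => hy i (Finset.mem_insert_of_mem hi)
  have hd1 := devNorm_le_insert (y := y) hj
  have hd2 := devNorm_insert_le hB hy hj
  have hsq : 2 * √L ≤ 1 + L := by nlinarith [Real.sq_sqrt hL, sq_nonneg (√L - 1)]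
  have hsum0 : 0 ≤ ∑ i ∈ Y, y i := Finset.sum_nonneg fun i hi => (hyY i hi).1
  have hsum1 : ∑ i ∈ Y, y i ≤ K * B := by
    calc ∑ i ∈ Y, y i ≤ ∑ _i ∈ Y, B := Finset.sum_le_sum fun i hi => (hyY i hi).2
      _ = Y.card * B := by rw [Finset.sum_const, nsmul_eq_mul]
      _ ≤ K * B := by gcongr
  have hdev0 := devNorm_nonneg (I := Y) y
  have hdev1 : √L * devNorm Y y ≤ K * B := by
    calc √L * devNorm Y y ≤ √K * (√K * B) := by
          refine mul_le_mul (Real.sqrt_le_sqrt (hLκ.trans hκK)) ?_ hdev0 (Real.sqrt_nonneg _)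
          refine (devNorm_le_sqrt_card hB hyY).trans ?_
          gcongr
      _ = K * B := by rw [← mul_assoc, Real.mul_self_sqrt hK0.le]
  set N := ∑ i ∈ Y, y i - 2 * √L * devNorm Y y - 14 * B * L with hN
  set N' := ∑ i ∈ insert j Y, y i - 2 * √L * devNorm (insert j Y) y - 14 * B * L with hN'
  have hBL : B * L ≤ K * B := by nlinarith
  have hBL0 : 0 ≤ B * L := by positivity
  have hNabs : |N| ≤ 17 * (K * B) := abs_le.2 ⟨by rw [hN]; nlinarith, by
    rw [hN]; nlinarith [mul_nonneg (Real.sqrt_nonneg L) hdev0]⟩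
  have hΔ : |N' - N| ≤ B * (2 + L) := by
    have e : N' - N = y j - 2 * √L * (devNorm (insert j Y) y - devNorm Y y) := by
      rw [hN, hN', Finset.sum_insert hj]; ring
    have h1 := hy j (Finset.mem_insert_self _ _)
    have h2 : 2 * √L * (devNorm (insert j Y) y - devNorm Y y) ≤ (1 + L) * B :=
      mul_le_mul hsq (by linarith) (by linarith) (by linarith)
    have h3 : 0 ≤ 2 * √L * (devNorm (insert j Y) y - devNorm Y y) :=
      mul_nonneg (by positivity) (by linarith)
    rw [e]
    exact abs_le.2 ⟨by nlinarith [h1.1], by nlinarith [h1.2]⟩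
  have e : penalizedMean B L κ (insert j Y) y - penalizedMean B L κ Y y
      = ((N' - N) + N / K * (K - K')) / K' := by
    change N' / K' - N / K = _
    field_simp
    ring
  rw [e, abs_div, abs_of_pos hK'0]
  have h4 : |N / K * (K - K')| ≤ 17 * B := by
    rw [abs_mul, abs_div, abs_of_pos hK0]
    have h5 : |K - K'| ≤ 1 := abs_le.2 ⟨by linarith, by linarith⟩
    have h6 : |N| / K ≤ 17 * B := by rw [div_le_iff₀ hK0]; linarith
    calc |N| / K * |K - K'| ≤ 17 * B * 1 := mul_le_mul h6 h5 (abs_nonneg _) (by positivity)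
      _ = 17 * B := mul_one _
  calc |N' - N + N / K * (K - K')| / K' ≤ (B * (2 + L) + 17 * B) / K' := by
        gcongr
        exact (abs_add_le _ _).trans (add_le_add hΔ h4)
    _ ≤ (B * (2 + L) + 17 * B) / κ := by gcongr
    _ = B * (19 + L) / κ := by ring

/-- The mean is 1-Lipschitz in the sup norm, and the deviation penalty adds 2√L/√K ≤ 1/H once the
sample size floor is at least 4H²L. A Lipschitz constant of 1 + 1/H per step stays bounded after H
steps. -/
theorem abs_penalizedMean_sub_le {H ε : ℝ} (hH : 0 < H) (hL : 0 ≤ L) (hκ : 0 < κ)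
    (hLκ : 4 * H ^ 2 * L ≤ κ) (hε : 0 ≤ ε) (h : ∀ i ∈ Y, |y i - z i| ≤ ε) :
    |penalizedMean B L κ Y y - penalizedMean B L κ Y z| ≤ (1 + 1 / H) * ε := by
  set K := max (Y.card : ℝ) κ with hK
  have hκK : κ ≤ K := le_max_right _ _
  have hYK : (Y.card : ℝ) ≤ K := le_max_left _ _
  have hK0 : 0 < K := hκ.trans_le hκK
  have h1 := devNorm_le_add hε h
  have h2 := devNorm_le_add (y := z) (z := y) hε fun i hi => by rw [abs_sub_comm]; exact h i hi
  have hs : |∑ i ∈ Y, y i - ∑ i ∈ Y, z i| ≤ K * ε := by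
    rw [← Finset.sum_sub_distrib]
    refine (Finset.abs_sum_le_sum_abs _ _).trans ((Finset.sum_le_sum h).trans ?_)
    rw [Finset.sum_const, nsmul_eq_mul]
    gcongr
  have hd : |devNorm Y y - devNorm Y z| ≤ √K * ε := by
    have : √(Y.card : ℝ) * ε ≤ √K * ε := by gcongr
    exact abs_sub_le_iff.2 ⟨by linarith, by linarith⟩
  have hLK : 2 * √L * √K ≤ K / H := by
    have h3 : 2 * √L ≤ √K / H := by
      rw [le_div_iff₀ hH]
      refine Real.le_sqrt_of_sq_le ?_
      have : (2 * √L * H) ^ 2 = 4 * H ^ 2 * L := by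
        rw [mul_pow, mul_pow, Real.sq_sqrt hL]; ring
      rw [this]; linarith
    calc 2 * √L * √K ≤ √K / H * √K := by gcongr
      _ = K / H := by rw [div_mul_eq_mul_div, Real.mul_self_sqrt hK0.le]
  have e : penalizedMean B L κ Y y - penalizedMean B L κ Y z
      = ((∑ i ∈ Y, y i - ∑ i ∈ Y, z i) - 2 * √L * (devNorm Y y - devNorm Y z)) / K := by
    rw [penalizedMean, penalizedMean]; ring
  rw [e, abs_div, abs_of_pos hK0, div_le_iff₀ hK0]
  calc _ ≤ |∑ i ∈ Y, y i - ∑ i ∈ Y, z i| + |2 * √L * (devNorm Y y - devNorm Y z)| := abs_sub _ _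
    _ ≤ K * ε + 2 * √L * (√K * ε) := by
        rw [abs_mul, abs_of_nonneg (by positivity : 0 ≤ 2 * √L)]
        gcongr
    _ = K * ε + 2 * √L * √K * ε := by ring
    _ ≤ K * ε + K / H * ε := by gcongr
    _ = (1 + 1 / H) * ε * K := by ring

end PenalizedMean

/-! ### The surrogate value iteration and its stability. -/

section Surrogate

variable {S A : Type*} [Fintype S] [Fintype A] {H n : ℕ}

/-- The observed reward plus the value of the next state. -/
noncomputable def target (D : Fin n → Episode S A H) (h : Fin H) (V : S → ℝ) (τ : Fin n) : ℝ :=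
  clip01 ((D τ).reward h) + V ((D τ).next h)

open Classical in
/-- The pessimistic update with sample sizes bounded below, restricted to the pairs in `g`. -/
noncomputable def stableQ (g : Fin H → S → A → Prop) (L κ : ℝ) (D : Fin n → Episode S A H)
    (h : Fin H) (V : S → ℝ) (s : S) (a : A) : ℝ :=
  if g h s a then max (min (penalizedMean H L κ (visits D h s a) (target D h V))
    ((H : ℝ) - (h : ℕ))) 0 else 0

/-- The values computed by backward induction from the stable pessimistic update. -/
noncomputable def stableV (g : Fin H → S → A → Prop) (L κ : ℝ) (D : Fin n → Episode S A H) :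
    Fin (H + 1) → S → ℝ :=
  Fin.reverseInduction (fun _ => 0) fun h V s => ⨆ a, stableQ g L κ D h V s a

variable {g : Fin H → S → A → Prop} {L κ : ℝ} {D : Fin n → Episode S A H}

theorem stableV_last : stableV g L κ D (Fin.last H) = fun _ => 0 := by
  simp [stableV]

theorem stableV_castSucc (h : Fin H) : stableV g L κ D h.castSucc
    = fun s => ⨆ a, stableQ g L κ D h (stableV g L κ D h.succ) s a := by
  simp [stableV]

theorem stableQ_mem (h : Fin H) (V : S → ℝ) (s : S) (a : A) :
    stableQ g L κ D h V s a ∈ Set.Icc (0 : ℝ) ((H : ℝ) - (h : ℕ)) := by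
  have hh : ((h : ℕ) : ℝ) ≤ H := by exact_mod_cast h.2.le
  rw [stableQ]
  split_ifs
  · exact ⟨le_max_right _ _, max_le (min_le_right _ _) (by linarith)⟩
  · exact ⟨le_rfl, by linarith⟩

theorem stableV_mem [Nonempty A] (h : Fin (H + 1)) (s : S) :
    stableV g L κ D h s ∈ Set.Icc (0 : ℝ) ((H : ℝ) - (h : ℕ)) := by
  refine Fin.lastCases ?_ (fun h => ?_) h
  · simp [stableV_last]
  · rw [stableV_castSucc]
    have hb : BddAbove (Set.range fun a => stableQ g L κ D h (stableV g L κ D h.succ) s a) :=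
      (Set.finite_range _).bddAbove
    refine ⟨?_, ciSup_le fun a => by simpa using (stableQ_mem h _ s a).2⟩
    obtain ⟨a⟩ := ‹Nonempty A›
    exact (stableQ_mem h _ s a).1.trans (le_ciSup hb a)

theorem target_mem (h : Fin H) {V : S → ℝ}
    (hV : ∀ s, V s ∈ Set.Icc (0 : ℝ) ((H : ℝ) - (h.succ : ℕ))) (τ : Fin n) :
    target D h V τ ∈ Set.Icc (0 : ℝ) H := by
  have h1 := clip01_mem ((D τ).reward h)
  have h2 := hV ((D τ).next h)
  have h3 : ((h.succ : ℕ) : ℝ) = (h : ℕ) + 1 := by simp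
  have h4 : (0 : ℝ) ≤ (h : ℕ) := by positivity
  rw [h3] at h2
  exact ⟨add_nonneg h1.1 h2.1, by rw [target]; linarith [h1.2, h2.2]⟩

open Classical in
theorem mem_visits {h : Fin H} {s : S} {a : A} {τ : Fin n} :
    τ ∈ visits D h s a ↔ (D τ).state h = s ∧ (D τ).action h = a := by
  simp [visits]

theorem abs_ciSup_sub_ciSup_le {α : Type*} [Finite α] [Nonempty α] {f f' : α → ℝ} {b : ℝ}
    (h : ∀ a, |f a - f' a| ≤ b) : |(⨆ a, f a) - ⨆ a, f' a| ≤ b := by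
  have hb : ∀ f : α → ℝ, BddAbove (Set.range f) := fun f => (Set.finite_range f).bddAbove
  have key : ∀ f f' : α → ℝ, (∀ a, |f a - f' a| ≤ b) → (⨆ a, f a) - (⨆ a, f' a) ≤ b := by
    intro f f' h
    rw [sub_le_iff_le_add]
    refine ciSup_le fun a => ?_
    have := le_ciSup (hb f') a
    linarith [(abs_le.1 (h a)).2]
  exact abs_sub_le_iff.2 ⟨key f f' h, key f' f fun a => by rw [abs_sub_comm]; exact h a⟩

/-- Replacing one episode changes a penalized mean only slightly. -/
theorem abs_penalizedMean_update_sub_le (hL : 0 ≤ L) (hκ : 0 < κ) (hLκ : L ≤ κ) (τ : Fin n)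
    (e : Episode S A H) (h : Fin H) {V : S → ℝ}
    (hV : ∀ s, V s ∈ Set.Icc (0 : ℝ) ((H : ℝ) - (h.succ : ℕ))) (s : S) (a : A) :
    |penalizedMean H L κ (visits (Function.update D τ e) h s a)
        (target (Function.update D τ e) h V)
      - penalizedMean H L κ (visits D h s a) (target D h V)| ≤ 2 * (H * (19 + L) / κ) := by
  -- Both data sets are compared with the sample from which episode `τ` is removed, where they
  -- agree. Each comparison is an insertion or no change.
  have herase : ∀ D' : Fin n → Episode S A H,
      |penalizedMean H L κ (visits D' h s a) (target D' h V)
        - penalizedMean H L κ ((visits D' h s a).erase τ) (target D' h V)|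
        ≤ H * (19 + L) / κ := by
    intro D'
    by_cases hτ : τ ∈ visits D' h s a
    · have := abs_penalizedMean_insert_sub_le (B := (H : ℝ)) (y := target D' h V)
        (by positivity) hL hκ hLκ (Finset.notMem_erase τ (visits D' h s a))
        fun i _ => target_mem h hV i
      rwa [Finset.insert_erase hτ] at this
    · rw [Finset.erase_eq_of_notMem hτ, sub_self, abs_zero]
      positivity
  have h1 := herase D
  have h2 := herase (Function.update D τ e)
  have h3 : (visits (Function.update D τ e) h s a).erase τ = (visits D h s a).erase τ := by
    ext j
    simp only [Finset.mem_erase, mem_visits]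
    refine and_congr_right fun hj => ?_
    rw [Function.update_of_ne hj]
  have h4 : penalizedMean H L κ ((visits D h s a).erase τ) (target (Function.update D τ e) h V)
      = penalizedMean H L κ ((visits D h s a).erase τ) (target D h V) :=
    penalizedMean_congr fun i hi => by
      simp only [target, Function.update_of_ne (Finset.ne_of_mem_erase hi)]
  rw [h3, h4] at h2
  rw [abs_sub_comm] at h1
  calc _ ≤ _ := abs_sub_le _ (penalizedMean H L κ ((visits D h s a).erase τ) (target D h V)) _
    _ ≤ _ := add_le_add h2 h1
    _ = _ := by ring

/-- The recursion is error_h ≤ (1 + 1/H)·error_{h+1} + c: the first term is the perturbation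
inherited through the next value function, the second the direct effect of the replaced episode at
step h. Maxima and truncations are 1-Lipschitz. -/
theorem abs_stableV_update_sub_le [Nonempty A] (hL : 0 ≤ L) (hκ : 0 < κ)
    (hLκ : 4 * (H : ℝ) ^ 2 * L ≤ κ) (τ : Fin n) (e : Episode S A H) (h : Fin (H + 1)) (s : S) :
    |stableV g L κ (Function.update D τ e) h s - stableV g L κ D h s|
      ≤ (1 + 1 / (H : ℝ)) ^ (H - (h : ℕ)) * ((H : ℝ) - (h : ℕ)) * (2 * (H * (19 + L) / κ)) := by
  set c := 2 * (H * (19 + L) / κ) with hc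
  have hc0 : 0 ≤ c := by positivity
  induction h using Fin.reverseInduction generalizing s with
  | last => simp [stableV_last]
  | cast h ih =>
    have hH : (0 : ℝ) < H := by
      have := h.2
      exact_mod_cast (by omega : 0 < H)
    have hH1 : (1 : ℝ) ≤ H := by
      have := h.2
      exact_mod_cast (by omega : 1 ≤ H)
    have hL' : L ≤ κ := by
      have : 1 ≤ 4 * (H : ℝ) ^ 2 := by nlinarith
      exact (le_mul_of_one_le_left hL this).trans hLκ
    have hsub : H - ((h.castSucc : Fin (H + 1)) : ℕ) = H - (h.succ : ℕ) + 1 := by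
      have := h.2
      simp; omega
    have hsub' : (H : ℝ) - ((h.castSucc : Fin (H + 1)) : ℕ) = (H : ℝ) - (h.succ : ℕ) + 1 := by
      simp only [Fin.val_castSucc, Fin.val_succ, Nat.cast_add, Nat.cast_one]
      ring
    have hnn : (0 : ℝ) ≤ (H : ℝ) - (h.succ : ℕ) := by
      have : ((h.succ : ℕ) : ℝ) ≤ H := by exact_mod_cast h.2
      linarith
    set k := H - (h.succ : ℕ) with hk
    set r := (H : ℝ) - (h.succ : ℕ) with hr
    set θ := 1 + 1 / (H : ℝ) with hθ
    have hθ1 : 1 ≤ θ := by rw [hθ]; linarith [one_div_pos.2 hH]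
    set V := stableV g L κ D h.succ with hV
    set V' := stableV g L κ (Function.update D τ e) h.succ with hV'
    rw [stableV_castSucc, stableV_castSucc, hsub, hsub']
    refine abs_ciSup_sub_ciSup_le fun a => ?_
    have hb : 0 ≤ θ ^ k * r * c := by positivity
    have main : |penalizedMean H L κ (visits (Function.update D τ e) h s a)
          (target (Function.update D τ e) h V')
        - penalizedMean H L κ (visits D h s a) (target D h V)|
        ≤ θ ^ (k + 1) * (r + 1) * c := by
      have h1 := abs_penalizedMean_sub_le (B := (H : ℝ)) (L := L) (κ := κ)
        (Y := visits (Function.update D τ e) h s a) (y := target (Function.update D τ e) h V')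
        (z := target (Function.update D τ e) h V) hH hL hκ hLκ hb fun i _ => by
          rw [target, target, add_sub_add_left_eq_sub]
          exact ih _
      have h2 := abs_penalizedMean_update_sub_le (D := D) hL hκ hL' τ e h (V := V)
        (fun s => stableV_mem _ s) s a
      have h3 : c ≤ θ ^ (k + 1) * c := le_mul_of_one_le_left hc0 (one_le_pow₀ hθ1)
      calc _ ≤ _ := abs_sub_le _ (penalizedMean H L κ (visits (Function.update D τ e) h s a)
              (target (Function.update D τ e) h V)) _
        _ ≤ θ * (θ ^ k * r * c) + c := add_le_add h1 h2
        _ ≤ θ ^ (k + 1) * r * c + θ ^ (k + 1) * c := by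
            refine add_le_add (le_of_eq ?_) h3
            ring
        _ = _ := by ring
    rw [stableQ, stableQ]
    split_ifs
    · refine (abs_max_sub_max_le_abs _ _ _).trans (le_trans ?_ main)
      exact abs_inf_sub_inf_le_abs _ _ _
    · rw [sub_self, abs_zero]; positivity

theorem one_add_inv_pow_le (hH : 1 ≤ H) (k : ℕ) (hk : k ≤ H) : (1 + 1 / (H : ℝ)) ^ k ≤ 3 := by
  have hH0 : (0 : ℝ) < H := by exact_mod_cast hH
  calc (1 + 1 / (H : ℝ)) ^ k ≤ (1 + 1 / (H : ℝ)) ^ H :=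
        pow_le_pow_right₀ (by linarith [one_div_pos.2 hH0]) hk
    _ ≤ (Real.exp (1 / (H : ℝ))) ^ H := by
        gcongr
        linarith [Real.add_one_le_exp (1 / (H : ℝ))]
    _ = Real.exp 1 := by rw [← Real.exp_nat_mul]; congr 1; field_simp
    _ ≤ 3 := by linarith [Real.exp_one_lt_d9]

theorem bddDiff_stableV [Nonempty A] (hH : 1 ≤ H) (hL : 0 ≤ L) (hκ : 0 < κ)
    (hLκ : 4 * (H : ℝ) ^ 2 * L ≤ κ) (h : Fin (H + 1)) (s : S) :
    BddDiff Finset.univ (6 * (H : ℝ) ^ 2 * (19 + L) / κ)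
      fun D : Fin n → Episode S A H => stableV g L κ D h s := by
  intro τ _ D e
  refine (abs_stableV_update_sub_le hL hκ hLκ τ e h s).trans ?_
  have h1 := one_add_inv_pow_le hH (H - (h : ℕ)) (Nat.sub_le _ _)
  have h2 : (0 : ℝ) ≤ (h : ℕ) := by positivity
  have h3 : ((h : ℕ) : ℝ) ≤ H := by exact_mod_cast Nat.lt_succ_iff.1 h.2
  calc _ ≤ 3 * (H : ℝ) * (2 * (H * (19 + L) / κ)) := by
        gcongr
        linarith
    _ = _ := by ring

variable [MeasurableSpace S] [DiscreteMeasurableSpace S] [MeasurableSpace A]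
  [DiscreteMeasurableSpace A]

theorem visits_eq_coordsIn (D : Fin n → Episode S A H) (h : Fin H) (s : S) (a : A) :
    visits D h s a = coordsIn (visitSet h s a) D := by
  ext τ
  rw [mem_visits, mem_coordsIn]
  rfl

theorem measurable_sum_visits (h : Fin H) (s : S) (a : A)
    {F : Fin n → (Fin n → Episode S A H) → ℝ} (hF : ∀ τ, Measurable (F τ)) :
    Measurable fun D : Fin n → Episode S A H => ∑ τ ∈ visits D h s a, F τ D := by
  classical
  have : (fun D : Fin n → Episode S A H => ∑ τ ∈ visits D h s a, F τ D)
      = fun D => ∑ τ, if D τ ∈ visitSet h s a then F τ D else 0 := by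
    funext D
    rw [← Finset.sum_filter]
    refine Finset.sum_congr ?_ fun _ _ => rfl
    ext τ
    simp only [mem_visits, Finset.mem_filter, Finset.mem_univ, true_and]
    rfl
  rw [this]
  refine Finset.measurable_sum _ fun τ _ => Measurable.ite ?_ (hF τ) measurable_const
  exact (measurableSet_visitSet h s a).preimage (measurable_pi_apply τ)

theorem measurable_stableV (h : Fin (H + 1)) (s : S) :
    Measurable fun D : Fin n → Episode S A H => stableV g L κ D h s := by
  classical
  induction h using Fin.reverseInduction generalizing s with
  | last => simp only [stableV_last]; exact measurable_const
  | cast h ih =>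
    simp only [stableV_castSucc]
    refine Measurable.iSup fun a => ?_
    simp only [stableQ]
    by_cases hg : g h s a
    · simp only [hg, if_true]
      have hcard : Measurable fun D : Fin n → Episode S A H => ((visits D h s a).card : ℝ) := by
        have := measurable_sum_visits (n := n) h s a (F := fun _ _ => (1 : ℝ))
          fun _ => measurable_const
        simpa using this
      have htar : ∀ τ : Fin n, Measurable fun D : Fin n → Episode S A H =>
          target D h (stableV g L κ D h.succ) τ := fun τ => by
        have e : (fun D : Fin n → Episode S A H => target D h (stableV g L κ D h.succ) τ)
            = fun D => clip01 ((D τ).reward h)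
              + ∑ s', if (D τ).next h = s' then stableV g L κ D h.succ s' else 0 := by
          funext D; simp [target]
        rw [e]
        refine (measurable_clip01.comp ((measurable_reward h).comp
          (measurable_pi_apply τ))).add (Finset.measurable_sum _ fun s' _ =>
            Measurable.ite ?_ (ih s') measurable_const)
        exact (measurableSet_singleton s').preimage
          ((measurable_next h).comp (measurable_pi_apply τ))
      have hsum := measurable_sum_visits h s a htar
      have hmean : Measurable fun D : Fin n → Episode S A H =>
          finMean (visits D h s a) (target D h (stableV g L κ D h.succ)) := hsum.div hcard
      have hdev : Measurable fun D : Fin n → Episode S A H =>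
          devNorm (visits D h s a) (target D h (stableV g L κ D h.succ)) :=
        (measurable_sum_visits h s a fun τ => ((htar τ).sub hmean).pow_const 2).sqrt
      have hpen : Measurable fun D : Fin n → Episode S A H =>
          penalizedMean H L κ (visits D h s a) (target D h (stableV g L κ D h.succ)) :=
        ((hsum.sub (hdev.const_mul _)).sub_const _).div (hcard.max measurable_const)
      exact (hpen.min measurable_const).max measurable_const
    · simp only [hg, if_false]
      exact measurable_const

end Surrogate

/-! ### Value functions and the deterministic part of the analysis -/

section Backward

variable {S A : Type*} [Fintype S] [Fintype A] {H : ℕ}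

/-- The value function of the policy `p` for the transitions `P` and the rewards `ρ`. -/
noncomputable def backValue (p : Fin H → S → A → ℝ) (P : Fin H → S → A → S → ℝ)
    (ρ : Fin H → S → A → ℝ) : Fin (H + 1) → S → ℝ :=
  Fin.reverseInduction (fun _ => 0) fun h V s => ∑ a, p h s a * (ρ h s a + ∑ s', P h s a s' * V s')

variable {f : S → ℝ} {p : Fin H → S → A → ℝ} {P : Fin H → S → A → S → ℝ} {ρ : Fin H → S → A → ℝ}

theorem backValue_last (s : S) : backValue p P ρ (Fin.last H) s = 0 := by
  simp [backValue]

theorem backValue_castSucc (h : Fin H) (s : S) : backValue p P ρ h.castSucc s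
    = ∑ a, p h s a * (ρ h s a + ∑ s', P h s a s' * backValue p P ρ h.succ s') := by
  simp [backValue]

theorem sum_mul_le_of_sum_eq_one {α : Type*} [Fintype α] {q x : α → ℝ} {b : ℝ}
    (hq : ∀ a, 0 ≤ q a) (h1 : ∑ a, q a = 1) (hx : ∀ a, x a ≤ b) : ∑ a, q a * x a ≤ b := by
  calc ∑ a, q a * x a ≤ ∑ a, q a * b :=
        Finset.sum_le_sum fun a _ => mul_le_mul_of_nonneg_left (hx a) (hq a)
    _ = b := by rw [← Finset.sum_mul, h1, one_mul]

theorem backValue_mem (hp0 : ∀ h s a, 0 ≤ p h s a) (hp : ∀ h s, ∑ a, p h s a = 1)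
    (hP0 : ∀ h s a s', 0 ≤ P h s a s') (hP : ∀ h s a, ∑ s', P h s a s' = 1) {R : ℝ}
    (hρ : ∀ h s a, ρ h s a ∈ Set.Icc 0 R) (h : Fin (H + 1)) (s : S) :
    backValue p P ρ h s ∈ Set.Icc 0 (((H : ℝ) - (h : ℕ)) * R) := by
  induction h using Fin.reverseInduction generalizing s with
  | last => simp [backValue_last]
  | cast h ih =>
    rw [backValue_castSucc]
    constructor
    · exact Finset.sum_nonneg fun a _ => mul_nonneg (hp0 _ _ _) (add_nonneg (hρ _ _ _).1
        (Finset.sum_nonneg fun s' _ => mul_nonneg (hP0 _ _ _ _) (ih s').1))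
    · refine sum_mul_le_of_sum_eq_one (hp0 h s) (hp h s) fun a => ?_
      have h1 := sum_mul_le_of_sum_eq_one (hP0 h s a) (hP h s a) fun s' => (ih s').2
      have h2 := (hρ h s a).2
      have e : ((H : ℝ) - ((h.castSucc : Fin (H + 1)) : ℕ)) * R
          = ((H : ℝ) - ((h.succ : Fin (H + 1)) : ℕ)) * R + R := by
        simp only [Fin.val_castSucc, Fin.val_succ, Nat.cast_add, Nat.cast_one]
        ring
      rw [e]; linarith

theorem sum_init_backValue (hp : ∀ h s, ∑ a, p h s a = 1) :
    ∑ s, f s * backValue p P ρ 0 s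
      = ∑ h : Fin H, ∑ s, ∑ a, stateDist f p P h.castSucc s * p h s a * ρ h s a := by
  rw [sum_init_eq hp (backValue p P ρ) backValue_last]
  refine Finset.sum_congr rfl fun h _ => Finset.sum_congr rfl fun s _ => ?_
  simp only [mul_assoc, ← Finset.mul_sum]
  congr 1
  simp only [mul_sub, Finset.sum_sub_distrib, ← Finset.sum_mul, hp, one_mul]
  rw [backValue_castSucc]
  simp only [mul_add, Finset.sum_add_distrib]
  ring

/-- A deterministic policy plays an action with positive probability only if it plays it always. -/
theorem eq_one_of_ne_zero (hp0 : ∀ h s a, 0 ≤ p h s a) (hp : ∀ h s, ∑ a, p h s a = 1)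
    (hdet : ∀ h s, ∃ a, p h s a = 1) {h : Fin H} {s : S} {a : A} (ha : p h s a ≠ 0) :
    p h s a = 1 ∧ ∀ b, b ≠ a → p h s b = 0 := by
  classical
  obtain ⟨c, hc⟩ := hdet h s
  have h1 : ∀ b, b ≠ c → p h s b = 0 := fun b hb => by
    have h2 := Finset.sum_le_sum_of_subset_of_nonneg (Finset.subset_univ {b, c})
      fun i _ _ => hp0 h s i
    rw [Finset.sum_pair hb, hp, hc] at h2
    exact le_antisymm (by linarith) (hp0 h s b)
  have : a = c := by
    by_contra hac
    exact ha (h1 a hac)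
  subst this
  exact ⟨hc, h1⟩

theorem backValue_castSucc_of_deterministic (hp0 : ∀ h s a, 0 ≤ p h s a)
    (hp : ∀ h s, ∑ a, p h s a = 1) (hdet : ∀ h s, ∃ a, p h s a = 1) {h : Fin H} {s : S} {a : A}
    (ha : p h s a ≠ 0) : backValue p P ρ h.castSucc s
      = ρ h s a + ∑ s', P h s a s' * backValue p P ρ h.succ s' := by
  obtain ⟨h1, h2⟩ := eq_one_of_ne_zero hp0 hp hdet ha
  rw [backValue_castSucc, Finset.sum_eq_single a (fun b _ hb => by rw [h2 b hb, zero_mul])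
    (by simp), h1, one_mul]

end Backward

/-! ### Weighted sums along a chain, total variance and self-bounding. -/

section Occupancy

variable {S A : Type*} [Fintype S] [Fintype A] {H : ℕ} {w : Fin H → S → A → ℝ}

/-- The expectation of an additive quantity under state-action weights `w`. -/
noncomputable def wsum (w x : Fin H → S → A → ℝ) : ℝ := ∑ h, ∑ s, ∑ a, w h s a * x h s a

theorem wsum_mono {x y : Fin H → S → A → ℝ} (hw : ∀ h s a, 0 ≤ w h s a)
    (hxy : ∀ h s a, w h s a ≠ 0 → x h s a ≤ y h s a) : wsum w x ≤ wsum w y := by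
  refine Finset.sum_le_sum fun h _ => Finset.sum_le_sum fun s _ => Finset.sum_le_sum fun a _ => ?_
  by_cases h0 : w h s a = 0
  · simp [h0]
  · exact mul_le_mul_of_nonneg_left (hxy h s a h0) (hw h s a)

theorem wsum_add (x y : Fin H → S → A → ℝ) :
    wsum w (fun h s a => x h s a + y h s a) = wsum w x + wsum w y := by
  simp only [wsum, mul_add, Finset.sum_add_distrib]

theorem wsum_sub (x y : Fin H → S → A → ℝ) :
    wsum w (fun h s a => x h s a - y h s a) = wsum w x - wsum w y := by
  simp only [wsum, mul_sub, Finset.sum_sub_distrib]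

theorem wsum_const_mul (c : ℝ) (x : Fin H → S → A → ℝ) :
    wsum w (fun h s a => c * x h s a) = c * wsum w x := by
  simp only [wsum, Finset.mul_sum]
  refine Finset.sum_congr rfl fun h _ => Finset.sum_congr rfl fun s _ =>
    Finset.sum_congr rfl fun a _ => ?_
  ring

theorem wsum_nonneg {x : Fin H → S → A → ℝ} (hw : ∀ h s a, 0 ≤ w h s a)
    (hx : ∀ h s a, 0 ≤ x h s a) : 0 ≤ wsum w x :=
  Finset.sum_nonneg fun h _ => Finset.sum_nonneg fun s _ => Finset.sum_nonneg fun a _ =>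
    mul_nonneg (hw h s a) (hx h s a)

theorem wsum_sqrt_le {x y : Fin H → S → A → ℝ} (hw : ∀ h s a, 0 ≤ w h s a)
    (hx : ∀ h s a, 0 ≤ x h s a) (hy : ∀ h s a, 0 ≤ y h s a) :
    wsum w (fun h s a => √(x h s a * y h s a)) ≤ √(wsum w x) * √(wsum w y) := by
  have e : ∀ z : Fin H → S → A → ℝ, wsum w z
      = ∑ i : Fin H × S × A, w i.1 i.2.1 i.2.2 * z i.1 i.2.1 i.2.2 := fun z => by
    simp only [wsum, Fintype.sum_prod_type]
  simp only [e]
  have h1 := Real.sum_sqrt_mul_sqrt_le (Finset.univ : Finset (Fin H × S × A))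
    (f := fun i => w i.1 i.2.1 i.2.2 * x i.1 i.2.1 i.2.2)
    (g := fun i => w i.1 i.2.1 i.2.2 * y i.1 i.2.1 i.2.2)
    (fun i => mul_nonneg (hw _ _ _) (hx _ _ _)) (fun i => mul_nonneg (hw _ _ _) (hy _ _ _))
  refine le_trans (le_of_eq (Finset.sum_congr rfl fun i _ => ?_)) h1
  rw [Real.sqrt_mul (hw _ _ _), Real.sqrt_mul (hw _ _ _), Real.sqrt_mul (hx _ _ _)]
  have := Real.mul_self_sqrt (hw i.1 i.2.1 i.2.2)
  calc _ = √(w i.1 i.2.1 i.2.2) * √(w i.1 i.2.1 i.2.2)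
        * (√(x i.1 i.2.1 i.2.2) * √(y i.1 i.2.1 i.2.2)) := by rw [this]
    _ = _ := by ring

variable {f : S → ℝ} {p : Fin H → S → A → ℝ} {P : Fin H → S → A → S → ℝ}

/-- The law of total variance along a chain. -/
theorem wsum_variance_le (hf : ∀ s, 0 ≤ f s) (hf1 : ∑ s, f s = 1) (hp0 : ∀ h s a, 0 ≤ p h s a)
    (hp : ∀ h s, ∑ a, p h s a = 1) (hP0 : ∀ h s a s', 0 ≤ P h s a s')
    (hP : ∀ h s a, ∑ s', P h s a s' = 1) {B : ℝ} {U : Fin (H + 1) → S → ℝ}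
    (hU : ∀ s, U (Fin.last H) s = 0) (hUB : ∀ h s, U h s ∈ Set.Icc 0 B) {e : Fin H → S → A → ℝ}
    (hwd : w = fun h s a => stateDist f p P h.castSucc s * p h s a)
    (he : ∀ h s a, w h s a ≠ 0 →
      0 ≤ U h.castSucc s - ∑ s', P h s a s' * U h.succ s' + e h s a)
    (he0 : ∀ h s a, w h s a ≠ 0 → 0 ≤ e h s a) :
    wsum w (fun h s a => ∑ s', P h s a s' * U h.succ s' ^ 2 - (∑ s', P h s a s' * U h.succ s') ^ 2)
      ≤ 2 * B * (B + wsum w e) := by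
  have hw : ∀ h s a, 0 ≤ w h s a := fun h s a => by
    rw [hwd]; exact mul_nonneg (stateDist_nonneg hf hp0 hP0 _ _) (hp0 _ _ _)
  have t1 : wsum w (fun h s a => U h.castSucc s ^ 2 - ∑ s', P h s a s' * U h.succ s' ^ 2)
      = ∑ s, f s * U 0 s ^ 2 := by
    rw [sum_init_eq (f := f) (P := P) hp (fun h s => U h s ^ 2) (by simp [hU]), hwd, wsum]
  have t2 : wsum w (fun h s a => U h.castSucc s - ∑ s', P h s a s' * U h.succ s')
      = ∑ s, f s * U 0 s := by
    rw [sum_init_eq (f := f) (P := P) hp U hU, hwd, wsum]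
  have t3 : 0 ≤ ∑ s, f s * U 0 s ^ 2 :=
    Finset.sum_nonneg fun s _ => mul_nonneg (hf s) (sq_nonneg _)
  have t4 : ∑ s, f s * U 0 s ≤ B := sum_mul_le_of_sum_eq_one hf hf1 fun s => (hUB 0 s).2
  -- The difference of squares factors as (U + q)(U − q). Adding `e` makes the second factor
  -- nonnegative, so U + q may be replaced by 2B, and then U − q telescopes to the initial value.
  have t5 : wsum w (fun h s a => U h.castSucc s ^ 2 - (∑ s', P h s a s' * U h.succ s') ^ 2)
      ≤ wsum w (fun h s a => 2 * B *
        ((U h.castSucc s - ∑ s', P h s a s' * U h.succ s') + e h s a)) := by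
    refine wsum_mono hw fun h s a hne => ?_
    set q := ∑ s', P h s a s' * U h.succ s' with hq
    have hq0 : 0 ≤ q := Finset.sum_nonneg fun s' _ => mul_nonneg (hP0 _ _ _ _) (hUB _ _).1
    have hq1 : q ≤ B := sum_mul_le_of_sum_eq_one (hP0 h s a) (hP h s a) fun s' => (hUB _ s').2
    have h1 := he h s a hne
    have h2 := he0 h s a hne
    have h3 := hUB h.castSucc s
    rw [← hq] at h1
    have h4 : (U h.castSucc s + q) * (U h.castSucc s - q + e h s a)
        ≤ 2 * B * (U h.castSucc s - q + e h s a) :=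
      mul_le_mul_of_nonneg_right (by linarith [h3.2]) h1
    have h5 : 0 ≤ (U h.castSucc s + q) * e h s a := mul_nonneg (by linarith [h3.1]) h2
    nlinarith
  -- The variance is the difference of U² − (PU)², bounded above, and U² − P(U²), which telescopes
  -- to the nonnegative initial second moment.
  have t6 : wsum w (fun h s a => ∑ s', P h s a s' * U h.succ s' ^ 2
        - (∑ s', P h s a s' * U h.succ s') ^ 2)
      = wsum w (fun h s a => U h.castSucc s ^ 2 - (∑ s', P h s a s' * U h.succ s') ^ 2)
        - wsum w (fun h s a => U h.castSucc s ^ 2 - ∑ s', P h s a s' * U h.succ s' ^ 2) := by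
    rw [← wsum_sub]
    congr 1
    funext h s a
    ring
  rw [wsum_const_mul, wsum_add, t2] at t5
  rw [t6, t1]
  have hB : 0 ≤ B := by
    obtain ⟨s⟩ : Nonempty S := by
      by_contra hcon
      rw [not_nonempty_iff] at hcon
      simp at hf1
    exact (hUB 0 s).1.trans (hUB 0 s).2
  nlinarith

/-- Solving the self-bounding inequality produced by the law of total variance. -/
theorem wsum_le_of_bernstein (hw : ∀ h s a, 0 ≤ w h s a) {B α γ : ℝ} (hB : 0 ≤ B) (hα : 0 ≤ α)
    {e v c : Fin H → S → A → ℝ} (he0 : ∀ h s a, 0 ≤ e h s a) (hv : ∀ h s a, 0 ≤ v h s a)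
    (hc : ∀ h s a, 0 ≤ c h s a)
    (he : ∀ h s a, w h s a ≠ 0 → e h s a ≤ α * √(v h s a * c h s a) + γ * c h s a)
    (hV : wsum w v ≤ 5 * B ^ 2 + 2 * B * wsum w e) :
    wsum w e ≤ 6 * α * B * √(wsum w c) + 2 * (α ^ 2 * B + γ) * wsum w c := by
  set X := wsum w e with hX
  set b := wsum w c with hb
  have hX0 : 0 ≤ X := wsum_nonneg hw he0
  have hb0 : 0 ≤ b := wsum_nonneg hw hc
  have h1 : X ≤ α * (√(wsum w v) * √b) + γ * b := by
    have := wsum_mono hw he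
    rw [wsum_add, wsum_const_mul, wsum_const_mul] at this
    refine this.trans (add_le_add (mul_le_mul_of_nonneg_left (wsum_sqrt_le hw hv hc) hα) le_rfl)
  have h2 : √(wsum w v) ≤ 3 * B + √(2 * B * X) := by
    refine (Real.sqrt_le_sqrt hV).trans (Real.sqrt_le_iff.2 ⟨by positivity, ?_⟩)
    have : √(2 * B * X) ^ 2 = 2 * B * X := Real.sq_sqrt (by positivity)
    nlinarith [mul_nonneg hB (Real.sqrt_nonneg (2 * B * X)), sq_nonneg B]
  -- Arithmetic-geometric mean: half of the unknown X is moved to the left-hand side, which doubles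
  -- the remaining constants.
  have h3 : α * (√(2 * B * X) * √b) ≤ X / 2 + α ^ 2 * B * b := by
    rw [← Real.sqrt_mul (by positivity)]
    have h4 : α * √(2 * B * X * b) = √(X * (2 * α ^ 2 * B * b)) := by
      rw [show X * (2 * α ^ 2 * B * b) = α ^ 2 * (2 * B * X * b) by ring,
        Real.sqrt_mul (sq_nonneg α), Real.sqrt_sq hα]
    rw [h4]
    refine Real.sqrt_le_iff.2 ⟨by positivity, ?_⟩
    nlinarith [sq_nonneg (X / 2 - α ^ 2 * B * b)]
  have h5 : α * (√(wsum w v) * √b) ≤ α * ((3 * B + √(2 * B * X)) * √b) := by gcongr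
  nlinarith

end Occupancy

/-! ### The empirical model -/

section Empirical

variable {S A : Type*} [Fintype S] [Fintype A] {H n : ℕ} {D : Fin n → Episode S A H} {h : Fin H}
  {s : S} {a : A}

theorem Phat_nonneg (s' : S) : 0 ≤ Phat D h s a s' := by
  rw [Phat]; split_ifs <;> positivity

theorem sum_Phat_mul (hc : count D h s a ≠ 0) (V : S → ℝ) : ∑ s', Phat D h s a s' * V s'
    = (∑ τ ∈ visits D h s a, V ((D τ).next h)) / count D h s a := by
  classical
  simp only [Phat, if_neg hc, div_mul_eq_mul_div]
  rw [← Finset.sum_div]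
  congr 1
  rw [← Finset.sum_fiberwise (visits D h s a) (fun τ => (D τ).next h)]
  refine Finset.sum_congr rfl fun s' _ => ?_
  rw [Finset.sum_congr rfl (g := fun _ => V s') fun τ hτ => by rw [(Finset.mem_filter.1 hτ).2],
    Finset.sum_const, nsmul_eq_mul]

theorem sum_Phat [Nonempty S] : ∑ s', Phat D h s a s' = 1 := by
  by_cases hc : count D h s a = 0
  · simp [Phat, if_pos hc]
  · have h1 := sum_Phat_mul hc fun _ => 1
    simp only [mul_one, Finset.sum_const, nsmul_eq_mul] at h1
    rw [h1]
    exact div_self (by exact_mod_cast hc)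

theorem exists_of_Phat_ne_zero (hc : count D h s a ≠ 0) {s' : S} (hP : Phat D h s a s' ≠ 0) :
    ∃ τ ∈ visits D h s a, (D τ).next h = s' := by
  classical
  by_contra hcon
  push Not at hcon
  refine hP ?_
  rw [Phat, if_neg hc, Finset.filter_eq_empty_iff.2 fun τ hτ => hcon τ hτ]
  simp

theorem sum_visits_target (hr : ∀ τ h, (D τ).reward h ∈ Set.Icc (0 : ℝ) 1) (V : S → ℝ) :
    ∑ τ ∈ visits D h s a, target D h V τ
      = ∑ τ ∈ visits D h s a, (D τ).reward h + ∑ τ ∈ visits D h s a, V ((D τ).next h) := by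
  rw [← Finset.sum_add_distrib]
  exact Finset.sum_congr rfl fun τ _ => by rw [target, clip01_of_mem (hr τ h)]

theorem Qhat_eq_finMean (hr : ∀ τ h, (D τ).reward h ∈ Set.Icc (0 : ℝ) 1)
    (hc : count D h s a ≠ 0) (V : S → ℝ) :
    Qhat D h V s a = finMean (visits D h s a) (target D h V) := by
  rw [Qhat, rhat, if_neg hc, sum_Phat_mul hc, finMean, sum_visits_target hr, add_div]
  rfl

theorem varHat_eq (hr : ∀ τ h, (D τ).reward h ∈ Set.Icc (0 : ℝ) 1)
    (hc : count D h s a ≠ 0) (V : S → ℝ) : varHat D h V s a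
      = devNorm (visits D h s a) (target D h V) ^ 2 / count D h s a := by
  rw [varHat, devNorm_sq, Qhat_eq_finMean hr hc]
  congr 1
  exact Finset.sum_congr rfl fun τ _ => by rw [target, clip01_of_mem (hr τ h)]

theorem varHat_nonneg (V : S → ℝ) : 0 ≤ varHat D h V s a :=
  div_nonneg (Finset.sum_nonneg fun _ _ => sq_nonneg _) (Nat.cast_nonneg _)

/-- The reward adds at most 2rV + r² ≤ 3H to the second moment and only increases the mean, so the
variance of r + V exceeds that of V by at most 3H. Only the latter is seen by the total variance
argument. -/
theorem varHat_le (hr : ∀ τ h, (D τ).reward h ∈ Set.Icc (0 : ℝ) 1)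
    (hc : count D h s a ≠ 0) {V : S → ℝ} (hV : ∀ s, V s ∈ Set.Icc (0 : ℝ) H) :
    varHat D h V s a ≤ (∑ s', Phat D h s a s' * V s' ^ 2 - (∑ s', Phat D h s a s' * V s') ^ 2)
      + 3 * H := by
  have hc0 : (0 : ℝ) < count D h s a := by exact_mod_cast Nat.pos_of_ne_zero hc
  have hH : (1 : ℝ) ≤ H := by
    have := h.2
    exact_mod_cast (by omega : 1 ≤ H)
  have h1 := sum_sub_sq (I := visits D h s a) (target D h V) 0
  rw [← devNorm_sq] at h1
  have h2 : ∑ τ ∈ visits D h s a, (target D h V τ - 0) ^ 2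
      ≤ ∑ τ ∈ visits D h s a, V ((D τ).next h) ^ 2 + count D h s a * (3 * H) := by
    rw [count, ← nsmul_eq_mul, ← Finset.sum_const, ← Finset.sum_add_distrib]
    refine Finset.sum_le_sum fun τ _ => ?_
    have := clip01_mem ((D τ).reward h)
    have h3 := hV ((D τ).next h)
    rw [target]
    nlinarith [this.1, this.2, h3.1, h3.2]
  rw [varHat_eq hr hc, sum_Phat_mul hc (fun s' => V s' ^ 2), sum_Phat_mul hc]
  have h4 : (∑ τ ∈ visits D h s a, V ((D τ).next h)) / count D h s a
      ≤ finMean (visits D h s a) (target D h V) := by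
    rw [finMean, count]
    gcongr with τ hτ
    rw [target]
    linarith [(clip01_mem ((D τ).reward h)).1]
  have h5 : 0 ≤ (∑ τ ∈ visits D h s a, V ((D τ).next h)) / count D h s a :=
    div_nonneg (Finset.sum_nonneg fun τ _ => (hV _).1) hc0.le
  have h6 : ((∑ τ ∈ visits D h s a, V ((D τ).next h)) / count D h s a) ^ 2
      ≤ finMean (visits D h s a) (target D h V) ^ 2 := by gcongr
  have h7 : devNorm (visits D h s a) (target D h V) ^ 2 / count D h s a
      ≤ (∑ τ ∈ visits D h s a, V ((D τ).next h) ^ 2 + count D h s a * (3 * H)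
        - count D h s a * finMean (visits D h s a) (target D h V) ^ 2) / count D h s a := by
    gcongr
    rw [count] at h2 ⊢
    simp only [sub_zero] at h1 h2
    nlinarith
  refine h7.trans ?_
  rw [sub_div, add_div, mul_div_cancel_left₀ _ hc0.ne', mul_div_cancel_left₀ _ hc0.ne']
  linarith

theorem sqrt_varHat_mul (hr : ∀ τ h, (D τ).reward h ∈ Set.Icc (0 : ℝ) 1)
    (hc : count D h s a ≠ 0) (V : S → ℝ) {L : ℝ} (hL : 0 ≤ L) :
    √(varHat D h V s a * L / count D h s a)
      = √L * devNorm (visits D h s a) (target D h V) / count D h s a := by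
  have hc0 : (0 : ℝ) < count D h s a := by exact_mod_cast Nat.pos_of_ne_zero hc
  rw [varHat_eq hr hc, Real.sqrt_eq_iff_mul_self_eq (by positivity) (by
    have := devNorm_nonneg (I := visits D h s a) (target D h V)
    positivity)]
  have := Real.mul_self_sqrt hL
  field_simp
  rw [Real.sq_sqrt hL]

/-- The pessimistic estimate at a visited pair is a penalized mean. -/
theorem Qhat_sub_penalty {δ C : ℝ} (hr : ∀ τ h, (D τ).reward h ∈ Set.Icc (0 : ℝ) 1)
    (hι : 0 ≤ iota S A H δ) {κ : ℝ} (hκ : 0 < κ) (hc : κ ≤ count D h s a) (V : S → ℝ) :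
    Qhat D h V s a - penalty D δ C h V s a
      = penalizedMean H (iota S A H δ) κ (visits D h s a) (target D h V) := by
  have hc0 : (0 : ℝ) < count D h s a := hκ.trans_le hc
  have hc1 : count D h s a ≠ 0 := by
    intro h0; rw [h0] at hc0; simp at hc0
  rw [penalty, if_pos (Nat.one_le_iff_ne_zero.2 hc1), sqrt_varHat_mul hr hc1 V hι,
    Qhat_eq_finMean hr hc1, penalizedMean, finMean]
  have : max ((visits D h s a).card : ℝ) κ = count D h s a := max_eq_left hc
  rw [this, count]
  ring

/-- Under the regularity of the data the pessimistic update agrees with its stable version. -/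
theorem Qbar_eq_stableQ [Nonempty S] {δ C : ℝ} (hr : ∀ τ h, (D τ).reward h ∈ Set.Icc (0 : ℝ) 1)
    (hι : 0 ≤ iota S A H δ) {κ : ℝ} (hκ : 0 < κ) {g : Fin H → S → A → Prop}
    (hg : ∀ h s a, g h s a → κ ≤ count D h s a) (hng : ∀ h s a, ¬ g h s a → count D h s a = 0)
    (hC : (H : ℝ) ≤ C * H * iota S A H δ) {V : S → ℝ} (hV : ∀ s, V s ≤ H) :
    Qbar D δ C h V s a = stableQ g (iota S A H δ) κ D h V s a := by
  rw [Qbar, stableQ]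
  split_ifs with h1
  · rw [Qhat_sub_penalty hr hι hκ (hg h s a h1)]
  -- At an unvisited pair the estimate is the uniform average of V, at most H, and the penalty is at
  -- least H. The truncation therefore returns 0, which is the value prescribed by `stableQ`.
  · have h0 := hng h s a h1
    rw [Qhat, rhat, if_pos h0, penalty, if_neg (by omega)]
    have h2 := sum_mul_le_of_sum_eq_one (fun s' => Phat_nonneg (D := D) (h := h) (s := s) (a := a) s')
      sum_Phat hV
    exact max_eq_right ((min_le_left _ _).trans (by linarith))

/-- The value computed by the algorithm agrees with its stable version, and the output policy is
greedy for it. -/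
theorem IsAPVIOutput.stableV_eq [Nonempty S] [Nonempty A] {δ C : ℝ} {πhat : Policy S A H}
    (hout : IsAPVIOutput D δ C πhat)
    (hr : ∀ τ h, (D τ).reward h ∈ Set.Icc (0 : ℝ) 1)
    (hι : 0 ≤ iota S A H δ) {κ : ℝ} (hκ : 0 < κ) {g : Fin H → S → A → Prop}
    (hg : ∀ h s a, g h s a → κ ≤ count D h s a) (hng : ∀ h s a, ¬ g h s a → count D h s a = 0)
    (hC : (H : ℝ) ≤ C * H * iota S A H δ) (h : Fin H) (s : S) :
    stableV g (iota S A H δ) κ D h.castSucc s = ∑ a, πhat.prob h s a *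
      stableQ g (iota S A H δ) κ D h (stableV g (iota S A H δ) κ D h.succ) s a := by
  classical
  obtain ⟨V, hV0, hV⟩ := hout
  have hle : ∀ (k : Fin (H + 1)) s, stableV g (iota S A H δ) κ D k s ≤ H := fun k s =>
    (stableV_mem k s).2.trans (by linarith [(Nat.cast_nonneg (k : ℕ) : (0 : ℝ) ≤ (k : ℕ))])
  have step : ∀ h : Fin H, V h.succ = stableV g (iota S A H δ) κ D h.succ →
      ∀ s, V h.castSucc s = stableV g (iota S A H δ) κ D h.castSucc s ∧
        V h.castSucc s = ∑ a, πhat.prob h s a *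
          stableQ g (iota S A H δ) κ D h (stableV g (iota S A H δ) κ D h.succ) s a := by
    intro h ih s
    obtain ⟨h1, h2⟩ := hV h s
    simp only [ih, Qbar_eq_stableQ hr hι hκ hg hng hC (hle h.succ)] at h1 h2
    have h3 : V h.castSucc s = ∑ a, πhat.prob h s a *
          stableQ g (iota S A H δ) κ D h (stableV g (iota S A H δ) κ D h.succ) s a := by
      rw [h2]
      exact Finset.sum_congr rfl fun a _ => mul_comm _ _
    refine ⟨le_antisymm ?_ ?_, h3⟩
    · rw [h3, stableV_castSucc]
      exact sum_mul_le_of_sum_eq_one (πhat.prob_nonneg h s) (πhat.prob_sum h s)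
        fun a => le_ciSup (Set.finite_range _).bddAbove a
    · rw [h2, stableV_castSucc]
      refine ciSup_le fun a => ?_
      -- Comparison with the point mass at `a` shows that the maximum over distributions is the
      -- maximum over actions, whatever the tie-breaking.
      have := h1 (fun b => if b = a then 1 else 0) (fun b => by positivity) (by simp)
      simpa using this
  have hall : ∀ k, V k = stableV g (iota S A H δ) κ D k := by
    intro k
    induction k using Fin.reverseInduction with
    | last => rw [stableV_last]; funext s; exact hV0 s
    | cast h ih => funext s; exact (step h ih s).1
  obtain ⟨h1, h2⟩ := step h (hall _) s
  rw [← h1, h2]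

end Empirical

/-! ### The estimation error along the optimal policy -/

section Transfer

variable {S A : Type*} [Fintype S] [Fintype A] {H : ℕ} {f : S → ℝ} {p : Fin H → S → A → ℝ}
  {P P' : Fin H → S → A → S → ℝ} {w : Fin H → S → A → ℝ}

theorem wsum_one (hf1 : ∑ s, f s = 1) (hp : ∀ h s, ∑ a, p h s a = 1)
    (hP : ∀ h s a, ∑ s', P h s a s' = 1)
    (hwd : w = fun h s a => stateDist f p P h.castSucc s * p h s a) :
    wsum w (fun _ _ _ => 1) = H := by
  simp only [wsum, hwd, mul_one, ← Finset.mul_sum, hp, sum_stateDist hp hP, hf1]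
  simp

/-- Additive costs of a deterministic policy under a kernel `P'` that is comparable to `P`. -/
theorem wsum_le_of_multiplicative (hf : ∀ s, 0 ≤ f s) (hp0 : ∀ h s a, 0 ≤ p h s a)
    (hp : ∀ h s, ∑ a, p h s a = 1) (hdet : ∀ h s, ∃ a, p h s a = 1)
    (hP0 : ∀ h s a s', 0 ≤ P h s a s') (hP : ∀ h s a, ∑ s', P h s a s' = 1)
    (hP0' : ∀ h s a s', 0 ≤ P' h s a s')
    (hwd : w = fun h s a => stateDist f p P' h.castSucc s * p h s a)
    {g : Fin H → S → A → ℝ} {R : ℝ} (hg : ∀ h s a, g h s a ∈ Set.Icc 0 R)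
    (hmul : ∀ h s a, w h s a ≠ 0 → ∑ s', P' h s a s' * backValue p P g h.succ s'
      ≤ (1 + 1 / (H : ℝ)) * ∑ s', P h s a s' * backValue p P g h.succ s' + g h s a / 4) :
    wsum w g ≤ 4 * ∑ s, f s * backValue p P g 0 s := by
  set W := backValue p P g with hW
  set q : ℝ := (1 + 1 / (H : ℝ))⁻¹ with hq
  have hq1 : 0 < 1 + 1 / (H : ℝ) := by positivity
  have hq0 : 0 < q := inv_pos.2 hq1
  have hq2 : q ≤ 1 := inv_le_one_of_one_le₀ (by
    have : 0 ≤ 1 / (H : ℝ) := by positivity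
    linarith)
  have hw : ∀ h s a, 0 ≤ w h s a := fun h s a => by
    rw [hwd]; exact mul_nonneg (stateDist_nonneg hf hp0 hP0' _ _) (hp0 _ _ _)
  have hflow := sum_init_eq (f := f) (P := P') hp (fun h s => q ^ (h : ℕ) * W h s)
    (fun s => by rw [hW, backValue_last, mul_zero])
  have h0 : ∑ s, f s * (q ^ ((0 : Fin (H + 1)) : ℕ) * W 0 s) = ∑ s, f s * W 0 s := by simp
  rw [h0] at hflow
  rw [hflow]
  -- One step of the discounted potential decreases by at least q^h(g − g/4) ≥ g/4, so telescoping
  -- under `P'` bounds the accumulated cost by four times the initial potential.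
  have hmono : wsum w (fun h s a => 1 / 4 * g h s a)
      ≤ wsum w (fun h s a => q ^ ((h.castSucc : Fin (H + 1)) : ℕ) * W h.castSucc s
        - ∑ s', P' h s a s' * (q ^ ((h.succ : Fin (H + 1)) : ℕ) * W h.succ s')) := by
    refine wsum_mono hw fun h s a hne => ?_
    have hpa : p h s a ≠ 0 := by
      intro h1; rw [hwd] at hne; simp [h1] at hne
    have hH : 1 ≤ H := by have := h.2; omega
    have h1 : W h.castSucc s = g h s a + ∑ s', P h s a s' * W h.succ s' :=
      backValue_castSucc_of_deterministic hp0 hp hdet hpa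
    have h2 := hmul h s a hne
    have h3 : ∑ s', P' h s a s' * (q ^ ((h.succ : Fin (H + 1)) : ℕ) * W h.succ s')
        = q ^ (h : ℕ) * q * ∑ s', P' h s a s' * W h.succ s' := by
      rw [Finset.mul_sum]
      refine Finset.sum_congr rfl fun s' _ => ?_
      rw [Fin.val_succ, pow_succ]; ring
    have h4 : 1 / 3 ≤ q ^ (h : ℕ) := by
      rw [hq, inv_pow, one_div]
      exact inv_anti₀ (by positivity) (one_add_inv_pow_le hH _ h.2.le)
    have h5 : 0 ≤ ∑ s', P h s a s' * W h.succ s' :=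
      Finset.sum_nonneg fun s' _ => mul_nonneg (hP0 _ _ _ _) (backValue_mem hp0 hp hP0 hP hg _ _).1
    have h6 : q * ((1 + 1 / (H : ℝ)) * ∑ s', P h s a s' * W h.succ s')
        = ∑ s', P h s a s' * W h.succ s' := by
      rw [← mul_assoc, hq, inv_mul_cancel₀ hq1.ne', one_mul]
    have h7 := (hg h s a).1
    rw [h3, h1, Fin.val_castSucc]
    have h8 : q * ∑ s', P' h s a s' * W h.succ s'
        ≤ ∑ s', P h s a s' * W h.succ s' + g h s a / 4 := by
      calc _ ≤ q * ((1 + 1 / (H : ℝ)) * ∑ s', P h s a s' * W h.succ s' + g h s a / 4) := by gcongr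
        _ = ∑ s', P h s a s' * W h.succ s' + q * (g h s a / 4) := by rw [mul_add, h6]
        _ ≤ _ := by nlinarith
    have h9 : q ^ (h : ℕ) * (q * ∑ s', P' h s a s' * W h.succ s')
        ≤ q ^ (h : ℕ) * (∑ s', P h s a s' * W h.succ s' + g h s a / 4) := by gcongr
    nlinarith
  rw [wsum_const_mul] at hmono
  have : wsum w (fun h s a => q ^ ((h.castSucc : Fin (H + 1)) : ℕ) * W h.castSucc s
        - ∑ s', P' h s a s' * (q ^ ((h.succ : Fin (H + 1)) : ℕ) * W h.succ s'))
      = ∑ h : Fin H, ∑ s, ∑ a, stateDist f p P' h.castSucc s * p h s a *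
        (q ^ ((h.castSucc : Fin (H + 1)) : ℕ) * W h.castSucc s
        - ∑ s', P' h s a s' * (q ^ ((h.succ : Fin (H + 1)) : ℕ) * W h.succ s')) := by
    rw [wsum, hwd]
  rw [this] at hmono
  linarith

end Transfer

/-! ### Regular data and inverse counts along the optimal policy. -/

section Model

variable {S A : Type*} [Fintype S] [Fintype A] {H n : ℕ}

/-- The expected inverse of the number of visits under the behaviour policy. -/
noncomputable def invCount (M : MDP S A H) (μ : Policy S A H) (n : ℕ) (h : Fin H) (s : S) (a : A) :
    ℝ := ((n : ℝ) * occ M μ h s a)⁻¹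

/-- A deterministic policy contributes one action per state, so only H·S terms remain and each is at
most c/n. This is why S, and not SA, enters the leading term. -/
theorem wsum_occ_invCount_le {M : MDP S A H} {μ π : Policy S A H} (hdet : π.IsDeterministic)
    {c : ℝ} (hc : 0 ≤ c) (hle : ∀ h s a, occ M π h s a ≤ c * occ M μ h s a) :
    wsum (occ M π) (invCount M μ n) ≤ H * Fintype.card S * c / n := by
  have h1 : ∀ (h : Fin H) (s : S), ∑ a, occ M π h s a * invCount M μ n h s a ≤ c / n := by
    intro h s
    obtain ⟨a, ha⟩ := hdet h s
    have h2 := (eq_one_of_ne_zero π.prob_nonneg π.prob_sum hdet (h := h) (s := s) (a := a)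
      (by rw [ha]; norm_num)).2
    rw [Finset.sum_eq_single a (fun b _ hb => by rw [occ, h2 b hb]; simp) (by simp)]
    rcases (occ_nonneg M μ h s a).eq_or_lt with h3 | h3
    · simp only [invCount, ← h3, mul_zero, inv_zero]; positivity
    · rw [invCount, mul_inv]
      calc occ M π h s a * ((n : ℝ)⁻¹ * (occ M μ h s a)⁻¹)
          ≤ c * occ M μ h s a * ((n : ℝ)⁻¹ * (occ M μ h s a)⁻¹) := by
            gcongr; exact hle h s a
        _ = c / n := by field_simp
  calc wsum (occ M π) (invCount M μ n) ≤ ∑ _h : Fin H, ∑ _s : S, c / n :=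
        Finset.sum_le_sum fun h _ => Finset.sum_le_sum fun s _ => h1 h s
    _ = H * Fintype.card S * c / n := by simp; ring

/-- The properties of the data that do not involve value functions. -/
structure RegularData (M : MDP S A H) (μ : Policy S A H) (D : Fin n → Episode S A H) : Prop where
  reward_mem : ∀ τ h, (D τ).reward h ∈ Set.Icc (0 : ℝ) 1
  transition_pos : ∀ τ h, 0 < occ M μ h ((D τ).state h) ((D τ).action h) ∧
    0 < M.P h ((D τ).state h) ((D τ).action h) ((D τ).next h)
  count_ge : ∀ h s a, 0 < occ M μ h s a → (n : ℝ) * occ M μ h s a / 2 ≤ count D h s a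

variable {M : MDP S A H} {μ π : Policy S A H} {D : Fin n → Episode S A H}

theorem RegularData.count_eq_zero (hD : RegularData M μ D) {h : Fin H} {s : S} {a : A}
    (h0 : ¬ 0 < occ M μ h s a) : count D h s a = 0 := by
  rw [count, Finset.card_eq_zero, Finset.eq_empty_iff_forall_notMem]
  intro τ hτ
  obtain ⟨h1, h2⟩ := mem_visits.1 hτ
  have := (hD.transition_pos τ h).1
  rw [h1, h2] at this
  exact h0 this

theorem RegularData.count_ne_zero (hD : RegularData M μ D) (hn : 0 < n) {h : Fin H} {s : S} {a : A}
    (h0 : 0 < occ M μ h s a) : count D h s a ≠ 0 := by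
  intro h1
  have h2 := hD.count_ge h s a h0
  have : 0 < (n : ℝ) * occ M μ h s a := mul_pos (by exact_mod_cast hn) h0
  rw [h1] at h2
  push_cast at h2
  linarith

theorem RegularData.inv_count_le (hD : RegularData M μ D) (hn : 0 < n) {h : Fin H} {s : S} {a : A}
    (h0 : 0 < occ M μ h s a) : (count D h s a : ℝ)⁻¹ ≤ 2 * invCount M μ n h s a := by
  have h2 := hD.count_ge h s a h0
  have : 0 < (n : ℝ) * occ M μ h s a := mul_pos (by exact_mod_cast hn) h0
  rw [invCount]
  calc (count D h s a : ℝ)⁻¹ ≤ ((n : ℝ) * occ M μ h s a / 2)⁻¹ := inv_anti₀ (by positivity) h2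
    _ = _ := by rw [inv_div]; ring

/-- The states reached in the empirical model under a policy covered by the data are also reached in
the true model. -/
theorem RegularData.stateDist_pos (hD : RegularData M μ D) (hn : 0 < n)
    (hsupp : ∀ h s a, 0 < occ M π h s a → 0 < occ M μ h s a) (k : Fin (H + 1)) (s : S)
    (hs : stateDist M.init π.prob (Phat D) k s ≠ 0) :
    0 < stateDist M.init π.prob M.P k s := by
  induction k using Fin.induction generalizing s with
  | zero => exact (M.init_nonneg s).lt_of_ne' hs
  | succ h ih =>
    rw [stateDist_succ] at hs
    obtain ⟨x, -, hx⟩ := Finset.exists_ne_zero_of_sum_ne_zero hs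
    obtain ⟨b, -, hb⟩ := Finset.exists_ne_zero_of_sum_ne_zero hx
    have h1 := ih x (left_ne_zero_of_mul hb)
    have h2 := (π.prob_nonneg h x b).lt_of_ne' (left_ne_zero_of_mul (right_ne_zero_of_mul hb))
    have h3 := right_ne_zero_of_mul (right_ne_zero_of_mul hb)
    have h4 := hsupp h x b (mul_pos h1 h2)
    obtain ⟨τ, hτ, hnext⟩ := exists_of_Phat_ne_zero (hD.count_ne_zero hn h4) h3
    obtain ⟨h5, h6⟩ := mem_visits.1 hτ
    have h7 := (hD.transition_pos τ h).2
    rw [h5, h6, hnext] at h7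
    rw [stateDist_succ]
    have hnn : ∀ x b, 0 ≤ stateDist M.init π.prob M.P h.castSucc x * (π.prob h x b * M.P h x b s) :=
      fun x b => mul_nonneg (stateDist_nonneg M.init_nonneg π.prob_nonneg M.P_nonneg _ _)
        (mul_nonneg (π.prob_nonneg _ _ _) (M.P_nonneg _ _ _ _))
    calc 0 < stateDist M.init π.prob M.P h.castSucc x * (π.prob h x b * M.P h x b s) :=
          mul_pos h1 (mul_pos h2 h7)
      _ ≤ ∑ b, stateDist M.init π.prob M.P h.castSucc x * (π.prob h x b * M.P h x b s) :=
          Finset.single_le_sum (fun b _ => hnn x b) (Finset.mem_univ b)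
      _ ≤ _ := Finset.single_le_sum
          (f := fun x => ∑ b, stateDist M.init π.prob M.P h.castSucc x *
            (π.prob h x b * M.P h x b s))
          (fun x _ => Finset.sum_nonneg fun b _ => hnn x b) (Finset.mem_univ x)

/-- The occupancy of `π` in the empirical model. -/
noncomputable def empOcc (M : MDP S A H) (π : Policy S A H) (D : Fin n → Episode S A H) (h : Fin H)
    (s : S) (a : A) : ℝ := stateDist M.init π.prob (Phat D) h.castSucc s * π.prob h s a

theorem empOcc_nonneg (h : Fin H) (s : S) (a : A) : 0 ≤ empOcc M π D h s a :=
  mul_nonneg (stateDist_nonneg M.init_nonneg π.prob_nonneg (fun _ _ _ => Phat_nonneg) _ _)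
    (π.prob_nonneg _ _ _)

theorem RegularData.occ_pos (hD : RegularData M μ D) (hn : 0 < n)
    (hsupp : ∀ h s a, 0 < occ M π h s a → 0 < occ M μ h s a) {h : Fin H} {s : S} {a : A}
    (hw : empOcc M π D h s a ≠ 0) : 0 < occ M μ h s a :=
  hsupp h s a (mul_pos (hD.stateDist_pos hn hsupp _ _ (left_ne_zero_of_mul hw))
    ((π.prob_nonneg _ _ _).lt_of_ne' (right_ne_zero_of_mul hw)))

/-- The expected inverse counts along a covered deterministic policy. -/
theorem RegularData.wsum_inv_count_le (hD : RegularData M μ D) (hn : 0 < n)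
    (hdet : π.IsDeterministic) (hsupp : ∀ h s a, 0 < occ M π h s a → 0 < occ M μ h s a)
    {c : ℝ} (hc : 0 ≤ c) (hle : ∀ h s a, occ M π h s a ≤ c * occ M μ h s a)
    {N u : ℝ} (hN : 0 < N) (hNle : ∀ h s a, 0 < occ M μ h s a → N ≤ n * occ M μ h s a)
    (hNu : 8 * (H : ℝ) ^ 2 * u ≤ N)
    (hC : ∀ h s a, 0 < occ M μ h s a → ∑ τ ∈ visits D h s a,
        backValue π.prob M.P (invCount M μ n) h.succ ((D τ).next h)
      ≤ count D h s a * ((1 + 1 / (H : ℝ)) *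
        ∑ s', M.P h s a s' * backValue π.prob M.P (invCount M μ n) h.succ s')
        + H * (H / N) * u) [Nonempty S] :
    wsum (empOcc M π D) (fun h s a => (count D h s a : ℝ)⁻¹) ≤ 8 * (H * Fintype.card S * c / n) := by
  have hn0 : (0 : ℝ) < n := by exact_mod_cast hn
  have hg : ∀ h s a, invCount M μ n h s a ∈ Set.Icc 0 (N⁻¹) := fun h s a => by
    rcases (occ_nonneg M μ h s a).eq_or_lt with h0 | h0
    · rw [invCount, ← h0]; simp [hN.le]
    · exact ⟨inv_nonneg.2 (mul_pos hn0 h0).le, inv_anti₀ hN (hNle h s a h0)⟩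
  have h1 : wsum (empOcc M π D) (fun h s a => (count D h s a : ℝ)⁻¹)
      ≤ 2 * wsum (empOcc M π D) (invCount M μ n) := by
    rw [← wsum_const_mul]
    exact wsum_mono empOcc_nonneg fun h s a hw => hD.inv_count_le hn (hD.occ_pos hn hsupp hw)
  have h2 := wsum_le_of_multiplicative (f := M.init) (P := M.P) (P' := Phat D)
    (w := empOcc M π D) M.init_nonneg π.prob_nonneg π.prob_sum hdet M.P_nonneg M.P_sum
    (fun _ _ _ => Phat_nonneg) rfl hg fun h s a hw => by
      have h0 := hD.occ_pos hn hsupp hw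
      have hc1 := hD.count_ne_zero hn h0
      have hc0 : (0 : ℝ) < count D h s a := by exact_mod_cast Nat.pos_of_ne_zero hc1
      rw [sum_Phat_mul hc1, div_le_iff₀ hc0]
      refine (hC h s a h0).trans ?_
      -- The additive Chernoff error is at most 1/8 because 8H²u ≤ N, and half the expected count
      -- times a quarter of its inverse is exactly 1/8. The error is thus absorbed by a quarter of
      -- the cost.
      have h3 : H * (H / N) * u ≤ invCount M μ n h s a / 4 * count D h s a := by
        have h4 := hD.count_ge h s a h0
        have h5 : 0 < (n : ℝ) * occ M μ h s a := mul_pos hn0 h0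
        calc H * (H / N) * u ≤ 1 / 8 := by
              rw [show H * (H / N) * u = (H ^ 2 * u) / N by ring, div_le_iff₀ hN]; linarith
          _ ≤ _ := by
              rw [invCount, ← one_div, div_div, div_mul_eq_mul_div, one_mul,
                le_div_iff₀ (by positivity)]
              linarith
      linarith
  have h3 := sum_init_backValue (f := M.init) (P := M.P) (ρ := invCount M μ n) π.prob_sum
  have h4 := wsum_occ_invCount_le (n := n) (M := M) (μ := μ) hdet hc hle
  have h5 : ∑ s, M.init s * backValue π.prob M.P (invCount M μ n) 0 s
      = wsum (occ M π) (invCount M μ n) := by rw [h3]; rfl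
  rw [h5] at h2
  linarith

end Model

/-! ### Comparison of the optimal value with the pessimistic value. -/

section OptimalPolicy

variable {S A : Type*} [Fintype S] [Fintype A] {H n : ℕ}
variable {M : MDP S A H} {μ π : Policy S A H} {D : Fin n → Episode S A H}

/-- A self-bounding error estimate in the empirical model. -/
theorem RegularData.wsum_le_of_varHat [Nonempty S] (hD : RegularData M μ D) (hn : 0 < n)
    (hsupp : ∀ h s a, 0 < occ M π h s a → 0 < occ M μ h s a)
    {U : Fin (H + 1) → S → ℝ} (hU0 : ∀ s, U (Fin.last H) s = 0)
    (hU : ∀ h s, U h s ∈ Set.Icc (0 : ℝ) H) {e : Fin H → S → A → ℝ} (he0 : ∀ h s a, 0 ≤ e h s a)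
    {α γ : ℝ} (hα : 0 ≤ α)
    (he : ∀ h s a, empOcc M π D h s a ≠ 0 →
      e h s a ≤ α * √(varHat D h (U h.succ) s a * (count D h s a : ℝ)⁻¹)
        + γ * (count D h s a : ℝ)⁻¹)
    (hUe : ∀ h s a, empOcc M π D h s a ≠ 0 →
      0 ≤ U h.castSucc s - ∑ s', Phat D h s a s' * U h.succ s' + e h s a) :
    wsum (empOcc M π D) e
      ≤ 6 * α * H * √(wsum (empOcc M π D) fun h s a => (count D h s a : ℝ)⁻¹)
        + 2 * (α ^ 2 * H + γ) * wsum (empOcc M π D) fun h s a => (count D h s a : ℝ)⁻¹ := by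
  refine wsum_le_of_bernstein empOcc_nonneg (Nat.cast_nonneg H) hα he0
    (v := fun h s a => varHat D h (U h.succ) s a) (fun _ _ _ => varHat_nonneg _)
    (fun _ _ _ => by positivity) he ?_
  have h1 := wsum_variance_le (w := empOcc M π D) (f := M.init) (p := π.prob) (P := Phat D)
    M.init_nonneg M.init_sum π.prob_nonneg π.prob_sum (fun _ _ _ _ => Phat_nonneg _)
    (fun _ _ _ => sum_Phat) hU0 hU rfl hUe fun h s a _ => he0 h s a
  have h2 := wsum_mono (w := empOcc M π D) empOcc_nonneg fun h s a hw =>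
    varHat_le hD.reward_mem (hD.count_ne_zero hn (hD.occ_pos hn hsupp hw)) (hU h.succ)
  rw [wsum_add (w := empOcc M π D)] at h2
  -- The reward contribution 3H per step sums to 3H² over the horizon. With 2H² from the law of
  -- total variance this gives the 5H² that `wsum_le_of_bernstein` expects.
  have h3 := wsum_const_mul (w := empOcc M π D) (3 * (H : ℝ)) fun _ _ _ => 1
  rw [wsum_one (w := empOcc M π D) M.init_sum π.prob_sum (P := Phat D) (fun _ _ _ => sum_Phat)
    rfl] at h3
  simp only [mul_one] at h3
  rw [h3] at h2
  nlinarith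

/-- The value of `π`. -/
noncomputable def polValue (M : MDP S A H) (π : Policy S A H) : Fin (H + 1) → S → ℝ :=
  backValue π.prob M.P (meanReward M)

theorem polValue_mem (h : Fin (H + 1)) (s : S) :
    polValue M π h s ∈ Set.Icc (0 : ℝ) ((H : ℝ) - (h : ℕ)) := by
  have := backValue_mem π.prob_nonneg π.prob_sum M.P_nonneg M.P_sum (meanReward_mem M) h s
  rwa [mul_one] at this

variable [MeasurableSpace S] [DiscreteMeasurableSpace S] [MeasurableSpace A]
  [DiscreteMeasurableSpace A]

theorem value_eq_sum_init (M : MDP S A H) (π : Policy S A H) :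
    value M π = ∑ s, M.init s * polValue M π 0 s := by
  rw [polValue, sum_init_backValue π.prob_sum, value_eq_sum]
  rfl

/-- Comparison of the value of a covered deterministic policy with the pessimistic value. -/
theorem RegularData.value_sub_le [Nonempty S] [Nonempty A] (hD : RegularData M μ D) (hn : 0 < n)
    (hdet : π.IsDeterministic) (hsupp : ∀ h s a, 0 < occ M π h s a → 0 < occ M μ h s a)
    {L κ : ℝ} (hL : 0 ≤ L) (hκc : ∀ h s a, 0 < occ M μ h s a → κ ≤ count D h s a)
    (hB : ∀ h s a, 0 < occ M μ h s a →
      |∑ τ ∈ visits D h s a, (target D h (polValue M π h.succ) τ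
        - (meanReward M h s a + ∑ s', M.P h s a s' * polValue M π h.succ s'))|
      ≤ √(20 * L) * (devNorm (visits D h s a) (target D h (polValue M π h.succ))
        + 10 * H * √(10 * L)) + 3 * H * (10 * L))
    {b : ℝ} (hb : wsum (empOcc M π D) (fun h s a => (count D h s a : ℝ)⁻¹) ≤ b) :
    value M π - ∑ s, M.init s * stableV (fun h s a => 0 < occ M μ h s a) L κ D 0 s
      ≤ 42 * (H * √(L * b)) + 436 * (H * L * b) := by
  set g : Fin H → S → A → Prop := fun h s a => 0 < occ M μ h s a with hg
  set w := empOcc M π D with hw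
  set Vs := polValue M π with hVs
  set Vt := stableV g L κ D with hVt
  set c : Fin H → S → A → ℝ := fun h s a => (count D h s a : ℝ)⁻¹ with hc
  have hVs1 : ∀ h s, Vs h s ∈ Set.Icc (0 : ℝ) H := fun h s =>
    ⟨(polValue_mem h s).1, (polValue_mem h s).2.trans
      (by linarith [(Nat.cast_nonneg (h : ℕ) : (0 : ℝ) ≤ (h : ℕ))])⟩
  have hVt1 : ∀ h s, Vt h s ∈ Set.Icc (0 : ℝ) H := fun h s =>
    ⟨(stableV_mem h s).1, (stableV_mem h s).2.trans
      (by linarith [(Nat.cast_nonneg (h : ℕ) : (0 : ℝ) ≤ (h : ℕ))])⟩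
  have hVs0 : ∀ s, Vs (Fin.last H) s = 0 := backValue_last
  have hVt0 : ∀ s, Vt (Fin.last H) s = 0 := fun s => by rw [hVt, stableV_last]
  -- The estimation error is taken at the value function of `π`, which does not depend on the data.
  -- The data-dependent pessimistic value enters only through its own penalty `Γ`.
  set err : Fin H → S → A → ℝ := fun h s a => |finMean (visits D h s a) (target D h (Vs h.succ))
    - (meanReward M h s a + ∑ s', M.P h s a s' * Vs h.succ s')| with herr
  set Γ : Fin H → S → A → ℝ := fun h s a =>
    2 * √L * √(varHat D h (Vt h.succ) s a * c h s a) + 14 * H * L * c h s a with hΓ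
  have hc0 : ∀ h s a, 0 ≤ c h s a := fun h s a => by simp only [hc]; positivity
  have hpos : ∀ h s a, w h s a ≠ 0 → 0 < occ M μ h s a := fun h s a h1 =>
    hD.occ_pos hn hsupp h1
  have hcne : ∀ h s a, w h s a ≠ 0 → count D h s a ≠ 0 := fun h s a h1 =>
    hD.count_ne_zero hn (hpos h s a h1)
  have hπne : ∀ h s a, w h s a ≠ 0 → π.prob h s a ≠ 0 := fun h s a h1 =>
    right_ne_zero_of_mul h1
  have hr0 : ∀ h s a, 0 ≤ rhat D h s a := fun h s a => by
    rw [rhat]; split_ifs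
    · exact le_rfl
    · exact div_nonneg (Finset.sum_nonneg fun τ _ => (hD.reward_mem τ h).1) (by positivity)
  have hQ : ∀ h s a, w h s a ≠ 0 → ∀ V : S → ℝ, finMean (visits D h s a) (target D h V)
      = rhat D h s a + ∑ s', Phat D h s a s' * V s' := fun h s a h1 V => by
    rw [← Qhat_eq_finMean hD.reward_mem (hcne h s a h1)]; rfl
  have hVseq : ∀ h s a, w h s a ≠ 0 → Vs h.castSucc s
      = meanReward M h s a + ∑ s', M.P h s a s' * Vs h.succ s' := fun h s a h1 =>
    backValue_castSucc_of_deterministic π.prob_nonneg π.prob_sum hdet (hπne h s a h1)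
  have hVtge : ∀ h s a, w h s a ≠ 0 →
      rhat D h s a + ∑ s', Phat D h s a s' * Vt h.succ s' - Γ h s a ≤ Vt h.castSucc s := by
    intro h s a h1
    have h2 := hpos h s a h1
    have hcn := hcne h s a h1
    have hc1 : (0 : ℝ) < count D h s a := by exact_mod_cast Nat.pos_of_ne_zero hcn
    have h3 : stableQ g L κ D h (Vt h.succ) s a ≤ Vt h.castSucc s := by
      rw [hVt, stableV_castSucc]
      exact le_ciSup (f := fun a => stableQ g L κ D h (stableV g L κ D h.succ) s a)
        (Set.finite_range _).bddAbove a
    refine le_trans ?_ h3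
    rw [stableQ, if_pos h2, ← hQ h s a h1]
    refine le_max_of_le_left (le_min ?_ ?_)
    · rw [penalizedMean]
      have e1 : max ((visits D h s a).card : ℝ) κ = count D h s a := max_eq_left (hκc h s a h2)
      have e2 := sqrt_varHat_mul hD.reward_mem hcn (Vt h.succ) (zero_le_one)
      have e3 : √(varHat D h (Vt h.succ) s a * c h s a)
          = devNorm (visits D h s a) (target D h (Vt h.succ)) / count D h s a := by
        simpa [hc, div_eq_mul_inv] using e2
      rw [e1, hΓ]
      simp only []
      rw [e3, finMean, hc]
      simp only [count]
      apply le_of_eq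
      ring
    -- The cap H − h is inactive from this side: all targets, and hence their mean minus the
    -- penalty, lie below it.
    · have h4 : ∀ τ ∈ visits D h s a, target D h (Vt h.succ) τ ∈ Set.Icc (0 : ℝ) (H - (h : ℕ)) := by
        intro τ _
        have h5 := clip01_mem ((D τ).reward h)
        have h6 := stableV_mem (g := g) (L := L) (κ := κ) (D := D) h.succ ((D τ).next h)
        rw [Fin.val_succ] at h6
        push_cast at h6
        exact ⟨add_nonneg h5.1 h6.1, by rw [target]; linarith [h5.2, h6.2]⟩
      have h7 := (finMean_mem (by
        have := h.2.le
        have : ((h : ℕ) : ℝ) ≤ H := by exact_mod_cast this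
        linarith) h4).2
      have h8 : 0 ≤ Γ h s a := by
        have := hc0 h s a
        simp only [hΓ]; positivity
      linarith
  have herr1 : ∀ h s a, w h s a ≠ 0 → err h s a
      ≤ √(20 * L) * √(varHat D h (Vs h.succ) s a * c h s a) + 180 * H * L * c h s a := by
    intro h s a h1
    have h2 := hpos h s a h1
    have hcn := hcne h s a h1
    have hc1 : (0 : ℝ) < count D h s a := by exact_mod_cast Nat.pos_of_ne_zero hcn
    have e2 := sqrt_varHat_mul hD.reward_mem hcn (Vs h.succ) (zero_le_one)
    have e3 : √(varHat D h (Vs h.succ) s a * c h s a)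
        = devNorm (visits D h s a) (target D h (Vs h.succ)) / count D h s a := by
      simpa [hc, div_eq_mul_inv] using e2
    have h3 := hB h s a h2
    rw [Finset.sum_sub_distrib, Finset.sum_const, nsmul_eq_mul, ← card_mul_finMean, ← mul_sub,
      abs_mul, abs_of_nonneg (by positivity : (0 : ℝ) ≤ ((visits D h s a).card : ℝ))] at h3
    have h4 : √(20 * L) * (10 * H * √(10 * L)) ≤ 150 * H * L := by
      have h5 : √(20 * L) * √(10 * L) ≤ 15 * L := by
        rw [← Real.sqrt_mul (by positivity)]
        refine Real.sqrt_le_iff.2 ⟨by positivity, ?_⟩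
        nlinarith [sq_nonneg L]
      have hH : (0 : ℝ) ≤ H := by positivity
      nlinarith
    have h6 : count D h s a * err h s a
        ≤ √(20 * L) * devNorm (visits D h s a) (target D h (Vs h.succ)) + 180 * H * L := by
      refine h3.trans ?_
      nlinarith
    rw [e3]
    simp only [hc]
    calc err h s a ≤ (√(20 * L) * devNorm (visits D h s a) (target D h (Vs h.succ))
          + 180 * H * L) / count D h s a := by
          rw [le_div_iff₀ hc1]; linarith
      _ = _ := by ring
  -- The sign condition of the total variance argument holds because, at the pairs visited, V*_h −
  -- P̂V*_{h+1} + err is at least the empirical mean reward, which is nonnegative.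
  have hX1 := hD.wsum_le_of_varHat (π := π) hn hsupp hVs0 hVs1 (e := err)
    (fun _ _ _ => abs_nonneg _) (Real.sqrt_nonneg _) herr1 fun h s a h1 => by
      have h2 := hQ h s a h1 (Vs h.succ)
      have h3 := hVseq h s a h1
      have h4 := hr0 h s a
      have h5 := le_abs_self (finMean (visits D h s a) (target D h (Vs h.succ))
        - (meanReward M h s a + ∑ s', M.P h s a s' * Vs h.succ s'))
      simp only [herr]
      linarith
  -- For the pessimistic value the same sign condition comes from V̂_h ≥ Q̂_h − Γ_h, so here the
  -- penalty itself plays the role of the error.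
  have hX2 := hD.wsum_le_of_varHat (π := π) hn hsupp hVt0 hVt1 (e := Γ)
    (fun h s a => by have := hc0 h s a; simp only [hΓ]; positivity) (by positivity)
    (fun h s a _ => le_rfl) fun h s a h1 => by
      have h2 := hVtge h s a h1
      have h4 := hr0 h s a
      linarith
  -- Telescoping under the empirical kernel rather than the true one: the local difference V* − V̂ −
  -- P̂(V* − V̂) is then at most err + Γ, with no transition error applied to V̂.
  have hflow : value M π - ∑ s, M.init s * Vt 0 s ≤ wsum w err + wsum w Γ := by
    rw [value_eq_sum_init, ← Finset.sum_sub_distrib]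
    have h1 := sum_init_eq (f := M.init) (P := Phat D) π.prob_sum (fun h s => Vs h s - Vt h s)
      (fun s => by rw [hVs0, hVt0, sub_zero])
    simp only [← mul_sub]
    refine (le_of_eq h1).trans ?_
    rw [← wsum_add]
    change wsum w _ ≤ wsum w _
    refine wsum_mono empOcc_nonneg fun h s a hne => ?_
    have h2 := hVseq h s a hne
    have h3 := hVtge h s a hne
    have h4 := hQ h s a hne (Vs h.succ)
    have h5 := neg_abs_le (finMean (visits D h s a) (target D h (Vs h.succ))
        - (meanReward M h s a + ∑ s', M.P h s a s' * Vs h.succ s'))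
    simp only [mul_sub, Finset.sum_sub_distrib, herr]
    linarith
  set B := wsum w c with hBdef
  have hB0 : 0 ≤ B := wsum_nonneg empOcc_nonneg hc0
  have hH0 : (0 : ℝ) ≤ H := by positivity
  have hs1 : √(20 * L) * √B ≤ 5 * √(L * b) := by
    rw [← Real.sqrt_mul (by positivity)]
    refine Real.sqrt_le_iff.2 ⟨by positivity, ?_⟩
    rw [mul_pow, Real.sq_sqrt (mul_nonneg hL (hB0.trans hb))]
    nlinarith [mul_le_mul_of_nonneg_left hb hL, mul_nonneg hL hB0]
  have hs2 : √L * √B ≤ √(L * b) := by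
    rw [← Real.sqrt_mul hL]
    exact Real.sqrt_le_sqrt (mul_le_mul_of_nonneg_left hb hL)
  have hs3 : √(20 * L) ^ 2 = 20 * L := Real.sq_sqrt (by positivity)
  have hs4 : √L ^ 2 = L := Real.sq_sqrt hL
  have hs5 : H * L * B ≤ H * L * b := by gcongr
  rw [hs3] at hX1
  rw [mul_pow, hs4] at hX2
  have f1 : 6 * √(20 * L) * H * √B ≤ 30 * (H * √(L * b)) := by
    have := mul_le_mul_of_nonneg_left hs1 hH0
    nlinarith
  have f2 : 6 * (2 * √L) * H * √B ≤ 12 * (H * √(L * b)) := by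
    have := mul_le_mul_of_nonneg_left hs2 hH0
    nlinarith
  have f3 : 2 * (20 * L * H + 180 * H * L) * B = 400 * (H * L * B) := by ring
  have f4 : 2 * (2 ^ 2 * L * H + 14 * H * L) * B = 36 * (H * L * B) := by ring
  linarith

end OptimalPolicy

/-! ### The good event -/

section Events

variable {S A : Type*} [Fintype S] [Fintype A] {H n : ℕ}
  [MeasurableSpace S] [DiscreteMeasurableSpace S] [MeasurableSpace A] [DiscreteMeasurableSpace A]
  {M : MDP S A H} {μ π : Policy S A H} {h : Fin H} {s : S} {a : A}

open Classical in
-- The level u = nd/8 is chosen so that the deviation √(2nd·u) equals half of the expected count nd.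
theorem measure_count_lt_le (hd : 0 < occ M μ h s a) :
    dataLaw M μ n {D | (count D h s a : ℝ) < n * occ M μ h s a / 2}
      ≤ ENNReal.ofReal (Real.exp (-(n * occ M μ h s a / 8))) := by
  set d := occ M μ h s a with hdd
  have h1 := measure_sum_lt_le (I := (Finset.univ : Finset (Fin n))) (Q₀ := episodeLaw M μ)
    (Q := fun _ => episodeLaw M μ) (fun _ _ => rfl)
    (w := (visitSet h s a).indicator fun _ => (1 : ℝ))
    (measurable_const.indicator (measurableSet_visitSet h s a)) (b := 1)
    (fun e => ⟨Set.indicator_nonneg (fun _ _ => zero_le_one) _,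
      Set.indicator_le_self' (fun _ _ => zero_le_one) _⟩) (u := n * d / 8) (by positivity)
  have h2 : ∫ e, (visitSet h s a).indicator (fun _ => (1 : ℝ)) e ∂(episodeLaw M μ) = d := by
    rw [hdd, ← measure_visitSet, ← integral_indicator_one (measurableSet_visitSet h s a)]
    rfl
  have h3 : √(2 * n * 1 * d * (n * d / 8)) = n * d / 2 := by
    rw [show 2 * (n : ℝ) * 1 * d * (n * d / 8) = (n * d / 2) ^ 2 by ring,
      Real.sqrt_sq (by positivity)]
  rw [h2, Finset.card_univ, Fintype.card_fin, h3] at h1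
  refine (measure_mono fun D hD => ?_).trans h1
  have h4 : ∑ i, (visitSet h s a).indicator (fun _ => (1 : ℝ)) (D i) = count D h s a := by
    simp only [Set.indicator_apply, Finset.sum_boole, count]
    congr 2
    ext τ
    simp only [Finset.mem_filter, Finset.mem_univ, true_and, mem_visits]
    rfl
  simp only [Set.mem_ofPred_eq] at hD ⊢
  rw [h4]
  linarith

theorem bddMeas_clip01_reward (h : Fin H) :
    BddMeas fun e : Episode S A H => clip01 (e.reward h) :=
  ⟨measurable_clip01.comp (measurable_reward h), 1, fun e => by
    rw [abs_of_nonneg (clip01_mem _).1]; exact (clip01_mem _).2⟩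

theorem bddMeas_comp_next (h : Fin H) (V : S → ℝ) :
    BddMeas fun e : Episode S A H => V (e.next h) := by
  refine ⟨(measurable_of_countable V).comp (measurable_next h), ∑ s, |V s|, fun e => ?_⟩
  exact Finset.single_le_sum (f := fun s => |V s|) (fun _ _ => abs_nonneg _) (Finset.mem_univ _)

theorem measure_abs_sum_target_gt_le (hH : 1 ≤ H) (hd : 0 < occ M μ h s a) {V : S → ℝ}
    (hV : ∀ s, V s ∈ Set.Icc (0 : ℝ) (H - 1)) {u : ℝ} (hu : 0 ≤ u) :
    dataLaw M μ n {D | (visits D h s a).Nonempty ∧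
      √(2 * u) * (devNorm (visits D h s a) (target D h V) + 10 * H * √u) + 3 * H * u
        < |∑ τ ∈ visits D h s a, (target D h V τ
          - (meanReward M h s a + ∑ s', M.P h s a s' * V s'))|}
      ≤ 8 * ENNReal.ofReal (Real.exp (-u)) := by
  have := ProbabilityTheory.cond_isProbabilityMeasure (measure_visitSet_ne_zero hd)
  have h1 := measure_cond_abs_sum_gt_le (ι := Fin n) (measurableSet_visitSet h s a)
    (measure_visitSet_ne_zero hd) (y := fun e : Episode S A H => clip01 (e.reward h) + V (e.next h))
    ((bddMeas_clip01_reward h).add (bddMeas_comp_next h V)).meas (M := H) (by exact_mod_cast hH)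
    (fun e => ⟨add_nonneg (clip01_mem _).1 (hV _).1, by
      linarith [(clip01_mem (e.reward h)).2, (hV (e.next h)).2]⟩) hu
  rw [integral_add ((bddMeas_clip01_reward h).integrable _) ((bddMeas_comp_next h V).integrable _),
    integral_cond_reward hd, integral_cond_next hd] at h1
  simp only [visits_eq_coordsIn]
  exact h1

theorem measure_sum_next_gt_le (hH : 1 ≤ H) (hd : 0 < occ M μ h s a) {W : S → ℝ} {b : ℝ}
    (hb : 0 < b) (hW : ∀ s, W s ∈ Set.Icc (0 : ℝ) b) (u : ℝ) :
    dataLaw M μ n {D | count D h s a * ((1 + 1 / (H : ℝ)) * ∑ s', M.P h s a s' * W s') + H * b * u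
        < ∑ τ ∈ visits D h s a, W ((D τ).next h)} ≤ ENNReal.ofReal (Real.exp (-u)) := by
  have h1 := measure_cond_sum_gt_multiplicative (ι := Fin n) (measurableSet_visitSet h s a)
    (measure_visitSet_ne_zero hd) (w := fun e : Episode S A H => W (e.next h))
    (bddMeas_comp_next h W).meas hb (K := H) (by exact_mod_cast hH) (fun e => hW _) u
  rw [integral_cond_next hd] at h1
  simp only [count, visits_eq_coordsIn]
  exact h1

theorem measure_sum_stable_target_gt_le [Nonempty A] (hH : 1 ≤ H) (hd : 0 < occ M μ h s a)
    {g : Fin H → S → A → Prop} {L κ : ℝ} (hL : 0 ≤ L) (hκ : 0 < κ)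
    (hLκ : 4 * (H : ℝ) ^ 2 * L ≤ κ) {β : ℝ} (hβ : β = 6 * (H : ℝ) ^ 2 * (19 + L) / κ)
    {u u' : ℝ} (hu : 0 ≤ u) (hu' : 0 ≤ u') :
    dataLaw M μ n {D | (visits D h s a).Nonempty ∧
      √(2 * u) * (devNorm (visits D h s a) (target D h (stableV g L κ D h.succ))
          + √(count D h s a) * (β * √(12 * count D h s a * u')) + 10 * H * √u')
          + 3 * H * u + 2 * count D h s a * β
          + 8 * 2 ^ Nat.clog 2 (count D h s a) * β * (Nat.clog 2 (count D h s a) + 1) * u'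
        < ∑ τ ∈ visits D h s a, (target D h (stableV g L κ D h.succ) τ
          - (meanReward M h s a + ∑ s', M.P h s a s' * stableV g L κ D h.succ s'))}
      ≤ ENNReal.ofReal (Real.exp (-u))
        + (5 + 2 * Fintype.card S) * ENNReal.ofReal (Real.exp (-u')) := by
  have := ProbabilityTheory.cond_isProbabilityMeasure (measure_visitSet_ne_zero hd)
  have hH0 : (0 : ℝ) < H := by exact_mod_cast hH
  have h1 := measure_cond_sum_gt_stable_bernstein (ι := Fin n) (measurableSet_visitSet h s a)
    (measure_visitSet_ne_zero hd) (measurable_next h) (bddMeas_clip01_reward h).meas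
    (fun e => clip01_mem _)
    (f := fun s' (D : Fin n → Episode S A H) => stableV g L κ D h.succ s') (M := H) (β := β)
    (by rw [hβ]; positivity) (fun s' => measurable_stableV h.succ s') (by exact_mod_cast hH)
    (fun s' D => ⟨(stableV_mem _ _).1, (stableV_mem _ _).2.trans (by
      rw [Fin.val_succ]; push_cast
      linarith [(Nat.cast_nonneg (h : ℕ) : (0 : ℝ) ≤ (h : ℕ))])⟩)
    (fun s' => by rw [hβ]; exact bddDiff_stableV hH hL hκ hLκ _ _) (Nat.clog 2)
    (fun m => Nat.le_pow_clog one_lt_two m) hu hu'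
  simp only [integral_cond_reward hd, cond_real_next hd] at h1
  simp only [count, visits_eq_coordsIn]
  exact h1

theorem ae_dataLaw_regular (M : MDP S A H) (μ : Policy S A H) (n : ℕ) :
    ∀ᵐ D ∂(dataLaw M μ n), ∀ τ, (∀ h, (D τ).reward h ∈ Set.Icc (0 : ℝ) 1) ∧
      ∀ h, 0 < occ M μ h ((D τ).state h) ((D τ).action h) ∧
        0 < M.P h ((D τ).state h) ((D τ).action h) ((D τ).next h) := by
  refine ae_all_iff.2 fun τ => ?_
  have h2 := measurePreserving_eval (μ := fun _ : Fin n => episodeLaw M μ) τ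
  exact h2.quasiMeasurePreserving.ae ((ae_reward_mem M μ).and (ae_transition_pos M μ))

/-- The event on which the suboptimality bound holds. -/
structure GoodData (M : MDP S A H) (μ π : Policy S A H) (L N : ℝ) (D : Fin n → Episode S A H) :
    Prop extends RegularData M μ D where
  value_dev : ∀ h s a, 0 < occ M μ h s a →
    |∑ τ ∈ visits D h s a, (target D h (polValue M π h.succ) τ
      - (meanReward M h s a + ∑ s', M.P h s a s' * polValue M π h.succ s'))|
    ≤ √(20 * L) * (devNorm (visits D h s a) (target D h (polValue M π h.succ))
      + 10 * H * √(10 * L)) + 3 * H * (10 * L)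
  invCount_dev : ∀ h s a, 0 < occ M μ h s a → ∑ τ ∈ visits D h s a,
      backValue π.prob M.P (invCount M μ n) h.succ ((D τ).next h)
    ≤ count D h s a * ((1 + 1 / (H : ℝ)) *
      ∑ s', M.P h s a s' * backValue π.prob M.P (invCount M μ n) h.succ s')
      + H * (H / N) * (10 * L)
  stable_dev : ∀ h s a, 0 < occ M μ h s a →
    ∑ τ ∈ visits D h s a, (target D h
        (stableV (fun h s a => 0 < occ M μ h s a) L (N / 2) D h.succ) τ
      - (meanReward M h s a + ∑ s', M.P h s a s' *
        stableV (fun h s a => 0 < occ M μ h s a) L (N / 2) D h.succ s'))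
    ≤ √(4 * L) * (devNorm (visits D h s a) (target D h
          (stableV (fun h s a => 0 < occ M μ h s a) L (N / 2) D h.succ))
        + √(count D h s a) * (12 * (H : ℝ) ^ 2 * (19 + L) / N * √(120 * count D h s a * L))
        + 10 * H * √(10 * L))
      + 6 * H * L + 2 * count D h s a * (12 * (H : ℝ) ^ 2 * (19 + L) / N)
      + 80 * 2 ^ Nat.clog 2 (count D h s a) * (12 * (H : ℝ) ^ 2 * (19 + L) / N)
        * (Nat.clog 2 (count D h s a) + 1) * L

/-- Union bound over triples (h, s, a). Only the leading tail of the stable Bernstein event is taken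
at level 2L, because √(2·2L) = 2√L is the constant of the penalty. All other events are taken at
level 10L: one for the count, eight for the value deviation, one for the Chernoff bound and 5 + 2S
for the stability corrections. -/
theorem measure_not_goodData_le [Nonempty S] [Nonempty A] (hH : 1 ≤ H) {L N : ℝ} (hL : 0 ≤ L)
    (hN : 0 < N) (hn : 0 < n) (hNL : 80 * (H : ℝ) ^ 2 * L ≤ N)
    (hNle : ∀ h s a, 0 < occ M μ h s a → N ≤ n * occ M μ h s a) :
    dataLaw M μ n {D | ¬ GoodData M μ π L N D}
      ≤ ENNReal.ofReal (H * Fintype.card S * Fintype.card A *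
        (Real.exp (-(2 * L)) + (15 + 2 * Fintype.card S) * Real.exp (-(10 * L)))) := by
  have hH1 : (1 : ℝ) ≤ H := by exact_mod_cast hH
  have hn0 : (0 : ℝ) < n := by exact_mod_cast hn
  set E : Fin H × S × A → Set (Fin n → Episode S A H) := fun i =>
    if 0 < occ M μ i.1 i.2.1 i.2.2 then
    {D | (count D i.1 i.2.1 i.2.2 : ℝ) < n * occ M μ i.1 i.2.1 i.2.2 / 2} ∪
    ({D | (visits D i.1 i.2.1 i.2.2).Nonempty ∧
      √(2 * (10 * L)) * (devNorm (visits D i.1 i.2.1 i.2.2)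
        (target D i.1 (polValue M π i.1.succ)) + 10 * H * √(10 * L)) + 3 * H * (10 * L)
        < |∑ τ ∈ visits D i.1 i.2.1 i.2.2, (target D i.1 (polValue M π i.1.succ) τ
          - (meanReward M i.1 i.2.1 i.2.2
            + ∑ s', M.P i.1 i.2.1 i.2.2 s' * polValue M π i.1.succ s'))|} ∪
    ({D | count D i.1 i.2.1 i.2.2 * ((1 + 1 / (H : ℝ)) * ∑ s', M.P i.1 i.2.1 i.2.2 s' *
        backValue π.prob M.P (invCount M μ n) i.1.succ s') + H * (H / N) * (10 * L)
        < ∑ τ ∈ visits D i.1 i.2.1 i.2.2,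
          backValue π.prob M.P (invCount M μ n) i.1.succ ((D τ).next i.1)} ∪
    {D | (visits D i.1 i.2.1 i.2.2).Nonempty ∧
      √(2 * (2 * L)) * (devNorm (visits D i.1 i.2.1 i.2.2) (target D i.1
          (stableV (fun h s a => 0 < occ M μ h s a) L (N / 2) D i.1.succ))
          + √(count D i.1 i.2.1 i.2.2) * (12 * (H : ℝ) ^ 2 * (19 + L) / N *
            √(12 * count D i.1 i.2.1 i.2.2 * (10 * L))) + 10 * H * √(10 * L))
          + 3 * H * (2 * L) + 2 * count D i.1 i.2.1 i.2.2 * (12 * (H : ℝ) ^ 2 * (19 + L) / N)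
          + 8 * 2 ^ Nat.clog 2 (count D i.1 i.2.1 i.2.2) * (12 * (H : ℝ) ^ 2 * (19 + L) / N) *
            (Nat.clog 2 (count D i.1 i.2.1 i.2.2) + 1) * (10 * L)
        < ∑ τ ∈ visits D i.1 i.2.1 i.2.2, (target D i.1
            (stableV (fun h s a => 0 < occ M μ h s a) L (N / 2) D i.1.succ) τ
          - (meanReward M i.1 i.2.1 i.2.2 + ∑ s', M.P i.1 i.2.1 i.2.2 s' *
            stableV (fun h s a => 0 < occ M μ h s a) L (N / 2) D i.1.succ s'))})) else ∅ with hE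
  have hEle : ∀ i, dataLaw M μ n (E i) ≤ ENNReal.ofReal
      (Real.exp (-(2 * L)) + (15 + 2 * Fintype.card S) * Real.exp (-(10 * L))) := by
    intro i
    by_cases hd : 0 < occ M μ i.1 i.2.1 i.2.2
    swap
    · simp only [hE, if_neg hd, measure_empty]; exact zero_le
    simp only [hE, if_pos hd]
    have h1 := measure_count_lt_le (n := n) hd
    have h2 := measure_abs_sum_target_gt_le (n := n) hH hd (V := polValue M π i.1.succ)
      (fun s => ⟨(polValue_mem _ _).1, (polValue_mem _ _).2.trans (by
        rw [Fin.val_succ]; push_cast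
        linarith [(Nat.cast_nonneg (i.1 : ℕ) : (0 : ℝ) ≤ (i.1 : ℕ))])⟩) (u := 10 * L)
      (by positivity)
    have h3 := measure_sum_next_gt_le (n := n) hH hd
      (W := backValue π.prob M.P (invCount M μ n) i.1.succ) (b := H / N) (by positivity)
      (fun s => by
        have hg : ∀ h s a, invCount M μ n h s a ∈ Set.Icc 0 (N⁻¹) := fun h s a => by
          rcases (occ_nonneg M μ h s a).eq_or_lt with h0 | h0
          · rw [invCount, ← h0]; simp [hN.le]
          · exact ⟨inv_nonneg.2 (mul_pos hn0 h0).le, inv_anti₀ hN (hNle h s a h0)⟩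
        have := backValue_mem π.prob_nonneg π.prob_sum M.P_nonneg M.P_sum hg i.1.succ s
        refine ⟨this.1, this.2.trans ?_⟩
        rw [div_eq_mul_inv]
        have : (0 : ℝ) ≤ ((i.1.succ : Fin (H + 1)) : ℕ) := Nat.cast_nonneg _
        have : 0 ≤ N⁻¹ := by positivity
        nlinarith) (10 * L)
    have h4 := measure_sum_stable_target_gt_le (n := n) hH hd
      (g := fun h s a => 0 < occ M μ h s a) hL (κ := N / 2) (by positivity)
      (by nlinarith [mul_nonneg (sq_nonneg (H : ℝ)) hL]) (β := 12 * (H : ℝ) ^ 2 * (19 + L) / N)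
      (by field_simp; ring) (u := 2 * L) (u' := 10 * L) (by positivity) (by positivity)
    -- The count tail exp(−nd/8) is below exp(−10L) because nd ≥ N ≥ 80H²L.
    have h5 : Real.exp (-(n * occ M μ i.1 i.2.1 i.2.2 / 8)) ≤ Real.exp (-(10 * L)) := by
      refine Real.exp_le_exp.2 ?_
      have := hNle _ _ _ hd
      have : L ≤ (H : ℝ) ^ 2 * L := le_mul_of_one_le_left hL (one_le_pow₀ hH1)
      linarith
    have he : 0 ≤ Real.exp (-(10 * L)) := (Real.exp_pos _).le
    have e1 : (8 : ENNReal) * ENNReal.ofReal (Real.exp (-(10 * L)))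
        = ENNReal.ofReal (8 * Real.exp (-(10 * L))) := by
      rw [ENNReal.ofReal_mul (by norm_num)]; norm_num
    have e2 : (5 + 2 * (Fintype.card S : ENNReal)) * ENNReal.ofReal (Real.exp (-(10 * L)))
        = ENNReal.ofReal ((5 + 2 * Fintype.card S) * Real.exp (-(10 * L))) := by
      rw [ENNReal.ofReal_mul (by positivity), ENNReal.ofReal_add (by norm_num) (by positivity),
        ENNReal.ofReal_mul (by norm_num), ENNReal.ofReal_natCast]
      norm_num
    rw [e1] at h2
    rw [e2] at h4
    refine (measure_union_le _ _).trans ((add_le_add (h1.trans (ENNReal.ofReal_le_ofReal h5))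
      ((measure_union_le _ _).trans (add_le_add h2
      ((measure_union_le _ _).trans (add_le_add h3 h4))))).trans (le_of_eq ?_))
    rw [← ENNReal.ofReal_add (by positivity) (by positivity),
      ← ENNReal.ofReal_add (by positivity) (by positivity),
      ← ENNReal.ofReal_add (by positivity) (by positivity),
      ← ENNReal.ofReal_add (by positivity) (by positivity)]
    congr 1
    ring
  have hsub : {D | ¬ GoodData M μ π L N D} ⊆ {D | ¬ ∀ τ,
      (∀ h, (D τ).reward h ∈ Set.Icc (0 : ℝ) 1) ∧
      ∀ h, 0 < occ M μ h ((D τ).state h) ((D τ).action h) ∧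
        0 < M.P h ((D τ).state h) ((D τ).action h) ((D τ).next h)} ∪ ⋃ i, E i := by
    intro D hD
    by_contra hcon
    rw [Set.mem_union, not_or, Set.mem_iUnion, not_exists] at hcon
    obtain ⟨hc1, hc2⟩ := hcon
    have hc1 := not_not.1 hc1
    have key : ∀ h s a, 0 < occ M μ h s a → _ := fun h s a hd => by
      have h1 := hc2 (h, s, a)
      simp only [hE, if_pos hd, Set.mem_union, not_or, Set.mem_ofPred_eq, not_lt, not_and] at h1
      have h2 : (visits D h s a).Nonempty := by
        rw [← Finset.card_pos]
        have h3 : (0 : ℝ) < count D h s a :=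
          (by have := mul_pos hn0 hd; positivity : (0 : ℝ) < n * occ M μ h s a / 2).trans_le h1.1
        exact_mod_cast h3
      exact And.intro h1.1 (And.intro (h1.2.1 h2) (And.intro h1.2.2.1 (h1.2.2.2 h2)))
    refine hD ⟨⟨fun τ => (hc1 τ).1, fun τ => (hc1 τ).2, fun h s a hd => (key h s a hd).1⟩,
      fun h s a hd => ?_, fun h s a hd => (key h s a hd).2.2.1, fun h s a hd => ?_⟩
    · refine (key h s a hd).2.1.trans (le_of_eq ?_)
      ring_nf
    · refine (key h s a hd).2.2.2.trans (le_of_eq ?_)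
      ring_nf
  refine (measure_mono hsub).trans ((measure_union_le _ _).trans ?_)
  rw [ae_iff.1 (ae_dataLaw_regular M μ n), zero_add]
  refine (measure_iUnion_fintype_le _ _).trans ((Finset.sum_le_sum fun i _ => hEle i).trans ?_)
  rw [Finset.sum_const, Finset.card_univ, nsmul_eq_mul, Fintype.card_prod, Fintype.card_prod,
    Fintype.card_fin, ← ENNReal.ofReal_natCast, ← ENNReal.ofReal_mul (by positivity)]
  refine ENNReal.ofReal_le_ofReal (le_of_eq ?_)
  push_cast
  ring

end Events

/-! ### The suboptimality bound on the good event -/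

theorem two_pow_clog_le {m : ℕ} (hm : 1 ≤ m) : 2 ^ Nat.clog 2 m ≤ 2 * m := by
  rcases hm.eq_or_lt with rfl | h
  · simp
  · have h1 := Nat.pow_pred_clog_lt_self one_lt_two h
    have h2 : 0 < Nat.clog 2 m := Nat.clog_pos one_lt_two h
    calc 2 ^ Nat.clog 2 m = 2 ^ (Nat.clog 2 m - 1 + 1) := by rw [Nat.sub_add_cancel h2]
      _ = 2 * 2 ^ (Nat.clog 2 m - 1) := pow_succ' _ _
      _ ≤ 2 * m := by have := h1.le; rw [Nat.pred_eq_sub_one] at this; omega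

theorem clog_add_one_le {m n : ℕ} {Λ : ℝ} (hm : 1 ≤ m) (hmn : m ≤ n) (hΛ : Real.log n ≤ Λ)
    (hΛ1 : 69 / 100 ≤ Λ) : (Nat.clog 2 m + 1 : ℝ) ≤ 5 * Λ := by
  have hm0 : (0 : ℝ) < m := by exact_mod_cast hm
  have h1 : ((2 : ℝ) ^ Nat.clog 2 m) ≤ 2 * m := by exact_mod_cast two_pow_clog_le hm
  have h2 := Real.log_le_log (by positivity) h1
  rw [Real.log_pow, Real.log_mul (by norm_num) hm0.ne'] at h2
  have h3 : Real.log m ≤ Λ := (Real.log_le_log hm0 (by exact_mod_cast hmn)).trans hΛ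
  have h4 := Real.log_two_gt_d9
  nlinarith

/-- Collects everything that the penalty does not cancel, as an error per observation. The
coefficient 72 is 80 + 6 − 14: the two HL terms of the concentration bound minus the 14HL of the
penalty. L ≥ 69/100 absorbs the constants into powers of Λ. -/
theorem stable_error_le {H L Λ N β m : ℝ} (hH1 : 1 ≤ H) (hL : 69 / 100 ≤ L) (hLΛ : L ≤ Λ)
    (hN : 0 < N) (hmN : N / 2 ≤ m) (hβ : β = 12 * H ^ 2 * (19 + L) / N) :
    22 * (β * m * L) + 2 * m * β + 800 * (m * β * Λ * L) + 72 * (H * L)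
      ≤ 300000 * (H ^ 2 * Λ ^ 3 / N) * m := by
  have hL0 : 0 < L := by linarith
  have hΛ0 : 0 < Λ := by linarith
  have hm0 : 0 < m := by linarith
  have hβL : β ≤ 348 * (H ^ 2 * L / N) := by
    rw [hβ, div_le_iff₀ hN]
    have : 348 * (H ^ 2 * L / N) * N = 348 * (H ^ 2 * L) := by field_simp
    rw [this]
    nlinarith [sq_nonneg H]
  have hΛ2 : L ≤ 3 / 2 * Λ ^ 2 := by nlinarith
  have hΛ3 : L ≤ 9 / 4 * Λ ^ 3 := by
    have : Λ ^ 2 ≤ 3 / 2 * Λ ^ 3 := by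
      have : 0 < Λ ^ 2 := by positivity
      nlinarith
    linarith
  have hL2 : L ^ 2 ≤ 3 / 2 * Λ ^ 3 := by
    calc L ^ 2 = L * L := sq L
      _ ≤ 3 / 2 * Λ ^ 2 * Λ := by gcongr
      _ = _ := by ring
  have hL3 : L ^ 2 * Λ ≤ Λ ^ 3 := by
    calc L ^ 2 * Λ ≤ Λ ^ 2 * Λ := by gcongr
      _ = _ := by ring
  have hcoef : 22 * (β * L) + 2 * β + 800 * (β * Λ * L) + 144 * (H ^ 2 * L / N)
      ≤ 300000 * (H ^ 2 * Λ ^ 3 / N) := by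
    have hx : 0 ≤ H ^ 2 / N := by positivity
    have b1 : β * (22 * L + 2 + 800 * (Λ * L))
        ≤ 348 * (H ^ 2 * L / N) * (22 * L + 2 + 800 * (Λ * L)) := by gcongr
    have b2 : (7656 * L ^ 2 + 840 * L + 278400 * (L ^ 2 * Λ)) ≤ 300000 * Λ ^ 3 := by
      have : 0 < Λ ^ 3 := by positivity
      linarith
    have b3 := mul_le_mul_of_nonneg_left b2 hx
    have e1 : 348 * (H ^ 2 * L / N) * (22 * L + 2 + 800 * (Λ * L)) + 144 * (H ^ 2 * L / N)
        = H ^ 2 / N * (7656 * L ^ 2 + 840 * L + 278400 * (L ^ 2 * Λ)) := by ring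
    have e2 : H ^ 2 / N * (300000 * Λ ^ 3) = 300000 * (H ^ 2 * Λ ^ 3 / N) := by ring
    linarith
  have hHL : 72 * (H * L) ≤ 144 * (H ^ 2 * L / N) * m := by
    have h2 : H * L ≤ H ^ 2 * L :=
      mul_le_mul_of_nonneg_right (le_self_pow₀ hH1 two_ne_zero) hL0.le
    calc 72 * (H * L) ≤ 72 * (H ^ 2 * L) := by linarith
      _ = 144 * (H ^ 2 * L / N) * (N / 2) := by field_simp; ring
      _ ≤ _ := by gcongr
  have hfin := mul_le_mul_of_nonneg_right hcoef hm0.le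
  linarith

section Bound

variable {S A : Type*} [Fintype S] [Fintype A] {H n : ℕ}
  [MeasurableSpace S] [DiscreteMeasurableSpace S] [MeasurableSpace A] [DiscreteMeasurableSpace A]
  {M : MDP S A H} {μ π : Policy S A H} {D : Fin n → Episode S A H} {L N Λ : ℝ}

/-- The pessimistic update exceeds the Bellman update only by a term of higher order. -/
theorem GoodData.stableQ_le [Nonempty A] (hD : GoodData M μ π L N D) (hH : 1 ≤ H)
    (hL : 69 / 100 ≤ L) (hLΛ : L ≤ Λ) (hnΛ : Real.log n ≤ Λ) (hN : 0 < N)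
    (hNle : ∀ h s a, 0 < occ M μ h s a → N ≤ n * occ M μ h s a) (h : Fin H) (s : S) (a : A) :
    stableQ (fun h s a => 0 < occ M μ h s a) L (N / 2) D h
        (stableV (fun h s a => 0 < occ M μ h s a) L (N / 2) D h.succ) s a
      ≤ meanReward M h s a + ∑ s', M.P h s a s' *
        stableV (fun h s a => 0 < occ M μ h s a) L (N / 2) D h.succ s'
        + 300000 * (H ^ 2 * Λ ^ 3 / N) := by
  set V := stableV (fun h s a => 0 < occ M μ h s a) L (N / 2) D h.succ with hV
  set q := meanReward M h s a + ∑ s', M.P h s a s' * V s' with hq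
  have hH1 : (1 : ℝ) ≤ H := by exact_mod_cast hH
  have hL0 : 0 < L := by linarith
  have hΛ0 : 0 < Λ := by linarith
  have hq0 : 0 ≤ q := add_nonneg (meanReward_mem M h s a).1 (Finset.sum_nonneg fun s' _ =>
    mul_nonneg (M.P_nonneg _ _ _ _) (stableV_mem _ _).1)
  have hε0 : 0 ≤ 300000 * (H ^ 2 * Λ ^ 3 / N) := by positivity
  rw [stableQ]
  split_ifs with hd
  swap
  · linarith
  refine max_le ((min_le_left _ _).trans ?_) (by linarith)
  set m : ℝ := (count D h s a : ℝ) with hm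
  have hmN : N / 2 ≤ m := by
    have := hD.count_ge h s a hd
    have := hNle h s a hd
    linarith
  have hm0 : 0 < m := by linarith
  have hm1 : 1 ≤ count D h s a := by
    rw [hm] at hm0; exact_mod_cast hm0
  have hmn : count D h s a ≤ n := by
    rw [count]; exact (Finset.card_le_univ _).trans (by simp)
  rw [penalizedMean, show max ((visits D h s a).card : ℝ) (N / 2) = m from max_eq_left hmN,
    div_le_iff₀ hm0]
  have h1 := hD.stable_dev h s a hd
  rw [← hV, ← hq, Finset.sum_sub_distrib, Finset.sum_const, nsmul_eq_mul] at h1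
  change _ - m * q ≤ _ at h1
  set β := 12 * (H : ℝ) ^ 2 * (19 + L) / N with hβ
  set d := devNorm (visits D h s a) (target D h V) with hdd
  have hβ0 : 0 ≤ β := by positivity
  have hs4 : √(4 * L) = 2 * √L := by
    rw [Real.sqrt_mul (by norm_num), show (4 : ℝ) = 2 ^ 2 by norm_num, Real.sqrt_sq (by norm_num)]
  have hsL : √L * √L = L := Real.mul_self_sqrt hL0.le
  have hsm : √m * √m = m := Real.mul_self_sqrt hm0.le
  have h120 : √(120 * m * L) ≤ 11 * (√m * √L) := by
    refine Real.sqrt_le_iff.2 ⟨by positivity, ?_⟩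
    have : (11 * (√m * √L)) ^ 2 = 121 * (m * L) := by
      rw [mul_pow, mul_pow, Real.sq_sqrt hm0.le, Real.sq_sqrt hL0.le]; norm_num
    rw [this]
    nlinarith [mul_pos hm0 hL0]
  have h10 : √(10 * L) ≤ 4 * √L := by
    refine Real.sqrt_le_iff.2 ⟨by positivity, ?_⟩
    rw [mul_pow, Real.sq_sqrt hL0.le]; linarith
  have t1 : √(4 * L) * (√m * (β * √(120 * m * L))) ≤ 22 * (β * m * L) := by
    calc _ ≤ 2 * √L * (√m * (β * (11 * (√m * √L)))) := by rw [hs4]; gcongr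
      _ = 22 * (β * (√m * √m) * (√L * √L)) := by ring
      _ = _ := by rw [hsm, hsL]
  have t2 : √(4 * L) * (10 * H * √(10 * L)) ≤ 80 * (H * L) := by
    calc _ ≤ 2 * √L * (10 * H * (4 * √L)) := by rw [hs4]; gcongr
      _ = 80 * (H * (√L * √L)) := by ring
      _ = _ := by rw [hsL]
  have t3 : 80 * 2 ^ Nat.clog 2 (count D h s a) * β * (Nat.clog 2 (count D h s a) + 1) * L
      ≤ 800 * (m * β * Λ * L) := by
    have h2 : ((2 : ℝ) ^ Nat.clog 2 (count D h s a)) ≤ 2 * m := by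
      rw [hm]; exact_mod_cast two_pow_clog_le hm1
    have h3 := clog_add_one_le hm1 hmn hnΛ (hL.trans hLΛ)
    calc _ ≤ 80 * (2 * m) * β * (5 * Λ) * L := by gcongr
      _ = _ := by ring
  -- The term 2√L times the deviation norm in the concentration bound is cancelled exactly by the
  -- penalty. What remains is the higher-order error.
  have hfin := stable_error_le hH1 hL hLΛ hN hmN hβ
  rw [hs4] at h1 t1 t2
  rw [mul_add, mul_add] at h1
  linarith

/-- The pessimistic value exceeds the value of the output only by a term of higher order. -/
theorem init_stableV_sub_value_le {V : Fin (H + 1) → S → ℝ} (hV0 : ∀ s, V (Fin.last H) s = 0)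
    {Q : Fin H → S → A → ℝ} {πhat : Policy S A H}
    (hVQ : ∀ h s, V (Fin.castSucc h) s = ∑ a, πhat.prob h s a * Q h s a) {ε : ℝ}
    (hQ : ∀ h s a, Q h s a ≤ meanReward M h s a + ∑ s', M.P h s a s' * V h.succ s' + ε) :
    ∑ s, M.init s * V 0 s - value M πhat ≤ H * ε := by
  have key : ∀ (k : Fin (H + 1)) s, V k s - polValue M πhat k s ≤ ((H : ℝ) - (k : ℕ)) * ε := by
    intro k
    induction k using Fin.reverseInduction with
    | last => intro s; simp [hV0, polValue, backValue_last]
    | cast h ih =>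
      intro s
      rw [hVQ, polValue, backValue_castSucc, ← Finset.sum_sub_distrib]
      simp only [← mul_sub]
      refine sum_mul_le_of_sum_eq_one (πhat.prob_nonneg h s) (πhat.prob_sum h s) fun a => ?_
      have h1 := sum_mul_le_of_sum_eq_one (M.P_nonneg h s a) (M.P_sum h s a) ih
      simp only [mul_sub, Finset.sum_sub_distrib] at h1
      have h2 := hQ h s a
      rw [Fin.val_succ] at h1
      rw [Fin.val_castSucc]
      push_cast at h1
      rw [polValue] at h1
      linarith
  rw [value_eq_sum_init, ← Finset.sum_sub_distrib]
  simp only [← mul_sub]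
  refine sum_mul_le_of_sum_eq_one M.init_nonneg M.init_sum fun s => ?_
  simpa using key 0 s

/-- The suboptimality bound on the good event. -/
theorem GoodData.value_sub_value_le [Nonempty S] [Nonempty A] {δ C : ℝ}
    (hD : GoodData M μ π (iota S A H δ) N D) (hH : 1 ≤ H) (hn : 0 < n) (hdet : π.IsDeterministic)
    (hL : 69 / 100 ≤ iota S A H δ) (hLΛ : iota S A H δ ≤ Λ) (hnΛ : Real.log n ≤ Λ) (hN : 0 < N)
    (hNle : ∀ h s a, 0 < occ M μ h s a → N ≤ n * occ M μ h s a)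
    (hNL : 80 * (H : ℝ) ^ 2 * iota S A H δ ≤ N) {c : ℝ} (hc : 0 ≤ c)
    (hle : ∀ h s a, occ M π h s a ≤ c * occ M μ h s a)
    (hlead : √((H : ℝ) ^ 3 * Fintype.card S * c * iota S A H δ / n) ≤ H) (hC : 2 ≤ C)
    {πhat : Policy S A H} (hout : IsAPVIOutput D δ C πhat) :
    value M π - value M πhat ≤ 4000 * √((H : ℝ) ^ 3 * Fintype.card S * c * iota S A H δ / n)
      + 300000 * (H ^ 3 * Λ ^ 3 / N) := by
  set L := iota S A H δ with hLd
  have hL0 : 0 ≤ L := by linarith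
  have hH0 : (0 : ℝ) < H := by exact_mod_cast hH
  have hn0 : (0 : ℝ) < n := by exact_mod_cast hn
  have hsupp : ∀ h s a, 0 < occ M π h s a → 0 < occ M μ h s a := fun h s a h1 => by
    by_contra h2
    have h3 := hle h s a
    rw [le_antisymm (not_lt.1 h2) (occ_nonneg M μ h s a), mul_zero] at h3
    linarith
  have hκc : ∀ h s a, 0 < occ M μ h s a → N / 2 ≤ count D h s a := fun h s a hd => by
    have := hD.count_ge h s a hd
    have := hNle h s a hd
    linarith
  set b := 8 * (H * Fintype.card S * c / n) with hb
  set lead := √((H : ℝ) ^ 3 * Fintype.card S * c * L / n) with hleadd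
  have hlead0 : 0 ≤ lead := Real.sqrt_nonneg _
  have hlead2 : lead ^ 2 = (H : ℝ) ^ 3 * Fintype.card S * c * L / n :=
    Real.sq_sqrt (by positivity)
  have h1 := hD.toRegularData.wsum_inv_count_le hn hdet hsupp hc hle hN (u := 10 * L) hNle
    (by linarith) hD.invCount_dev
  have h2 := hD.toRegularData.value_sub_le hn hdet hsupp hL0 hκc hD.value_dev h1
  have h3 := init_stableV_sub_value_le (M := M) (πhat := πhat)
    (V := stableV (fun h s a => 0 < occ M μ h s a) L (N / 2) D)
    (fun s => by rw [stableV_last])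
    (hout.stableV_eq hD.reward_mem hL0 (by positivity) hκc
      (fun h s a h0 => hD.toRegularData.count_eq_zero h0) (by nlinarith [mul_nonneg hH0.le hL0]))
    (hD.stableQ_le hH hL hLΛ hnΛ hN hNle)
  -- With b = 8HSc/n, H√(Lb) is √8 times the leading term, hence at most three times it.
  have h4 : H * √(L * b) ≤ 3 * lead := by
    have : H * √(L * b) = √(8 * lead ^ 2) := by
      rw [hlead2, ← Real.sqrt_sq hH0.le, ← Real.sqrt_mul (by positivity), Real.sqrt_sq hH0.le, hb]
      congr 1; ring
    rw [this]
    exact Real.sqrt_le_iff.2 ⟨by positivity, by nlinarith [sq_nonneg lead]⟩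
  -- The second-order term HLb equals 8·lead²/H. It is dominated by the leading term because lead ≤
  -- H, so no separate SC*/n term appears in the result.
  have h5 : H * L * b ≤ 8 * lead := by
    have : H * (H * L * b) = 8 * lead ^ 2 := by rw [hlead2, hb]; ring
    have h6 : H * (H * L * b) ≤ H * (8 * lead) := by
      rw [this]; nlinarith
    exact le_of_mul_le_mul_left h6 hH0
  have h6 : (H : ℝ) * (300000 * (H ^ 2 * Λ ^ 3 / N)) = 300000 * (H ^ 3 * Λ ^ 3 / N) := by ring
  linarith

theorem minOccupancy_spec (hH : 1 ≤ H) (M : MDP S A H) (μ : Policy S A H) :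
    0 < minOccupancy M μ ∧ ∀ h s a, 0 < occ M μ h s a → minOccupancy M μ ≤ occ M μ h s a := by
  have hfin : {x : ℝ | 0 < x ∧ ∃ h s a, occupancy M μ h s a = x}.Finite := by
    refine (Set.finite_range fun i : Fin H × S × A => occupancy M μ i.1 i.2.1 i.2.2).subset ?_
    rintro x ⟨-, h, s, a, rfl⟩
    exact ⟨(h, s, a), rfl⟩
  have hne : {x : ℝ | 0 < x ∧ ∃ h s a, occupancy M μ h s a = x}.Nonempty := by
    have h1 := sum_occ M μ ⟨0, hH⟩
    obtain ⟨s, -, hs⟩ := Finset.exists_ne_zero_of_sum_ne_zero (by rw [h1]; exact one_ne_zero)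
    obtain ⟨a, -, ha⟩ := Finset.exists_ne_zero_of_sum_ne_zero hs
    exact ⟨_, (occ_nonneg M μ _ s a).lt_of_ne' ha, _, s, a, occupancy_eq_occ M μ _ s a⟩
  exact ⟨(hne.csInf_mem hfin).1, fun h s a hd =>
    csInf_le hfin.bddBelow ⟨hd, h, s, a, occupancy_eq_occ M μ h s a⟩⟩

theorem occ_le_concentrability (hc : concentrability M π μ < ⊤) (h : Fin H) (s : S) (a : A) :
    occ M π h s a ≤ (concentrability M π μ).toReal * occ M μ h s a := by
  have h1 : ENNReal.ofReal (occ M π h s a) / ENNReal.ofReal (occ M μ h s a)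
      ≤ concentrability M π μ := by
    rw [← occupancy_eq_occ, ← occupancy_eq_occ]
    exact le_iSup_of_le h (le_iSup_of_le s (le_iSup_of_le a le_rfl))
  have h2 := (ENNReal.div_le_iff_le_mul (Or.inr hc.ne) (Or.inl ENNReal.ofReal_ne_top)).1 h1
  rw [← ENNReal.ofReal_toReal hc.ne, ← ENNReal.ofReal_mul ENNReal.toReal_nonneg] at h2
  exact (ENNReal.ofReal_le_ofReal_iff (mul_nonneg ENNReal.toReal_nonneg (occ_nonneg _ _ _ _ _))).1 h2

/-- With a single action there is only one policy and the gap is zero. Excluding this case ensures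
HSA ≥ 2, so that ι is at least log 2. -/
theorem value_eq_of_card_eq_one (hA : Fintype.card A = 1) (M : MDP S A H) (π π' : Policy S A H) :
    value M π = value M π' := by
  obtain ⟨a, ha⟩ := Fintype.card_eq_one_iff.1 hA
  have h1 : ∀ π : Policy S A H, π.prob = fun _ _ _ => 1 := fun π => by
    funext h s b
    have h2 := π.prob_sum h s
    rw [Finset.sum_eq_single a (fun b _ hb => absurd (ha b) hb) (by simp)] at h2
    rw [ha b, h2]
  simp only [value_eq_sum, occ, h1]

end Bound

end OfflineRL

/-! ### Assembly: trivial regimes, failure probability and the final bound. -/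

theorem mainTheorem6 :
    ∃ c₀ : ℝ, 0 < c₀ ∧ ∃ C' : ℝ, 0 < C' ∧ ∃ k : ℕ,
      ∀ (S A : Type*) [Fintype S] [Fintype A] [MeasurableSpace S] [DiscreteMeasurableSpace S]
        [MeasurableSpace A] [DiscreteMeasurableSpace A] (H : ℕ) (_ : 1 ≤ H)
        (M : OfflineRL.MDP S A H) (μ πstar : OfflineRL.Policy S A H)
        (_ : πstar.IsDeterministic)
        (_ : OfflineRL.value M πstar = OfflineRL.optimalValue M)
        (_ : OfflineRL.concentrability M πstar μ < ⊤)
        (δ : ℝ) (_ : 0 < δ) (_ : δ < 1) (C : ℝ) (_ : 2 ≤ C) (n : ℕ)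
        (_ : c₀ * (1 / OfflineRL.minOccupancy M μ) * OfflineRL.iota S A H δ < n),
        OfflineRL.dataLaw M μ n
          {D | ¬ ∀ πhat : OfflineRL.Policy S A H, OfflineRL.IsAPVIOutput D δ C πhat →
            0 ≤ OfflineRL.optimalValue M - OfflineRL.value M πhat ∧
            OfflineRL.optimalValue M - OfflineRL.value M πhat ≤
              C' * √((H : ℝ) ^ 3 * Fintype.card S * (OfflineRL.concentrability M πstar μ).toReal
                      * OfflineRL.iota S A H δ / n)
              + C' * ((H : ℝ) ^ 3
                  * Real.log (H * Fintype.card S * Fintype.card A * n / δ) ^ k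
                  / (n * OfflineRL.minOccupancy M μ))}
          ≤ ENNReal.ofReal δ := by
  -- The regime N < 80H²ι is covered by the trivial bound below, so c₀ = 1 suffices: the sample-size
  -- condition serves to make n positive.
  refine ⟨1, one_pos, 300000, by norm_num, 3, ?_⟩
  intro S A _ _ _ _ _ _ H hH M μ πstar hdet hopt hconc δ hδ0 hδ1 C hC n hn
  set c := (OfflineRL.concentrability M πstar μ).toReal with hc
  set L := OfflineRL.iota S A H δ with hL
  set Λ := Real.log (H * Fintype.card S * Fintype.card A * n / δ) with hΛ
  obtain ⟨hm0, hmle⟩ := OfflineRL.minOccupancy_spec hH M μ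
  set N := (n : ℝ) * OfflineRL.minOccupancy M μ with hN
  have : Nonempty S := by
    by_contra hcon
    rw [not_nonempty_iff] at hcon
    have := M.init_sum
    simp at this
  have : Nonempty A := by
    by_contra hcon
    rw [not_nonempty_iff] at hcon
    have := μ.prob_sum ⟨0, hH⟩ (Classical.arbitrary S)
    simp at this
  have hH1 : (1 : ℝ) ≤ H := by exact_mod_cast hH
  have hS1 : (1 : ℝ) ≤ Fintype.card S := by exact_mod_cast Fintype.card_pos
  have hA1 : (1 : ℝ) ≤ Fintype.card A := by exact_mod_cast Fintype.card_pos
  have hHS : (1 : ℝ) ≤ H * Fintype.card S := one_le_mul_of_one_le_of_one_le hH1 hS1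
  set X : ℝ := H * Fintype.card S * Fintype.card A with hX
  have hX1 : 1 ≤ X := one_le_mul_of_one_le_of_one_le hHS hA1
  have hLeq : L = Real.log (X / δ) := rfl
  have hXδ : 1 < X / δ := by rw [lt_div_iff₀ hδ0]; linarith
  have hL0 : 0 < L := Real.log_pos hXδ
  have hn0 : (0 : ℝ) < n := lt_of_le_of_lt (by positivity) hn
  have hn1 : 0 < n := by exact_mod_cast hn0
  have hN0 : 0 < N := mul_pos hn0 hm0
  have hΛeq : Λ = L + Real.log n := by
    rw [hΛ, hLeq, ← Real.log_mul (by positivity) hn0.ne']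
    congr 1; ring
  have hlogn : 0 ≤ Real.log n := Real.log_natCast_nonneg n
  have hLΛ : L ≤ Λ := by linarith
  have hnΛ : Real.log n ≤ Λ := by linarith
  have hrhs : 0 ≤ 300000 * ((H : ℝ) ^ 3 * Λ ^ 3 / N) := by
    have : 0 ≤ Λ := hL0.le.trans hLΛ
    positivity
  have hlead0 := Real.sqrt_nonneg ((H : ℝ) ^ 3 * Fintype.card S * c * L / n)
  have hgap : ∀ πhat, OfflineRL.optimalValue M - OfflineRL.value M πhat ≤ H := fun πhat => by
    rw [← hopt]
    linarith [(OfflineRL.value_mem M πstar).2, (OfflineRL.value_mem M πhat).1]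
  -- The lower bound 0 ≤ v* − v^π̂ always holds, so only failures of the upper bound need to be
  -- covered by a small event.
  have htriv : ∀ P : Set (Fin n → OfflineRL.Episode S A H),
      OfflineRL.dataLaw M μ n P ≤ ENNReal.ofReal δ →
      {D | ¬ ∀ πhat : OfflineRL.Policy S A H, OfflineRL.IsAPVIOutput D δ C πhat →
        OfflineRL.optimalValue M - OfflineRL.value M πhat
          ≤ 300000 * √((H : ℝ) ^ 3 * Fintype.card S * c * L / n)
            + 300000 * ((H : ℝ) ^ 3 * Λ ^ 3 / N)} ⊆ P →
      OfflineRL.dataLaw M μ n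
        {D | ¬ ∀ πhat : OfflineRL.Policy S A H, OfflineRL.IsAPVIOutput D δ C πhat →
        0 ≤ OfflineRL.optimalValue M - OfflineRL.value M πhat ∧
        OfflineRL.optimalValue M - OfflineRL.value M πhat
          ≤ 300000 * √((H : ℝ) ^ 3 * Fintype.card S * c * L / n)
            + 300000 * ((H : ℝ) ^ 3 * Λ ^ 3 / N)} ≤ ENNReal.ofReal δ := by
    intro P hP hsub
    refine (MeasureTheory.measure_mono fun D hD => hsub ?_).trans hP
    intro hcon
    exact hD fun πhat hout =>
      ⟨sub_nonneg.2 (OfflineRL.value_le_optimalValue M πhat), hcon πhat hout⟩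
  by_cases hA : Fintype.card A = 1
  · refine htriv ∅ (by simp) fun D hD => hD fun πhat _ => ?_
    rw [← hopt, OfflineRL.value_eq_of_card_eq_one hA M πstar πhat, sub_self]
    positivity
  have hA2 : (2 : ℝ) ≤ Fintype.card A := by
    have := Fintype.card_pos (α := A)
    exact_mod_cast (by omega : 2 ≤ Fintype.card A)
  have hX2 : 2 ≤ X := by
    calc (2 : ℝ) = 1 * 2 := by norm_num
      _ ≤ X := mul_le_mul hHS hA2 (by norm_num) (by positivity)
  have hX2δ : 2 ≤ X / δ := by rw [le_div_iff₀ hδ0]; linarith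
  have hL2 : 69 / 100 ≤ L := by
    have h1 := Real.log_le_log two_pos hX2δ
    have h2 := Real.log_two_gt_d9
    rw [← hLeq] at h1
    linarith
  -- If N < 80H²L, the higher-order term already exceeds H, which bounds every gap.
  by_cases hNL : 80 * (H : ℝ) ^ 2 * L ≤ N
  swap
  · refine htriv ∅ (by simp) fun D hD => hD fun πhat _ => (hgap πhat).trans ?_
    have h1 : (H : ℝ) ≤ 300000 * ((H : ℝ) ^ 3 * Λ ^ 3 / N) := by
      rw [← mul_div_assoc, le_div_iff₀ hN0]
      have h3 : 80 * L ≤ 300000 * Λ ^ 3 := by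
        have h4 : (69 / 100) ^ 2 ≤ Λ ^ 2 := pow_le_pow_left₀ (by norm_num) (hL2.trans hLΛ) 2
        nlinarith
      calc (H : ℝ) * N ≤ H * (80 * H ^ 2 * L) := by
            have := (not_le.1 hNL).le
            gcongr
        _ = H ^ 3 * (80 * L) := by ring
        _ ≤ H ^ 3 * (300000 * Λ ^ 3) := by gcongr
        _ = _ := by ring
    linarith
  -- If the leading square root exceeds H, the bound is trivial as well.
  by_cases hlead : √((H : ℝ) ^ 3 * Fintype.card S * c * L / n) ≤ H
  swap
  · refine htriv ∅ (by simp) fun D hD => hD fun πhat _ => (hgap πhat).trans ?_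
    linarith [not_le.1 hlead]
  have hNle : ∀ h s a, 0 < OfflineRL.occ M μ h s a → N ≤ n * OfflineRL.occ M μ h s a :=
    fun h s a hd => mul_le_mul_of_nonneg_left (hmle h s a hd) hn0.le
  refine htriv {D | ¬ OfflineRL.GoodData M μ πstar L N D}
    ((OfflineRL.measure_not_goodData_le hH hL0.le hN0 hn1 hNL hNle).trans
      (ENNReal.ofReal_le_ofReal ?_)) fun D hD hgood => hD fun πhat hout => ?_
  -- With x = exp(−L) = δ/X and δ = X·x, the claim is x² + (15 + 2S)x¹⁰ ≤ x. It follows from x ≤ 1/2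
  -- and S·x ≤ 1, the latter absorbing the factor S from the union over next states.
  · have hexp : Real.exp (-L) = δ / X := by
      rw [hLeq, Real.exp_neg, Real.exp_log (by positivity), inv_div]
    have hx0 := Real.exp_pos (-L)
    set x := Real.exp (-L) with hx
    have hx2 : x ≤ 1 / 2 := by
      rw [hexp, div_le_iff₀ (by positivity)]; linarith
    have hSx : Fintype.card S * x ≤ 1 := by
      rw [hexp, mul_div_assoc', div_le_iff₀ (by positivity), one_mul]
      have : (Fintype.card S : ℝ) ≤ X := by
        calc (Fintype.card S : ℝ) = 1 * Fintype.card S * 1 := by ring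
          _ ≤ X := by rw [hX]; gcongr
      nlinarith
    have e2 : Real.exp (-(2 * L)) = x ^ 2 := by rw [hx, ← Real.exp_nat_mul]; congr 1; push_cast; ring
    have e10 : Real.exp (-(10 * L)) = x ^ 10 := by
      rw [hx, ← Real.exp_nat_mul]; congr 1; push_cast; ring
    have hδ : δ = X * x := by rw [hexp]; field_simp
    change X * _ ≤ δ
    rw [e2, e10, hδ]
    refine mul_le_mul_of_nonneg_left ?_ (by positivity)
    have p8 : x ^ 8 ≤ (1 / 2) ^ 8 := pow_le_pow_left₀ hx0.le hx2 8
    have p9 : x ^ 9 ≤ (1 / 2) ^ 9 := pow_le_pow_left₀ hx0.le hx2 9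
    have q1 : Fintype.card S * x * x ^ 8 ≤ 1 * (1 / 2) ^ 8 :=
      mul_le_mul hSx p8 (by positivity) zero_le_one
    calc x ^ 2 + (15 + 2 * Fintype.card S) * x ^ 10
        = x * (x + 15 * x ^ 9 + 2 * (Fintype.card S * x * x ^ 8)) := by ring
      _ ≤ x * 1 := by
          refine mul_le_mul_of_nonneg_left ?_ hx0.le
          norm_num at p9 q1 ⊢
          linarith
      _ = x := mul_one x
  · have h1 := hgood.value_sub_value_le hH hn1 hdet hL2 hLΛ hnΛ hN0 hNle hNL
      ENNReal.toReal_nonneg (OfflineRL.occ_le_concentrability hconc) hlead hC hout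
    rw [← hopt]
    linarith
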